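/- Let $D$ be a diagram on the sphere of an unoriented link, with $N$ crossings (listed in some fixed order). A Kauffman state $s$ assigns a marker $\pm1$ to each crossing; smoothing the crossings according to the markers (the positive marker joins the two regions swept out by the upper strand when it is turned counterclockwise) gives a system $D_s$ of $|s|$ circles; $s_+$ and $s_-$ are the states with all markers positive, respectively negative. An enhanced state $S$ is a Kauffman state $s$ with a sign for each circle of $D_s$; let $\sigma(S)$ be the number of positive minus the number of negative markers, and $\tau(S)$ the number of positive minus the number of negative circles. Let $C_{i,j}(D)$ be the free abelian group on the enhanced states with $\sigma(S)=i$ and $\sigma(S)+2\tau(S)=j$, and let $d\colon C_{i,j}(D)\to C_{i-2,j}(D)$ be $d(S)=\sum_{S'}(-1)^{t(S:S')}[S:S']\,S'$, where $[S:S']=1$ if the markers of $S$ and $S'$ differ at exactly one crossing $v$, where that of $S$ is positive and that of $S'$ negative, and all circles not touching $v$ have the same sign in both, and $[S:S']=0$ otherwise ($S'$ ranging over the generators of $C_{i-2,j}(D)$), and $t(S:S')$ is the number of negative markers of $S$ at crossings bigger than $v$. The Khovanov homology is $H_{i,j}(D)=\ker\bigl(d|_{C_{i,j}(D)}\bigr)/d(C_{i+2,j}(D))$,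 and $T_{i,j}(D)$ is its torsion subgroup. For integers $k_1,k_2$, the diagram $D$ is called $H$-$(k_1,k_2)$-thick (respectively $TH$-$(k_1,k_2)$-thick) if $H_{i,j}(D)=0$ (respectively $T_{i,j}(D)=0$) for all $i,j$ except possibly those with $$N-2|s_-|-4k_2\le j-2i\le 2|s_+|-N+4k_1 .$$ Let $k\ge 0$ be an integer. Suppose that $D$ is non-split (not a disjoint union of two nonempty diagrams), has no nugatory crossing (no crossing at which two opposite corners belong to the same region), and is $k$-almost alternating (it becomes alternating after changing some $k$ of its crossings). Then $D$ is $H$-$(k,k)$-thick and $TH$-$(k,k-1)$-thick. -/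

import Mathlib

noncomputable section

/-- An (unoriented) link diagram on the 2-sphere, with crossings indexed by the finite set `V`,
given combinatorially (a planar diagram code).

At every crossing `v` the four half-edges are `(v, 0), (v, 1), (v, 2), (v, 3)`, listed in
counterclockwise cyclic order, in such a way that `(v, 0)` and `(v, 2)` are the two ends of the
lower strand, and `(v, 1)` and `(v, 3)` the two ends of the upper strand.
The fixed-point free involution `edge` tells which half-edges are joined by an edge.
`loops` is the number of components of the diagram that are simple closed curves without crossings.
Planarity of the resulting 4-valent rotation system is expressed by Euler's formula
`#vertices - #edges + #faces = 2 * #components`. -/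
structure LinkDiagram (V : Type*) [Fintype V] where
  edge : V × Fin 4 → V × Fin 4
  edge_edge : ∀ x, edge (edge x) = x
  edge_ne : ∀ x, edge x ≠ x
  loops : ℕ
  planar :
    Fintype.card V
        -- faces: from the half-edge `x` go along its edge, then turn to the next half-edge
        + Nat.card (Quot fun x y : V × Fin 4 => y = ((edge x).1, (edge x).2 + 1))
      = -- edges
        Nat.card (Quot fun x y : V × Fin 4 => y = edge x)
        -- connected components
        + 2 * Nat.card (Quot fun x y : V × Fin 4 => y = edge x ∨ x.1 = y.1)

namespace LinkDiagram

open Classical in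
/-- Renaming of the half-edges under crossing changes at the crossings in `F`: the names of the
half-edges at these crossings are shifted by one position. -/
def relabel {V : Type*} (F : Finset V) : V × Fin 4 ≃ V × Fin 4 where
  toFun x := if x.1 ∈ F then (x.1, x.2 + 1) else x
  invFun x := if x.1 ∈ F then (x.1, x.2 - 1) else x
  left_inv x := by by_cases h : x.1 ∈ F <;> simp [h]
  right_inv x := by by_cases h : x.1 ∈ F <;> simp [h]

theorem relabel_fst {V : Type*} (F : Finset V) (x : V × Fin 4) : (relabel F x).1 = x.1 := by
  by_cases h : x.1 ∈ F <;> simp [relabel, h]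

theorem relabel_rot {V : Type*} (F : Finset V) (x : V × Fin 4) :
    relabel F (x.1, x.2 + 1) = ((relabel F x).1, (relabel F x).2 + 1) := by
  by_cases h : x.1 ∈ F <;> simp [relabel, h]

variable {V : Type*} [Fintype V]

/-- The connected components of the diagram that contain a crossing. -/
def Component (D : LinkDiagram V) : Type _ :=
  Quot fun x y : V × Fin 4 => y = D.edge x ∨ x.1 = y.1

/-- The faces (regions) of the components with crossings. The class of the half-edge `(v, p)` is the
region that contains, near `v`, the corner between `(v, p - 1)` and `(v, p)`. -/
def Face (D : LinkDiagram V) : Type _ :=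
  Quot fun x y : V × Fin 4 => y = ((D.edge x).1, (D.edge x).2 + 1)

/-- The face at the corner of `v` between the half-edges `p - 1` and `p`. -/
def face (D : LinkDiagram V) (v : V) (p : Fin 4) : D.Face := Quot.mk _ (v, p)

/-- The diagram is not split: it is not a disjoint union of two nonempty diagrams. (The components
without crossings count as connected components too.) -/
def IsNonSplit (D : LinkDiagram V) : Prop :=
  Nat.card D.Component + D.loops ≤ 1

/-- A crossing is nugatory if two opposite corners at it belong to the same region, that is, if
some simple closed curve meets the diagram exactly in this crossing, running there between two
opposite corners. -/
def IsNugatory (D : LinkDiagram V) (v : V) : Prop :=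
  ∃ p : Fin 4, D.face v p = D.face v (p + 2)

/-- A half-edge belongs to the upper strand of its crossing. -/
def IsOver (x : V × Fin 4) : Prop := x.2 = 1 ∨ x.2 = 3

/-- Along every component over- and undercrossings alternate: every edge joins the end of an upper
strand to the end of a lower strand. -/
def IsAlternating (D : LinkDiagram V) : Prop :=
  ∀ x, IsOver (D.edge x) ↔ ¬ IsOver x

/-- The diagram obtained by changing all the crossings in `F` (upper and lower strand are exchanged
there; the underlying plane curve is the same). -/
def changeCrossings (D : LinkDiagram V) (F : Finset V) : LinkDiagram V where
  edge x := (relabel F).symm (D.edge (relabel F x))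
  edge_edge x := by simp [D.edge_edge]
  edge_ne x h := D.edge_ne (relabel F x) (by
    rw [Equiv.symm_apply_eq] at h; exact h)
  loops := D.loops
  planar := by
    have h1 := Nat.card_congr (Quot.congr
      (ra := fun x y : V × Fin 4 =>
        y = (((relabel F).symm (D.edge (relabel F x))).1,
          ((relabel F).symm (D.edge (relabel F x))).2 + 1))
      (rb := fun x y : V × Fin 4 => y = ((D.edge x).1, (D.edge x).2 + 1))
      (relabel F) (fun x y => by
        rw [← (relabel F).apply_eq_iff_eq, relabel_rot, Equiv.apply_symm_apply]))
    have h2 := Nat.card_congr (Quot.congr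
      (ra := fun x y : V × Fin 4 => y = (relabel F).symm (D.edge (relabel F x)))
      (rb := fun x y : V × Fin 4 => y = D.edge x)
      (relabel F) (fun x y => by rw [Equiv.eq_symm_apply]))
    have h3 := Nat.card_congr (Quot.congr
      (ra := fun x y : V × Fin 4 => y = (relabel F).symm (D.edge (relabel F x)) ∨ x.1 = y.1)
      (rb := fun x y : V × Fin 4 => y = D.edge x ∨ x.1 = y.1)
      (relabel F) (fun x y => by rw [Equiv.eq_symm_apply, relabel_fst, relabel_fst]))
    rw [h1, h2, h3]
    exact D.planar

/-- The diagram becomes alternating after changing `k` of its crossings. -/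
def IsAlmostAlternating (D : LinkDiagram V) (k : ℕ) : Prop :=
  ∃ F : Finset V, F.card = k ∧ (D.changeCrossings F).IsAlternating

/-! ### Kauffman states -/

/-- The half-edge to which `x` is joined when its crossing is smoothed according to the marker `m`.
The positive marker joins the two regions swept out by the upper strand when it is turned
counterclockwise, so the arcs of the positive smoothing join `0` with `1` and `2` with `3`; those
of the negative smoothing join `1` with `2` and `3` with `0`. -/
def smoothing (m : ℤˣ) (x : V × Fin 4) : V × Fin 4 :=
  (x.1, if m = 1 then ![1, 0, 3, 2] x.2 else ![3, 2, 1, 0] x.2)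

/-- The circles of the system `D_s` obtained by smoothing all crossings according to the markers of
the Kauffman state `s`: classes of half-edges, and the components without crossings. -/
def Circle (D : LinkDiagram V) (s : V → ℤˣ) : Type _ :=
  (Quot fun x y : V × Fin 4 => y = D.edge x ∨ y = smoothing (s x.1) x) ⊕ Fin D.loops

instance (D : LinkDiagram V) (s : V → ℤˣ) : Finite (D.Circle s) :=
  inferInstanceAs (Finite (_ ⊕ Fin D.loops))

instance (D : LinkDiagram V) (s : V → ℤˣ) : Fintype (D.Circle s) := Fintype.ofFinite _

/-- The circle of `D_s` that contains the half-edge `x`. -/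
def circle (D : LinkDiagram V) (s : V → ℤˣ) (x : V × Fin 4) : D.Circle s :=
  Sum.inl (Quot.mk _ x)

/-- The circle of `D_s` given by the `l`-th component without crossings. -/
def loop (D : LinkDiagram V) (s : V → ℤˣ) (l : Fin D.loops) : D.Circle s :=
  Sum.inr l

/-- `|s|`, the number of circles of `D_s`. -/
def numCircles (D : LinkDiagram V) (s : V → ℤˣ) : ℕ := Fintype.card (D.Circle s)

/-- `N`, the number of crossings. -/
def numCrossings (_D : LinkDiagram V) : ℕ := Fintype.card V

/-- `|s_+|`, the number of circles of the state with all markers positive. -/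
def numPos (D : LinkDiagram V) : ℕ := D.numCircles fun _ => 1

/-- `|s_-|`, the number of circles of the state with all markers negative. -/
def numNeg (D : LinkDiagram V) : ℕ := D.numCircles fun _ => -1

/-! ### Khovanov homology -/

/-- Enhanced Kauffman states: a Kauffman state `S.1` with a sign for each circle. -/
def EnhancedState (D : LinkDiagram V) : Type _ :=
  Σ s : V → ℤˣ, (D.Circle s → ℤˣ)

instance (D : LinkDiagram V) : Finite D.EnhancedState :=
  inferInstanceAs (Finite (Σ s : V → ℤˣ, (D.Circle s → ℤˣ)))

instance (D : LinkDiagram V) : Fintype D.EnhancedState := Fintype.ofFinite _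

variable {D : LinkDiagram V}

/-- `σ(S)`: the number of positive markers minus the number of negative markers. -/
def EnhancedState.sigma (S : D.EnhancedState) : ℤ := ∑ v, (S.1 v : ℤ)

/-- `τ(S)`: the number of positive circles minus the number of negative circles. -/
def EnhancedState.tau (S : D.EnhancedState) : ℤ := ∑ c, (S.2 c : ℤ)

/-- The half-edge `x` lies on a circle of `D_S` that touches the crossing `v`. -/
def EnhancedState.Touches (S : D.EnhancedState) (v : V) (x : V × Fin 4) : Prop :=
  ∃ p : Fin 4, D.circle S.1 x = D.circle S.1 (v, p)

/-- `[S : S'] = 1`, where `v` is the crossing at which the markers differ: the marker at `v` is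
positive in `S` and negative in `S'`, all other markers agree, all circles not touching `v` have
the same sign in `S` and `S'`, and `τ(S') = τ(S) + 1` (so that the second degree
`σ + 2 τ` is preserved). -/
def EnhancedState.Incident (S S' : D.EnhancedState) (v : V) : Prop :=
  S.1 v = 1 ∧ S'.1 v = -1 ∧ (∀ w, w ≠ v → S.1 w = S'.1 w) ∧
    (∀ x, ¬ S.Touches v x → S.2 (D.circle S.1 x) = S'.2 (D.circle S'.1 x)) ∧
    (∀ l, S.2 (D.loop S.1 l) = S'.2 (D.loop S'.1 l)) ∧
    S'.tau = S.tau + 1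

/-- `t(S : S')`: the number of negative markers of `S` at crossings bigger than `v`. -/
def EnhancedState.numNegAbove [LinearOrder V] (S : D.EnhancedState) (v : V) : ℕ :=
  (Finset.univ.filter fun w => v < w ∧ S.1 w = -1).card

open Classical in
/-- The coefficient `(-1)^t(S : S') [S : S']` of `S'` in `d S`. -/
def EnhancedState.coeff [LinearOrder V] (S S' : D.EnhancedState) : ℤ :=
  ∑ v, if S.Incident S' v then (-1) ^ S.numNegAbove v else 0

variable (D : LinkDiagram V)

/-- The free abelian group `C(D)` on the enhanced Kauffman states. -/
abbrev Chain : Type _ := D.EnhancedState →₀ ℤ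

/-- The subgroup `C_{i,j}(D)` spanned by the enhanced states with `σ = i` and `σ + 2 τ = j`. -/
def chainGrade (i j : ℤ) : Submodule ℤ D.Chain :=
  Finsupp.supported ℤ ℤ {S | S.sigma = i ∧ S.sigma + 2 * S.tau = j}

/-- The differential of `C(D)`; it maps `C_{i,j}(D)` to `C_{i-2,j}(D)`. -/
def differential [LinearOrder V] : D.Chain →ₗ[ℤ] D.Chain :=
  Finsupp.linearCombination ℤ fun S => ∑ S', Finsupp.single S' (S.coeff S')

/-- The cycles of degree `(i,j)`. -/
def cycles [LinearOrder V] (i j : ℤ) : Submodule ℤ D.Chain :=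
  LinearMap.ker D.differential ⊓ D.chainGrade i j

/-- The boundaries of degree `(i,j)`: the image of `C_{i+2,j}(D)` under the differential. -/
def boundaries [LinearOrder V] (i j : ℤ) : Submodule ℤ D.Chain :=
  (D.chainGrade (i + 2) j).map D.differential

/-- The Khovanov homology group `H_{i,j}(D)`. -/
abbrev Homology [LinearOrder V] (i j : ℤ) : Type _ :=
  D.cycles i j ⧸ (D.boundaries i j).submoduleOf (D.cycles i j)

/-- The torsion part `T_{i,j}(D)` of `H_{i,j}(D)`. -/
abbrev torsionPart [LinearOrder V] (i j : ℤ) : Submodule ℤ (D.Homology i j) :=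
  Submodule.torsion ℤ (D.Homology i j)

/-! ### Thickness -/

/-- The strip `N - 2|s_-| - 4 k₂ ≤ j - 2i ≤ 2|s_+| - N + 4 k₁`. -/
def InStrip (k₁ k₂ i j : ℤ) : Prop :=
  (D.numCrossings : ℤ) - 2 * D.numNeg - 4 * k₂ ≤ j - 2 * i ∧
    j - 2 * i ≤ 2 * D.numPos - D.numCrossings + 4 * k₁

/-- `D` is `H`-`(k₁,k₂)`-thick: `H_{i,j}(D) = 0` outside the strip. -/
def IsHThick [LinearOrder V] (k₁ k₂ : ℤ) : Prop :=
  ∀ i j : ℤ, ¬ D.InStrip k₁ k₂ i j → Subsingleton (D.Homology i j)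

/-- `D` is `TH`-`(k₁,k₂)`-thick: the torsion part of `H_{i,j}(D)` vanishes outside the strip. -/
def IsTHThick [LinearOrder V] (k₁ k₂ : ℤ) : Prop :=
  ∀ i j : ℤ, ¬ D.InStrip k₁ k₂ i j → D.torsionPart i j = ⊥

end LinkDiagram

end

/-! Everything is read off on the diagonals j - 2i = 2τ - σ, which d raises by 4. Put M = 2|s_+| - N
and m = N - 2|s_-|. Two facts carry the theorem.

Homological fact (`exactAt_and_torsionFreeAt`): for a connected diagram the homology vanishes on the
diagonals below M - 4 and above m + 4, and it has no torsion below M. Combinatorial fact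
(`numCrossings_add_two_le`): N + 2 ≤ |s_+| + |s_-| + 2k. The second one says that m - 4k ≤ M - 4,
equivalently m + 4 ≤ M + 4k and m - 4(k-1) ≤ M; these inequalities put the homology, respectively
its torsion, into the required strips.

The homological fact is an induction on the number of crossings that are not yet smoothed. If both
smoothings of some crossing leave the diagram connected, its complex is an extension of the complex
of the positive smoothing by that of the negative one, and the bounds pass through the long exact
sequence; torsion-freeness also uses that the quotient is exact in the source degree of d, which
lies 4 lower. Otherwise every crossing is disconnected by one of its smoothings. An innermost one is
then a kink (`exists_isKink`), and removing it as in a Reidemeister I move shifts both degrees but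
preserves j - 2i, M and m (`IsKink.exactAt`, `IsKink.torsionFreeAt`, `IsKink.diagonal_eq`). The
induction ends with at most one circle and no crossing.

For the combinatorial fact, Euler's formula gives at least N + 2 faces. After the k crossing changes
the diagram is alternating, so faces inject into the circles of two opposite states
(`card_face_le`). These states differ from s_- and s_+ in the k changed crossings only, and one
marker change alters the number of circles by at most one.

That a marker change always merges two circles or splits one (`joined_iff_not_joined`) comes from a
source-sink colouring of the half-edges, which is supplied by the upper strands of the alternating
diagram. That d squares to zero is seen in a ring with square-zero variables, where a split is an
inclusion and a merge is a multiplication, so that these maps visibly commute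
(`EnhancedState.edgeMap_edgeMap`). -/

noncomputable section

/-! ### Cycles of a permutation composed with a transposition -/

theorem Equiv.Perm.sameCycle_iff_not_sameCycle_of_swap {α : Type*} [Finite α] {f g : Equiv.Perm α}
    {x y : α} (hxy : x ≠ y) (hy : g y = f x) (h : ∀ z, z ≠ x → z ≠ y → g z = f z) :
    f.SameCycle x y ↔ ¬ g.SameCycle x y := by
  -- The g-orbit of y shadows the f-orbit of x until the latter meets x or y. So it closes up at y
  -- if y comes first, and runs into x if x comes first.
  have key : ∀ m : ℕ, (∀ i, 0 < i → i < m → (f ^ i) x ≠ x ∧ (f ^ i) x ≠ y) →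
      ∀ i, 0 < i → i ≤ m → (g ^ i) y = (f ^ i) x := by
    intro m hm i hi him
    induction i, hi using Nat.le_induction with
    | base => simpa using hy
    | succ i hi ih =>
      have h1 := hm i hi him
      rw [pow_succ', pow_succ', Equiv.Perm.mul_apply, Equiv.Perm.mul_apply, ih (by lia),
        h _ h1.1 h1.2]
  classical
  constructor
  · intro hf hg
    have hex : ∃ n : ℕ, (f ^ n) x = y := by
      obtain ⟨n, -, hn⟩ := hf.exists_pow_eq'
      exact ⟨n, hn⟩
    set n := Nat.find hex
    have hn1 : (f ^ n) x = y := Nat.find_spec hex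
    have hmin : ∀ i < n, (f ^ i) x ≠ y := fun i hi => Nat.find_min hex hi
    have hn0 : 0 < n := by
      rcases Nat.eq_zero_or_pos n with h0 | h0
      · rw [h0] at hn1; exact absurd hn1 hxy
      · exact h0
    -- An earlier return to x would make the f-orbit reach y before the minimal time n.
    have hx : ∀ i, 0 < i → i < n → (f ^ i) x ≠ x := by
      intro i hi hin hxi
      apply hmin (n - i) (by lia)
      rw [← hn1, ← Nat.sub_add_cancel hin.le, pow_add, Equiv.Perm.mul_apply, hxi]
      simp
    have hk := key n fun i hi hin => ⟨hx i hi hin, hmin i hin⟩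
    have hgn : (g ^ n) y = y := (hk n hn0 le_rfl).trans hn1
    obtain ⟨k, -, hk'⟩ := hg.symm.exists_pow_eq'
    have hmod : (g ^ (k % n)) y = x := by
      refine Eq.trans ?_ hk'
      conv_rhs => rw [← Nat.mod_add_div k n, pow_add, Equiv.Perm.mul_apply, pow_mul]
      congr 1
      exact (Equiv.Perm.pow_apply_eq_self_of_apply_eq_self hgn _).symm
    rcases Nat.eq_zero_or_pos (k % n) with h0 | h0
    · rw [h0] at hmod; exact hxy hmod.symm
    · have hlt := Nat.mod_lt k hn0
      exact hx _ h0 hlt ((hk _ h0 hlt.le).symm.trans hmod)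
  · intro hg
    by_contra hf
    have hex : ∃ n : ℕ, 0 < n ∧ (f ^ n) x = x :=
      ⟨orderOf f, orderOf_pos f, by simp [pow_orderOf_eq_one]⟩
    obtain ⟨hn0, hn1⟩ := Nat.find_spec hex
    have hk := key (Nat.find hex) fun i hi hin =>
      ⟨fun hx => Nat.find_min hex hin ⟨hi, hx⟩, fun hy' => hf ⟨i, by simpa using hy'⟩⟩
    exact hg (Equiv.Perm.SameCycle.symm ⟨Nat.find hex, by
      simpa using (hk _ hn0 le_rfl).trans hn1⟩)

/-! ### Circles of Kauffman states under the change of one marker -/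

namespace LinkDiagram

variable {V : Type*} [Fintype V] (D : LinkDiagram V)

theorem circle_edge (s : V → ℤˣ) (x : V × Fin 4) : D.circle s (D.edge x) = D.circle s x :=
  congrArg Sum.inl (Quot.sound (r := fun x y => y = D.edge x ∨ y = smoothing (s x.1) x)
    (Or.inl rfl)).symm

theorem circle_smoothing (s : V → ℤˣ) (x : V × Fin 4) :
    D.circle s (smoothing (s x.1) x) = D.circle s x :=
  congrArg Sum.inl (Quot.sound (r := fun x y => y = D.edge x ∨ y = smoothing (s x.1) x)
    (Or.inr rfl)).symm

variable {D}

/-- The universal property of the quotient. Statements about circles are proved by exhibiting a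
function constant along edges and smoothing arcs. -/
theorem circle_factor {α : Type*} {s : V → ℤˣ} (g : V × Fin 4 → α)
    (he : ∀ x, g (D.edge x) = g x) (hs : ∀ x, g (smoothing (s x.1) x) = g x)
    {x y : V × Fin 4} (h : D.circle s x = D.circle s y) : g x = g y := by
  have h' := Sum.inl_injective h
  refine congrArg (Quot.lift g ?_) h'
  rintro a b (rfl | rfl)
  · exact (he a).symm
  · exact (hs a).symm

theorem circle_pos {s : V → ℤˣ} {v : V} (h : s v = 1) :
    D.circle s (v, 0) = D.circle s (v, 1) ∧ D.circle s (v, 2) = D.circle s (v, 3) := by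
  have h0 := D.circle_smoothing s (v, 0)
  have h2 := D.circle_smoothing s (v, 2)
  simp only [smoothing, h, if_true] at h0 h2
  exact ⟨h0.symm, h2.symm⟩

theorem circle_neg {s : V → ℤˣ} {v : V} (h : s v = -1) :
    D.circle s (v, 0) = D.circle s (v, 3) ∧ D.circle s (v, 2) = D.circle s (v, 1) := by
  have h0 := D.circle_smoothing s (v, 0)
  have h2 := D.circle_smoothing s (v, 2)
  simp only [smoothing, h, if_neg (show (-1 : ℤˣ) ≠ 1 by decide)] at h0 h2
  exact ⟨h0.symm, h2.symm⟩

variable (D) in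
/-- The circles of `D_s` near the crossing `v` are only one. -/
def Joined (s : V → ℤˣ) (v : V) : Prop := D.circle s (v, 0) = D.circle s (v, 2)

theorem Joined.circle_eq {s : V → ℤˣ} {v : V} (h : D.Joined s v) (p q : Fin 4) :
    D.circle s (v, p) = D.circle s (v, q) := by
  suffices ∀ p, D.circle s (v, p) = D.circle s (v, 0) from (this p).trans (this q).symm
  intro p
  unfold Joined at h
  rcases Int.units_eq_one_or (s v) with hs | hs
  · have := circle_pos (D := D) hs
    fin_cases p <;> simp <;> grind
  · have := circle_neg (D := D) hs
    fin_cases p <;> simp <;> grind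

theorem joined_of_circle_eq {s : V → ℤˣ} {v : V} {p : Fin 4}
    (h : D.circle s (v, p) = D.circle s (v, p + 2)) : D.Joined s v := by
  unfold Joined
  rcases Int.units_eq_one_or (s v) with hs | hs
  · have := circle_pos (D := D) hs
    fin_cases p <;> simp at h <;> grind
  · have := circle_neg (D := D) hs
    fin_cases p <;> simp at h <;> grind

theorem circle_eq_or_opposite (s : V → ℤˣ) (v : V) (p q : Fin 4) :
    D.circle s (v, q) = D.circle s (v, p) ∨ D.circle s (v, q) = D.circle s (v, p + 2) := by
  rcases Int.units_eq_one_or (s v) with hs | hs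
  · have := circle_pos (D := D) hs
    fin_cases p <;> fin_cases q <;> simp <;> grind
  · have := circle_neg (D := D) hs
    fin_cases p <;> fin_cases q <;> simp <;> grind

theorem smoothing_fst {V : Type*} (m : ℤˣ) (x : V × Fin 4) : (smoothing m x).1 = x.1 := rfl

theorem smoothing_smoothing {V : Type*} (m : ℤˣ) (x : V × Fin 4) : smoothing m (smoothing m x) = x := by
  obtain ⟨v, p⟩ := x
  unfold smoothing
  split_ifs <;> fin_cases p <;> rfl

section

variable {t t' : V → ℤˣ} {v : V}

/-- All four half-edges at `v` lie on one circle of `t'`, so the arcs which `t` has there join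
nothing new. -/
theorem circle_eq_of_joined (h : ∀ w, w ≠ v → t w = t' w) (hj : D.Joined t' v)
    {x y : V × Fin 4} (hxy : D.circle t x = D.circle t y) : D.circle t' x = D.circle t' y := by
  refine circle_factor (D.circle t') (D.circle_edge t') (fun x => ?_) hxy
  obtain ⟨w, p⟩ := x
  by_cases hw : w = v
  · subst hw
    exact hj.circle_eq _ _
  · rw [h _ hw]
    exact D.circle_smoothing t' (w, p)

theorem circle_eq_or_of_circle_eq (h : ∀ w, w ≠ v → t w = t' w) (p : Fin 4)
    {x y : V × Fin 4} (hxy : D.circle t' x = D.circle t' y) : D.circle t x = D.circle t y ∨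
      ((D.circle t x = D.circle t (v, p) ∨ D.circle t x = D.circle t (v, p + 2)) ∧
        (D.circle t y = D.circle t (v, p) ∨ D.circle t y = D.circle t (v, p + 2))) := by
  classical
  -- Merging the (at most two) circles of `t` at `v` into one class gives a function that every
  -- smoothing of `v` respects.
  let g : V × Fin 4 → D.Circle t := fun x =>
    if D.circle t x = D.circle t (v, p) ∨ D.circle t x = D.circle t (v, p + 2)
    then D.circle t (v, p) else D.circle t x
  have hg : g x = g y := by
    refine circle_factor g (fun x => ?_) (fun x => ?_) hxy
    · simp only [g, D.circle_edge]
    · obtain ⟨w, q⟩ := x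
      by_cases hw : w = v
      · subst hw
        have h1 := circle_eq_or_opposite (D := D) t w p q
        have h2 := circle_eq_or_opposite (D := D) t w p (smoothing (t' w) (w, q)).2
        have h2' : D.circle t (smoothing (t' w) (w, q)) = D.circle t (w, p) ∨
          D.circle t (smoothing (t' w) (w, q)) = D.circle t (w, p + 2) := h2
        simp only [g]
        rw [if_pos h1, if_pos h2']
      · have : D.circle t (smoothing (t' w) (w, q)) = D.circle t (w, q) := by
          rw [← h w hw]; exact D.circle_smoothing t (w, q)
        simp only [g, this]
  simp only [g] at hg
  split_ifs at hg with h1 h2 h2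
  · exact Or.inr ⟨h1, h2⟩
  · exact absurd (Or.inl hg.symm) h2
  · exact absurd (Or.inl hg) h1
  · exact Or.inl hg

end

/-- `ev` is a colouring of the half-edges which alternates along the edges and around the crossings
(a source-sink orientation of the underlying curve). -/
structure IsSourceSink (D : LinkDiagram V) (ev : V × Fin 4 → Bool) : Prop where
  edge : ∀ x, ev (D.edge x) = !ev x
  rot : ∀ v p, ev (v, p + 1) = !ev (v, p)

theorem IsSourceSink.apply_eq {ev : V × Fin 4 → Bool} (hev : D.IsSourceSink ev) (v : V) :
    ev (v, 1) = (!ev (v, 0)) ∧ ev (v, 2) = ev (v, 0) ∧ ev (v, 3) = !ev (v, 0) := by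
  have h1 : ev (v, 1) = !ev (v, 0) := hev.rot v 0
  have h2 : ev (v, 2) = !ev (v, 1) := hev.rot v 1
  have h3 : ev (v, 3) = !ev (v, 2) := hev.rot v 2
  simp [h1, h2, h3]

theorem IsSourceSink.smoothing {ev : V × Fin 4 → Bool} (hev : D.IsSourceSink ev) (m : ℤˣ)
    (x : V × Fin 4) : ev (smoothing m x) = !ev x := by
  obtain ⟨v, p⟩ := x
  obtain ⟨h1, h2, h3⟩ := hev.apply_eq v
  unfold LinkDiagram.smoothing
  split_ifs <;> fin_cases p <;> simp [h1, h2, h3]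

/-- The permutation of the half-edges of one colour whose cycles are the circles of `D_s`. -/
def circlePerm {ev : V × Fin 4 → Bool} (hev : D.IsSourceSink ev) (s : V → ℤˣ) :
    Equiv.Perm {x : V × Fin 4 // ev x = true} where
  toFun x := ⟨D.edge (smoothing (s x.1.1) x.1), by
    rw [hev.edge, hev.smoothing, Bool.not_not, x.2]⟩
  invFun x := ⟨smoothing (s (D.edge x.1).1) (D.edge x.1), by
    rw [hev.smoothing, hev.edge, Bool.not_not, x.2]⟩
  left_inv x := Subtype.ext (by simp [D.edge_edge, smoothing_fst, smoothing_smoothing])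
  right_inv x := Subtype.ext (by
    change D.edge (smoothing (s (smoothing _ (D.edge x.1)).1) (smoothing _ (D.edge x.1))) = _
    rw [smoothing_fst, smoothing_smoothing, D.edge_edge])

/-- A circle alternates between arcs and edges, and both flip the colour. Hence "arc, then edge"
preserves the colour and runs once around the circle. -/
theorem sameCycle_circlePerm_iff {ev : V × Fin 4 → Bool} (hev : D.IsSourceSink ev) (s : V → ℤˣ)
    (x y : {x : V × Fin 4 // ev x = true}) :
    (circlePerm hev s).SameCycle x y ↔ D.circle s x.1 = D.circle s y.1 := by
  have hstep : ∀ x, D.circle s (circlePerm hev s x).1 = D.circle s x.1 := fun x => by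
    change D.circle s (D.edge (smoothing (s x.1.1) x.1)) = _
    rw [D.circle_edge, D.circle_smoothing]
  constructor
  · intro h
    obtain ⟨n, -, rfl⟩ := h.exists_pow_eq'
    induction n with
    | zero => rfl
    | succ n ih => rw [pow_succ', Equiv.Perm.mul_apply, hstep, ← ih ⟨n, by simp⟩]
  · intro h
    let S := Equiv.Perm.SameCycle.setoid (circlePerm hev s)
    -- A half-edge of the wrong colour is represented by the other end of its edge.
    let g : V × Fin 4 → Quotient S := fun x =>
      if hx : ev x = true then Quotient.mk S ⟨x, hx⟩
      else Quotient.mk S ⟨D.edge x, by rw [hev.edge]; simpa using hx⟩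
    have hgp : ∀ x (hx : ev x = true), g x = Quotient.mk S ⟨x, hx⟩ := fun x hx => dif_pos hx
    have hgn : ∀ x (hx : ¬ ev x = true), g x = Quotient.mk S ⟨D.edge x, by
      rw [hev.edge]; simpa using hx⟩ := fun x hx => dif_neg hx
    have hg : g x.1 = g y.1 := by
      refine circle_factor g (fun x => ?_) (fun x => ?_) h
      · by_cases hx : ev x = true
        · have : ¬ ev (D.edge x) = true := by rw [hev.edge, hx]; simp
          rw [hgp x hx, hgn _ this]
          exact congrArg _ (Subtype.ext (D.edge_edge x))
        · have : ev (D.edge x) = true := by rw [hev.edge]; simpa using hx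
          rw [hgp _ this, hgn x hx]
      · by_cases hx : ev x = true
        · have : ¬ ev (LinkDiagram.smoothing (s x.1) x) = true := by
            rw [hev.smoothing, hx]; simp
          rw [hgn _ this, hgp x hx]
          exact Quotient.sound (Equiv.Perm.SameCycle.symm ⟨1, by simp; rfl⟩)
        · have : ev (LinkDiagram.smoothing (s x.1) x) = true := by
            rw [hev.smoothing]; simpa using hx
          rw [hgp _ this, hgn x hx]
          refine Quotient.sound ⟨1, ?_⟩
          simp only [zpow_one]
          refine Subtype.ext ?_
          change D.edge (smoothing (s (smoothing _ x).1) (smoothing _ x)) = _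
          rw [smoothing_fst, smoothing_smoothing]
    rw [hgp _ x.2, hgp _ y.2] at hg
    exact Quotient.exact hg

/-- Two opposite half-edges at `v` have the same colour, and the circle permutations of the two
states differ by the transposition of those two. So a marker change never turns one circle at `v`
into one circle. -/
theorem joined_iff_not_joined {ev : V × Fin 4 → Bool} (hev : D.IsSourceSink ev)
    {t t' : V → ℤˣ} {v : V} (h : ∀ w, w ≠ v → t w = t' w) (hv : t v ≠ t' v) :
    D.Joined t v ↔ ¬ D.Joined t' v := by
  have hp : ∃ p, ev (v, p) = true := by
    by_contra! hne
    have h0 := hev.rot v 0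
    simp [hne] at h0
  obtain ⟨p, hp⟩ := hp
  have hp2 : ev (v, p + 2) = true := by
    have : p + 2 = p + 1 + 1 := by rw [add_assoc]; rfl
    rw [this, hev.rot, hev.rot, hp]; rfl
  have hj : ∀ s, D.Joined s v ↔ (circlePerm hev s).SameCycle ⟨(v, p), hp⟩ ⟨(v, p + 2), hp2⟩ :=
    fun s => by
      rw [sameCycle_circlePerm_iff]
      exact ⟨fun h => h.circle_eq _ _, joined_of_circle_eq⟩
  rw [hj, hj]
  apply Equiv.Perm.sameCycle_iff_not_sameCycle_of_swap
  · intro he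
    have := congrArg (fun x => x.1.2) he
    simp at this
  -- The other smoothing carries the half-edge opposite to `p` to where the first one carries `p`.
  · refine Subtype.ext (congrArg D.edge ?_)
    simp only [smoothing]
    rcases Int.units_eq_one_or (t v) with h1 | h1 <;>
      rcases Int.units_eq_one_or (t' v) with h2 | h2 <;> rw [h1, h2] at hv ⊢ <;>
      first | exact absurd rfl hv | (fin_cases p <;> simp)
  · rintro ⟨⟨w, q⟩, hq⟩ hz1 hz2
    refine Subtype.ext (congrArg D.edge ?_)
    by_cases hw : w = v
    · subst hw
      exfalso
      obtain ⟨h1, h2, h3⟩ := hev.apply_eq w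
      have e1 := fun e : q = p => hz1 (by subst e; rfl)
      have e2 := fun e : q = p + 2 => hz2 (by subst e; rfl)
      clear hj hz1 hz2 hp2
      fin_cases p <;> fin_cases q <;> simp_all
    · simp only [h w hw]

end LinkDiagram

/-! ### Counting circles, signs of circles, and the merge and split rules -/

namespace LinkDiagram

variable {V : Type*} [Fintype V] {D : LinkDiagram V}

theorem exists_circle_eq (hl : D.loops = 0) {s : V → ℤˣ} (c : D.Circle s) :
    ∃ x, D.circle s x = c := by
  rcases c with c | c
  · obtain ⟨x, rfl⟩ := Quot.exists_rep c
    exact ⟨x, rfl⟩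
  · exact (Fin.cast hl c).elim0

section

variable {t t' : V → ℤˣ} {v : V}

/-- The circles away from `v` correspond bijectively, and the two circles of `t` at `v` become the
single one of `t'`. With constant summands this counts circles, with signs it compares `τ`. -/
theorem sum_circle_of_joined (hl : D.loops = 0) (h : ∀ w, w ≠ v → t w = t' w)
    (hj : ¬ D.Joined t v) (hj' : D.Joined t' v) (p : Fin 4) (g : D.Circle t → ℤ)
    (g' : D.Circle t' → ℤ)
    (hg : ∀ x, D.circle t' x ≠ D.circle t' (v, 0) → g (D.circle t x) = g' (D.circle t' x)) :
    ∑ c, g c = ∑ c, g' c + g (D.circle t (v, p)) + g (D.circle t (v, p + 2))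
      - g' (D.circle t' (v, 0)) := by
  classical
  have hne : D.circle t (v, p) ≠ D.circle t (v, p + 2) := fun h => hj (joined_of_circle_eq h)
  have hiff : ∀ x, D.circle t' x = D.circle t' (v, 0) ↔
      D.circle t x = D.circle t (v, p) ∨ D.circle t x = D.circle t (v, p + 2) := by
    intro x
    constructor
    · intro hx
      rcases circle_eq_or_of_circle_eq h p hx with hx | hx
      · rw [hx]; exact circle_eq_or_opposite t v p 0
      · exact hx.1
    · rintro (hx | hx)
      · rw [circle_eq_of_joined h hj' hx]; exact hj'.circle_eq _ _
      · rw [circle_eq_of_joined h hj' hx]; exact hj'.circle_eq _ _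
  have hrest : ∑ c ∈ Finset.univ \ {D.circle t (v, p), D.circle t (v, p + 2)}, g c =
      ∑ c ∈ Finset.univ \ {D.circle t' (v, 0)}, g' c := by
    choose r hr using fun c : D.Circle t => exists_circle_eq hl c
    refine Finset.sum_bij (fun c _ => D.circle t' (r c)) ?_ ?_ ?_ ?_
    · intro c hc
      simp only [Finset.mem_sdiff, Finset.mem_univ, true_and, Finset.mem_insert,
        Finset.mem_singleton] at hc ⊢
      rwa [hiff, hr]
    · intro c hc c' hc' he
      simp only [Finset.mem_sdiff, Finset.mem_univ, true_and, Finset.mem_insert,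
        Finset.mem_singleton] at hc hc'
      rcases circle_eq_or_of_circle_eq h p he with hx | hx
      · rwa [hr, hr] at hx
      · rw [hr] at hx; exact absurd hx.1 hc
    · intro c hc
      obtain ⟨x, rfl⟩ := exists_circle_eq hl c
      simp only [Finset.mem_sdiff, Finset.mem_univ, true_and, Finset.mem_singleton] at hc
      refine ⟨D.circle t x, ?_, circle_eq_of_joined h hj' (hr _)⟩
      simp only [Finset.mem_sdiff, Finset.mem_univ, true_and, Finset.mem_insert,
        Finset.mem_singleton]
      rwa [← hiff]
    · intro c hc
      simp only [Finset.mem_sdiff, Finset.mem_univ, true_and, Finset.mem_insert,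
        Finset.mem_singleton] at hc
      rw [← hg, hr]
      rwa [Ne, hiff, hr]
  have h1 := Finset.sum_sdiff (f := g)
    (Finset.subset_univ {D.circle t (v, p), D.circle t (v, p + 2)})
  have h2 := Finset.sum_sdiff (f := g') (Finset.subset_univ {D.circle t' (v, 0)})
  rw [Finset.sum_pair hne] at h1
  rw [Finset.sum_singleton] at h2
  linarith

theorem numCircles_of_joined (hl : D.loops = 0) (h : ∀ w, w ≠ v → t w = t' w)
    (hj : ¬ D.Joined t v) (hj' : D.Joined t' v) : D.numCircles t = D.numCircles t' + 1 := by
  have := sum_circle_of_joined hl h hj hj' 0 (fun _ => 1) (fun _ => 1) fun _ _ => rfl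
  simp only [Finset.sum_const, Finset.card_univ, mul_one, nsmul_eq_mul] at this
  unfold numCircles
  linarith

theorem numCircles_le_succ {ev : V × Fin 4 → Bool} (hev : D.IsSourceSink ev) (hl : D.loops = 0)
    (h : ∀ w, w ≠ v → t w = t' w) : D.numCircles t ≤ D.numCircles t' + 1 := by
  by_cases hv : t v = t' v
  · have : t = t' := funext fun w => by
      by_cases hw : w = v
      · rw [hw, hv]
      · exact h w hw
    rw [this]; lia
  · have hK := joined_iff_not_joined hev h hv
    by_cases hj : D.Joined t' v
    · exact (numCircles_of_joined hl h (fun hc => hK.1 hc hj) hj).le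
    · have := numCircles_of_joined hl (fun w hw => (h w hw).symm) hj (hK.2 hj)
      lia

end

namespace EnhancedState

/-- The sign of the circle of `D_S` that contains the half-edge `x`. -/
def sgn (S : D.EnhancedState) (x : V × Fin 4) : ℤˣ := S.2 (D.circle S.1 x)

theorem sgn_congr (S : D.EnhancedState) {x y : V × Fin 4}
    (h : D.circle S.1 x = D.circle S.1 y) : S.sgn x = S.sgn y := congrArg S.2 h

theorem ext_sgn (hl : D.loops = 0) {S S' : D.EnhancedState} (h : S.1 = S'.1)
    (hs : ∀ x, S.sgn x = S'.sgn x) : S = S' := by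
  obtain ⟨s, f⟩ := S
  obtain ⟨s', f'⟩ := S'
  dsimp only at h
  subst h
  congr 1
  funext c
  obtain ⟨x, rfl⟩ := exists_circle_eq hl c
  exact hs x

/-- The enhanced state with markers `t` and given signs of the half-edges. -/
def ofSgn (hl : D.loops = 0) (t : V → ℤˣ) (f : V × Fin 4 → ℤˣ) : D.EnhancedState :=
  ⟨t, fun c => f (exists_circle_eq hl c).choose⟩

theorem ofSgn_fst (hl : D.loops = 0) (t : V → ℤˣ) (f : V × Fin 4 → ℤˣ) :
    (ofSgn (D := D) hl t f).1 = t := rfl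

theorem sgn_ofSgn (hl : D.loops = 0) (t : V → ℤˣ) (f : V × Fin 4 → ℤˣ)
    (hf : ∀ x y, D.circle t x = D.circle t y → f x = f y) (x : V × Fin 4) :
    (ofSgn (D := D) hl t f).sgn x = f x :=
  hf _ _ (exists_circle_eq hl (D.circle t x)).choose_spec

theorem abs_tau_le (S : D.EnhancedState) : |S.tau| ≤ D.numCircles S.1 := by
  refine (Finset.abs_sum_le_sum_abs _ _).trans ?_
  simp [numCircles, Int.abs_eq_natAbs]

theorem tau_of_joined (hl : D.loops = 0) {S S' : D.EnhancedState} {v : V}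
    (h : ∀ w, w ≠ v → S.1 w = S'.1 w) (hj : ¬ D.Joined S.1 v) (hj' : D.Joined S'.1 v)
    (p : Fin 4)
    (hs : ∀ x, D.circle S'.1 x ≠ D.circle S'.1 (v, 0) → S.sgn x = S'.sgn x) :
    S.tau = S'.tau + S.sgn (v, p) + S.sgn (v, p + 2) - S'.sgn (v, 0) :=
  sum_circle_of_joined hl h hj hj' p (fun c => (S.2 c : ℤ)) (fun c => (S'.2 c : ℤ))
    fun x hx => congrArg _ (hs x hx)

theorem incident_iff (hl : D.loops = 0) {S S' : D.EnhancedState} {v : V} :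
    S.Incident S' v ↔ S.1 v = 1 ∧ S'.1 v = -1 ∧ (∀ w, w ≠ v → S.1 w = S'.1 w) ∧
      (∀ x, (∀ p, D.circle S.1 x ≠ D.circle S.1 (v, p)) → S.sgn x = S'.sgn x) ∧
      S'.tau = S.tau + 1 := by
  unfold Incident Touches sgn
  simp only [not_exists]
  constructor
  · rintro ⟨h1, h2, h3, h4, -, h6⟩
    exact ⟨h1, h2, h3, h4, h6⟩
  · rintro ⟨h1, h2, h3, h4, h6⟩
    exact ⟨h1, h2, h3, h4, fun l => (Fin.cast hl l).elim0, h6⟩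

end EnhancedState

/-- The circles not meeting the crossing `v` are the same in `D_t` and `D_t'`. -/
theorem forall_circle_ne_iff {t t' : V → ℤˣ} {v : V} (h : ∀ w, w ≠ v → t w = t' w)
    (x : V × Fin 4) : (∀ p, D.circle t x ≠ D.circle t (v, p)) ↔
      ∀ p, D.circle t' x ≠ D.circle t' (v, p) := by
  suffices ∀ t t' : V → ℤˣ, (∀ w, w ≠ v → t w = t' w) →
      (∀ p, D.circle t x ≠ D.circle t (v, p)) → ∀ p, D.circle t' x ≠ D.circle t' (v, p) from
    ⟨this t t' h, this t' t fun w hw => (h w hw).symm⟩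
  intro t t' h hx p hp
  rcases circle_eq_or_of_circle_eq h 0 hp with h1 | ⟨h1 | h1, -⟩
  exacts [hx _ h1, hx _ h1, hx _ h1]

theorem forall_circle_ne_iff_of_joined {t : V → ℤˣ} {v : V} (h : D.Joined t v)
    (x : V × Fin 4) : (∀ p, D.circle t x ≠ D.circle t (v, p)) ↔
      D.circle t x ≠ D.circle t (v, 0) :=
  ⟨fun hx => hx 0, fun hx p => by rwa [h.circle_eq p 0]⟩

/-- All circles away from `v` contribute equally to both values of `τ`, so the condition on `τ`
becomes a relation among the three signs at `v`. The free choice of `p` lets a kink name its own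
side. -/
theorem EnhancedState.incident_iff_of_merge (hl : D.loops = 0) {S S' : D.EnhancedState} {v : V}
    (h1 : S.1 v = 1) (h2 : S'.1 v = -1) (h : ∀ w, w ≠ v → S.1 w = S'.1 w)
    (hj : ¬ D.Joined S.1 v) (hj' : D.Joined S'.1 v) (p : Fin 4) :
    S.Incident S' v ↔
      (∀ x, D.circle S'.1 x ≠ D.circle S'.1 (v, 0) → S.sgn x = S'.sgn x) ∧
      (S'.sgn (v, 0) : ℤ) = S.sgn (v, p) + S.sgn (v, p + 2) + 1 := by
  rw [incident_iff hl]
  simp only [forall_circle_ne_iff h, forall_circle_ne_iff_of_joined hj']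
  constructor
  · rintro ⟨-, -, -, h4, h5⟩
    have := tau_of_joined hl h hj hj' p h4
    exact ⟨h4, by linarith⟩
  · rintro ⟨h4, h5⟩
    have := tau_of_joined hl h hj hj' p h4
    exact ⟨h1, h2, h, h4, by linarith⟩

theorem EnhancedState.incident_iff_of_split (hl : D.loops = 0) {S S' : D.EnhancedState} {v : V}
    (h1 : S.1 v = 1) (h2 : S'.1 v = -1) (h : ∀ w, w ≠ v → S.1 w = S'.1 w)
    (hj : D.Joined S.1 v) (hj' : ¬ D.Joined S'.1 v) (p : Fin 4) :
    S.Incident S' v ↔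
      (∀ x, D.circle S.1 x ≠ D.circle S.1 (v, 0) → S.sgn x = S'.sgn x) ∧
      (S'.sgn (v, p) : ℤ) + S'.sgn (v, p + 2) = S.sgn (v, 0) + 1 := by
  rw [incident_iff hl]
  simp only [forall_circle_ne_iff_of_joined hj]
  have h' : ∀ w, w ≠ v → S'.1 w = S.1 w := fun w hw => (h w hw).symm
  constructor
  · rintro ⟨-, -, -, h4, h5⟩
    have := tau_of_joined hl h' hj' hj p fun x hx => (h4 x hx).symm
    exact ⟨h4, by linarith⟩
  · rintro ⟨h4, h5⟩
    have := tau_of_joined hl h' hj' hj p fun x hx => (h4 x hx).symm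
    exact ⟨h1, h2, h, h4, by linarith⟩

end LinkDiagram

/-! ### Squares of the cube of states and the ring model of the differential -/

namespace LinkDiagram

variable {V : Type*} [Fintype V] {D : LinkDiagram V}

/-- How the smoothings at two crossings `v` and `w` interact: either changing the marker at one of
them does not influence whether the other one is joined, or both are influenced, and then the
circles at `v` are those at `w`. -/
theorem joined_square {ev : V × Fin 4 → Bool} (hev : D.IsSourceSink ev) (hl : D.loops = 0)
    {t t₁ t₂ t₃ : V → ℤˣ} {v w : V} (h₁ : ∀ u, u ≠ v → t u = t₁ u) (hv₁ : t v ≠ t₁ v)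
    (h₂ : ∀ u, u ≠ w → t u = t₂ u) (hw₂ : t w ≠ t₂ w)
    (h₁₃ : ∀ u, u ≠ w → t₁ u = t₃ u) (hw₃ : t₁ w ≠ t₃ w)
    (h₂₃ : ∀ u, u ≠ v → t₂ u = t₃ u) (hv₃ : t₂ v ≠ t₃ v) :
    ((D.Joined t v ↔ D.Joined t₂ v) ∧ (D.Joined t w ↔ D.Joined t₁ w)) ∨
    ((D.Joined t v ∧ D.Joined t w ∧ ¬ D.Joined t₂ v ∧ ¬ D.Joined t₁ w) ∧
      D.circle t (v, 0) = D.circle t (w, 0)) ∨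
    ((¬ D.Joined t v ∧ ¬ D.Joined t w ∧ D.Joined t₂ v ∧ D.Joined t₁ w) ∧
      (D.circle t (v, 0) = D.circle t (w, 0) ∧ D.circle t (v, 2) = D.circle t (w, 2) ∨
        D.circle t (v, 0) = D.circle t (w, 2) ∧ D.circle t (v, 2) = D.circle t (w, 0))) := by
  have key : ∀ {t₁ t₂ t₃ : V → ℤˣ} {v w : V} (_ : ∀ u, u ≠ v → t u = t₁ u) (_ : t v ≠ t₁ v)
      (_ : ∀ u, u ≠ w → t u = t₂ u) (_ : t w ≠ t₂ w)
      (_ : ∀ u, u ≠ w → t₁ u = t₃ u) (_ : t₁ w ≠ t₃ w)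
      (_ : ∀ u, u ≠ v → t₂ u = t₃ u) (_ : t₂ v ≠ t₃ v), ¬ (D.Joined t v ↔ D.Joined t₂ v) →
      ((D.Joined t v ∧ D.Joined t w ∧ ¬ D.Joined t₂ v ∧ ¬ D.Joined t₁ w) ∧
        D.circle t (v, 0) = D.circle t (w, 0)) ∨
      ((¬ D.Joined t v ∧ ¬ D.Joined t w ∧ D.Joined t₂ v ∧ D.Joined t₁ w) ∧
        (D.circle t (v, 0) = D.circle t (w, 0) ∧ D.circle t (v, 2) = D.circle t (w, 2) ∨
          D.circle t (v, 0) = D.circle t (w, 2) ∧ D.circle t (v, 2) = D.circle t (w, 0))) := by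
    intro t₁ t₂ t₃ v w h₁ hv₁ h₂ hw₂ h₁₃ hw₃ h₂₃ hv₃ hne
    have K₁ := joined_iff_not_joined hev h₁ hv₁
    have K₂ := joined_iff_not_joined hev h₂ hw₂
    have K₁₃ := joined_iff_not_joined hev h₁₃ hw₃
    have K₂₃ := joined_iff_not_joined hev h₂₃ hv₃
    have h₂' : ∀ u, u ≠ w → t₂ u = t u := fun u hu => (h₂ u hu).symm
    by_cases ha : D.Joined t v
    · have ha' : ¬ D.Joined t₂ v := fun h => hne ⟨fun _ => h, fun _ => ha⟩
      have hb : D.Joined t w := by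
        -- If two circles met at `w`, the other marker there would merge them, and merging cannot
        -- separate the circle at `v`.
        by_contra hb
        exact ha' (circle_eq_of_joined h₂ (by by_contra h; exact hb (K₂.2 h)) ha)
      have hcirc : D.circle t (v, 0) = D.circle t (w, 0) := by
        rcases circle_eq_or_of_circle_eq h₂' 0 ha with h | ⟨h | h, -⟩
        · exact absurd h ha'
        · exact circle_eq_of_joined h₂' hb h
        · exact (circle_eq_of_joined h₂' hb h).trans (hb.circle_eq _ _)
      refine Or.inl ⟨⟨ha, hb, ha', fun hb' => ?_⟩, hcirc⟩
      -- Circle counts exclude this case: passing through `t₁` the state `t₃` would have two circles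
      -- more than `t`, passing through `t₂` equally many.
      have n₁ := numCircles_of_joined hl (fun u hu => (h₁ u hu).symm) (K₁.1 ha) ha
      have n₂ := numCircles_of_joined hl h₂' (K₂.1 hb) hb
      have n₃ := numCircles_of_joined hl (fun u hu => (h₁₃ u hu).symm) (K₁₃.1 hb') hb'
      have n₄ := numCircles_of_joined hl h₂₃ ha' (by by_contra h; exact ha' (K₂₃.2 h))
      lia
    · have ha' : D.Joined t₂ v := by
        by_contra h; exact hne ⟨fun h' => absurd h' ha, fun h' => absurd h' h⟩
      have hb : ¬ D.Joined t w := fun hb => ha (circle_eq_of_joined h₂' hb ha')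
      have hj₁ : D.Joined t₁ v := by by_contra h; exact ha (K₁.2 h)
      have hcirc : D.circle t (v, 0) = D.circle t (w, 0) ∧
          D.circle t (v, 2) = D.circle t (w, 2) ∨
          D.circle t (v, 0) = D.circle t (w, 2) ∧ D.circle t (v, 2) = D.circle t (w, 0) := by
        rcases circle_eq_or_of_circle_eq h₂ 0 ha' with h | ⟨h | h, h' | h'⟩
        · exact absurd h ha
        · exact absurd (h.trans h'.symm) ha
        · exact Or.inl ⟨h, h'⟩
        · exact Or.inr ⟨h, h'⟩
        · exact absurd (h.trans h'.symm) ha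
      refine Or.inr ⟨⟨ha, hb, ha', ?_⟩, hcirc⟩
      unfold Joined at hj₁ ⊢
      rcases hcirc with ⟨h, h'⟩ | ⟨h, h'⟩
      · rw [← circle_eq_of_joined h₁ hj₁ h, ← circle_eq_of_joined h₁ hj₁ h', hj₁]
      · rw [← circle_eq_of_joined h₁ hj₁ h, ← circle_eq_of_joined h₁ hj₁ h', hj₁]
  by_cases hne : D.Joined t v ↔ D.Joined t₂ v
  · by_cases hne' : D.Joined t w ↔ D.Joined t₁ w
    · exact Or.inl ⟨hne, hne'⟩
    · rcases key h₂ hw₂ h₁ hv₁ h₂₃ hv₃ h₁₃ hw₃ hne' with ⟨h, -⟩ | ⟨h, -⟩ <;> tauto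
  · exact Or.inr (key h₁ hv₁ h₂ hw₂ h₁₃ hw₃ h₂₃ hv₃ hne)

/-! ### The chain groups as ideals

Let `R` be the quotient of the polynomial ring on the half-edges by the squares of the variables.
An element of `R` is written as a function of finite sets of half-edges, where `Z` stands for the
product of the variables that are not in `Z`. -/

/-- Multiplication by the variable of the half-edge `e`. -/
def mulVar {V : Type*} (e : V × Fin 4) : (Finset (V × Fin 4) → ℤ) →ₗ[ℤ] (Finset (V × Fin 4) → ℤ) where
  toFun φ Z := open Classical in if e ∈ Z then 0 else φ (insert e Z)
  map_add' φ ψ := by ext Z; by_cases h : e ∈ Z <;> simp [h]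
  map_smul' c φ := by ext Z; by_cases h : e ∈ Z <;> simp [h]

theorem mulVar_comm {V : Type*} (e e' : V × Fin 4) (φ : Finset (V × Fin 4) → ℤ) :
    mulVar e (mulVar e' φ) = mulVar e' (mulVar e φ) := by
  classical
  by_cases he : e = e'
  · rw [he]
  ext Z
  simp only [mulVar, LinearMap.coe_mk, AddHom.coe_mk, Finset.mem_insert, Ne.symm he, he, false_or]
  rw [Finset.insert_comm e e' Z]
  split_ifs <;> rfl

open Classical in
/-- The number of half-edges of `Z` on the circle of `x`. -/
def circleCount (D : LinkDiagram V) (t : V → ℤˣ) (Z : Finset (V × Fin 4)) (x : V × Fin 4) : ℕ :=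
  (Z.filter fun y => D.circle t y = D.circle t x).card

theorem circleCount_congr {t : V → ℤˣ} (Z : Finset (V × Fin 4)) {x y : V × Fin 4}
    (h : D.circle t x = D.circle t y) : D.circleCount t Z x = D.circleCount t Z y := by
  unfold circleCount; rw [h]

open Classical in
theorem circleCount_insert {t : V → ℤˣ} {Z : Finset (V × Fin 4)} {e : V × Fin 4} (he : e ∉ Z)
    (x : V × Fin 4) : D.circleCount t (insert e Z) x =
      D.circleCount t Z x + if D.circle t x = D.circle t e then 1 else 0 := by
  unfold circleCount
  rw [Finset.filter_insert]
  by_cases h : D.circle t e = D.circle t x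
  · rw [if_pos h, if_pos h.symm]
    convert Finset.card_insert_of_notMem _
    simp [he]
  · rw [if_neg h, if_neg (Ne.symm h)]
    rfl

theorem circleCount_eq_of_ne {t t' : V → ℤˣ} {v : V} (h : ∀ w, w ≠ v → t w = t' w)
    (hj' : D.Joined t' v) (Z : Finset (V × Fin 4)) {x : V × Fin 4}
    (hx : D.circle t' x ≠ D.circle t' (v, 0)) : D.circleCount t' Z x = D.circleCount t Z x := by
  unfold circleCount
  congr 1
  ext y
  simp only [Finset.mem_filter, and_congr_right_iff]
  intro _
  refine ⟨fun hy => ?_, circle_eq_of_joined h hj'⟩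
  rcases circle_eq_or_of_circle_eq h 0 hy with h1 | ⟨-, h1 | h1⟩
  · exact h1
  · exact absurd (circle_eq_of_joined h hj' h1) hx
  · exact absurd ((circle_eq_of_joined h hj' h1).trans (hj'.circle_eq _ _)) hx

theorem circleCount_eq_add {t t' : V → ℤˣ} {v : V} (h : ∀ w, w ≠ v → t w = t' w)
    (hj : ¬ D.Joined t v) (hj' : D.Joined t' v) (Z : Finset (V × Fin 4)) :
    D.circleCount t' Z (v, 0) = D.circleCount t Z (v, 0) + D.circleCount t Z (v, 2) := by
  classical
  unfold circleCount
  rw [← Finset.card_union_of_disjoint]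
  · congr 1
    ext y
    simp only [Finset.mem_filter, Finset.mem_union, ← and_or_left, and_congr_right_iff]
    intro _
    constructor
    · intro hy
      rcases circle_eq_or_of_circle_eq h 0 hy with h1 | ⟨h1, -⟩
      · exact Or.inl h1
      · exact h1
    · rintro (hy | hy)
      · exact circle_eq_of_joined h hj' hy
      · exact (circle_eq_of_joined h hj' hy).trans (hj'.circle_eq _ _)
  · rw [Finset.disjoint_filter]
    intro y _ h1 h2
    exact hj (h1.symm.trans h2)

/-- `1` for the negative sign and `0` for the positive one. -/
def negCount (u : ℤˣ) : ℕ := if u = -1 then 1 else 0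

theorem coe_units_eq (u : ℤˣ) : (u : ℤ) = 1 - 2 * negCount u := by
  rcases Int.units_eq_one_or u with rfl | rfl <;> rfl

theorem negCount_le (u : ℤˣ) : negCount u ≤ 1 := by
  unfold negCount; split_ifs <;> simp

theorem negCount_injective : Function.Injective negCount := fun u u' h =>
  Units.ext (by rw [coe_units_eq, coe_units_eq, h])

namespace EnhancedState

/-- `Z` contains exactly one half-edge of every negative circle and none of the positive ones. -/
def Fits (S : D.EnhancedState) (Z : Finset (V × Fin 4)) : Prop :=
  ∀ x, D.circleCount S.1 Z x = negCount (S.sgn x)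

open Classical in
/-- The product over the positive circles of all variables times the product over the negative
circles of the elementary symmetric polynomials of second highest degree. -/
def toIdeal (S : D.EnhancedState) (Z : Finset (V × Fin 4)) : ℤ := if S.Fits Z then 1 else 0

theorem eq_of_fits (hl : D.loops = 0) {S S' : D.EnhancedState} (h : S.1 = S'.1)
    {Z : Finset (V × Fin 4)} (hS : S.Fits Z) (hS' : S'.Fits Z) : S = S' :=
  ext_sgn hl h fun x => negCount_injective (by rw [← hS x, ← hS' x, h])

theorem exists_fits (hl : D.loops = 0) (t : V → ℤˣ) (Z : Finset (V × Fin 4))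
    (h : ∀ x, D.circleCount t Z x ≤ 1) : ∃ S : D.EnhancedState, S.1 = t ∧ S.Fits Z := by
  refine ⟨ofSgn hl t fun x => if D.circleCount t Z x = 1 then -1 else 1, rfl, fun x => ?_⟩
  rw [sgn_ofSgn hl t _ (fun x y hxy => by rw [circleCount_congr Z hxy]), ofSgn_fst]
  have := h x
  unfold negCount
  interval_cases D.circleCount t Z x <;> simp

/-- Choosing one half-edge on every negative circle gives a monomial that occurs in the element of
`S` and in no other with the same markers. It is used to read off coefficients. -/
theorem exists_forall_fits_iff (hl : D.loops = 0) (S : D.EnhancedState) :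
    ∃ Z, ∀ S' : D.EnhancedState, S'.1 = S.1 → (S'.Fits Z ↔ S' = S) := by
  classical
  choose r hr using fun c : D.Circle S.1 => exists_circle_eq hl c
  have hS : S.Fits ((Finset.univ.filter fun c => S.2 c = -1).image r) := by
    intro x
    unfold circleCount negCount
    split_ifs with h
    · rw [Finset.card_eq_one]
      refine ⟨r (D.circle S.1 x), ?_⟩
      ext y
      simp only [Finset.mem_filter, Finset.mem_image, Finset.mem_univ, true_and,
        Finset.mem_singleton]
      constructor
      · rintro ⟨⟨c, -, rfl⟩, hy⟩
        rw [← hy, hr]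
      · rintro rfl
        exact ⟨⟨_, h, rfl⟩, hr _⟩
    · rw [Finset.card_eq_zero, Finset.filter_eq_empty_iff]
      intro y hy hyx
      obtain ⟨c, hc, rfl⟩ := Finset.mem_image.1 hy
      rw [hr] at hyx
      subst hyx
      exact h (Finset.mem_filter.1 hc).2
  exact ⟨_, fun S' h => ⟨fun h' => eq_of_fits hl h h' hS, fun h' => h' ▸ hS⟩⟩

open Classical in
-- On its own circle a variable kills the top product and turns the second highest elementary
-- symmetric polynomial into the top product. The result therefore depends only on the circle of
-- `e`.
theorem mulVar_toIdeal (S : D.EnhancedState) (e : V × Fin 4) (Z : Finset (V × Fin 4)) :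
    mulVar e S.toIdeal Z = if ∀ x, D.circleCount S.1 Z x +
      (if D.circle S.1 x = D.circle S.1 e then 1 else 0) = negCount (S.sgn x) then 1 else 0 := by
  unfold mulVar toIdeal Fits
  simp only [LinearMap.coe_mk, AddHom.coe_mk]
  by_cases he : e ∈ Z
  · rw [if_pos he, if_neg]
    intro h
    have h1 := h e
    have h2 := negCount_le (S.sgn e)
    have h3 : 0 < D.circleCount S.1 Z e := by
      unfold circleCount
      exact Finset.card_pos.2 ⟨e, by simp [he]⟩
    simp only [if_true] at h1
    lia
  · rw [if_neg he]
    simp only [circleCount_insert he]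

theorem mulVar_toIdeal_congr (S : D.EnhancedState) {e e' : V × Fin 4}
    (h : D.circle S.1 e = D.circle S.1 e') : mulVar e S.toIdeal = mulVar e' S.toIdeal := by
  ext Z
  rw [mulVar_toIdeal, mulVar_toIdeal, h]

end EnhancedState

open Classical in
/-- The part of the differential that changes the marker at `v`: if two circles merge, the
multiplication by the sum of the variables of two opposite half-edges, and the inclusion of ideals
if a circle splits. -/
def edgeMap (D : LinkDiagram V) (t : V → ℤˣ) (v : V) :
    (Finset (V × Fin 4) → ℤ) →ₗ[ℤ] (Finset (V × Fin 4) → ℤ) :=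
  if D.Joined t v then LinearMap.id else mulVar (v, 0) + mulVar (v, 2)

theorem edgeMap_congr {t t' : V → ℤˣ} {v : V} (h : D.Joined t v ↔ D.Joined t' v) :
    D.edgeMap t v = D.edgeMap t' v := by
  by_cases ht : D.Joined t v
  · rw [edgeMap, edgeMap, if_pos ht, if_pos (h.1 ht)]
  · rw [edgeMap, edgeMap, if_neg ht, if_neg fun h' => ht (h.2 h')]

theorem edgeMap_comm (t t' : V → ℤˣ) (v w : V) (φ : Finset (V × Fin 4) → ℤ) :
    D.edgeMap t v (D.edgeMap t' w φ) = D.edgeMap t' w (D.edgeMap t v φ) := by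
  unfold edgeMap
  split_ifs <;> simp only [LinearMap.id_apply, LinearMap.add_apply, map_add]
  simp only [mulVar_comm (w, 0) (v, 0), mulVar_comm (w, 2) (v, 0), mulVar_comm (w, 0) (v, 2),
    mulVar_comm (w, 2) (v, 2)]
  abel

/-- If the marker at one crossing does not affect whether the other is joined, this is commutativity
of multiplication. Otherwise `v` and `w` meet the same circles, and variables on the same circle act
equally on the element of `S`. -/
theorem EnhancedState.edgeMap_edgeMap {ev : V × Fin 4 → Bool} (hev : D.IsSourceSink ev)
    (hl : D.loops = 0) (S : D.EnhancedState)
    {t₁ t₂ t₃ : V → ℤˣ} {v w : V} (h₁ : ∀ u, u ≠ v → S.1 u = t₁ u) (hv₁ : S.1 v ≠ t₁ v)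
    (h₂ : ∀ u, u ≠ w → S.1 u = t₂ u) (hw₂ : S.1 w ≠ t₂ w)
    (h₁₃ : ∀ u, u ≠ w → t₁ u = t₃ u) (hw₃ : t₁ w ≠ t₃ w)
    (h₂₃ : ∀ u, u ≠ v → t₂ u = t₃ u) (hv₃ : t₂ v ≠ t₃ v) :
    D.edgeMap t₁ w (D.edgeMap S.1 v S.toIdeal) = D.edgeMap t₂ v (D.edgeMap S.1 w S.toIdeal) := by
  rcases joined_square hev hl h₁ hv₁ h₂ hw₂ h₁₃ hw₃ h₂₃ hv₃ with ⟨h, h'⟩ | ⟨⟨a, b, c, d⟩, h⟩ |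
    ⟨⟨a, b, c, d⟩, h⟩
  · have e1 : D.edgeMap t₁ w = D.edgeMap S.1 w := edgeMap_congr h'.symm
    have e2 : D.edgeMap t₂ v = D.edgeMap S.1 v := edgeMap_congr h.symm
    rw [e1, e2, edgeMap_comm]
  · unfold edgeMap
    simp only [a, b, c, d, if_true, if_false, LinearMap.id_apply, LinearMap.add_apply]
    rw [S.mulVar_toIdeal_congr h, S.mulVar_toIdeal_congr (a.symm.trans h),
      S.mulVar_toIdeal_congr b.symm]
  · unfold edgeMap
    simp only [a, b, c, d, if_true, if_false, LinearMap.id_apply, LinearMap.add_apply]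
    rcases h with ⟨h, h'⟩ | ⟨h, h'⟩
    · rw [S.mulVar_toIdeal_congr h, S.mulVar_toIdeal_congr h']
    · rw [S.mulVar_toIdeal_congr h, S.mulVar_toIdeal_congr h', add_comm]

open Classical in
-- For a split, the second highest symmetric polynomial of a union of two sets is the sum of the two
-- products "second highest on one set, top on the other". For a merge, multiplying by the two
-- variables produces the corresponding element of the united circle.
theorem EnhancedState.exists_incident_fits_iff {ev : V × Fin 4 → Bool} (hev : D.IsSourceSink ev)
    (hl : D.loops = 0) (S : D.EnhancedState) {v : V} (hv : S.1 v = 1)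
    (Z : Finset (V × Fin 4)) :
    D.edgeMap S.1 v S.toIdeal Z = if ∃ S', S.Incident S' v ∧ S'.Fits Z then 1 else 0 := by
  set t' := Function.update S.1 v (-1) with ht'
  have h : ∀ w, w ≠ v → S.1 w = t' w := fun w hw => by rw [ht', Function.update_of_ne hw]
  have h' : ∀ w, w ≠ v → t' w = S.1 w := fun w hw => (h w hw).symm
  have hv' : t' v = -1 := by rw [ht', Function.update_self]
  have heq : ∀ S' : D.EnhancedState, S.Incident S' v → S'.1 = t' := by
    rintro S' ⟨-, h2, h3, -⟩
    funext w
    by_cases hw : w = v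
    · rw [hw, h2, hv']
    · rw [← h3 w hw, h w hw]
  have hK := joined_iff_not_joined hev h (by rw [hv, hv']; decide)
  unfold edgeMap
  by_cases hj : D.Joined S.1 v
  · rw [if_pos hj]
    have hj' := hK.1 hj
    simp only [LinearMap.id_apply]
    unfold toIdeal
    refine if_congr ⟨fun hf => ?_, ?_⟩ rfl rfl
    · obtain ⟨S', hS', hf'⟩ := exists_fits (D := D) hl t' Z fun x => by
        refine le_trans ?_ ((hf x).le.trans (negCount_le _))
        unfold circleCount
        refine Finset.card_le_card fun y hy => ?_
        rw [Finset.mem_filter] at hy ⊢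
        exact ⟨hy.1, circle_eq_of_joined h' hj hy.2⟩
      refine ⟨S', ?_, hf'⟩
      rw [incident_iff_of_split hl hv (by rw [hS', hv']) (by rwa [hS']) hj (by rwa [hS']) 0]
      constructor
      · intro x hx
        apply negCount_injective
        rw [← hf x, ← hf' x, circleCount_eq_of_ne h' hj Z hx, hS']
      · have := circleCount_eq_add h' hj' hj Z
        rw [hf, ← hS', hf', hf'] at this
        rw [coe_units_eq, coe_units_eq, coe_units_eq]
        push_cast [this]
        ring
    · rintro ⟨S', hi, hf'⟩
      have hS' := heq S' hi
      rw [incident_iff_of_split hl hv (by rw [hS', hv']) (by rwa [hS']) hj (by rwa [hS']) 0] at hi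
      intro x
      by_cases hx : D.circle S.1 x = D.circle S.1 (v, 0)
      · rw [circleCount_congr Z hx, S.sgn_congr hx, circleCount_eq_add h' hj' hj Z, ← hS', hf',
          hf']
        have := hi.2
        rw [coe_units_eq, coe_units_eq, coe_units_eq, zero_add] at this
        lia
      · rw [hi.1 x hx, circleCount_eq_of_ne h' hj Z hx, ← hS', hf']
  · rw [if_neg hj]
    have hj' : D.Joined t' v := by by_contra hc; exact hj (hK.2 hc)
    have hne : D.circle S.1 (v, 0) ≠ D.circle S.1 (v, 2) := hj
    simp only [LinearMap.add_apply, Pi.add_apply, mulVar_toIdeal]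
    have hcount := circleCount_eq_add h hj hj' Z
    have hoff : ∀ x, D.circle t' x ≠ D.circle t' (v, 0) →
        D.circle S.1 x ≠ D.circle S.1 (v, 0) ∧ D.circle S.1 x ≠ D.circle S.1 (v, 2) :=
      fun x hx => ⟨fun hc => hx (circle_eq_of_joined h hj' hc),
        fun hc => hx ((circle_eq_of_joined h hj' hc).trans (hj'.circle_eq _ _))⟩
    have hback : ∀ e ∈ ({(v, 0), (v, 2)} : Set (V × Fin 4)), (∀ x, D.circleCount S.1 Z x +
        (if D.circle S.1 x = D.circle S.1 e then 1 else 0) = negCount (S.sgn x)) →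
        ∃ S', S.Incident S' v ∧ S'.Fits Z := by
      intro e he hA
      have h0 := hA (v, 0)
      have h2 := hA (v, 2)
      have hsum : D.circleCount t' Z (v, 0) + 1 =
          negCount (S.sgn (v, 0)) + negCount (S.sgn (v, 2)) := by
        rcases he with rfl | rfl
        · rw [if_pos rfl] at h0; rw [if_neg hne.symm] at h2; lia
        · rw [if_pos rfl] at h2; rw [if_neg hne] at h0; lia
      have hoff' : ∀ x, D.circle t' x ≠ D.circle t' (v, 0) →
          D.circleCount t' Z x = negCount (S.sgn x) := by
        intro x hx
        rw [circleCount_eq_of_ne h hj' Z hx, ← hA x, if_neg]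
        · rfl
        · rcases he with rfl | rfl
          exacts [(hoff x hx).1, (hoff x hx).2]
      obtain ⟨S', hS', hf'⟩ := exists_fits (D := D) hl t' Z fun x => by
        by_cases hx : D.circle t' x = D.circle t' (v, 0)
        · rw [circleCount_congr Z hx]
          have := negCount_le (S.sgn (v, 0))
          have := negCount_le (S.sgn (v, 2))
          lia
        · rw [hoff' x hx]; exact negCount_le _
      refine ⟨S', ?_, hf'⟩
      rw [incident_iff_of_merge hl hv (by rw [hS', hv']) (by rwa [hS']) hj (by rwa [hS']) 0]
      constructor
      · intro x hx
        rw [hS'] at hx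
        apply negCount_injective
        rw [← hf' x, ← hoff' x hx, hS']
      · rw [← hS', hf'] at hsum
        rw [coe_units_eq, coe_units_eq, coe_units_eq, zero_add]
        lia
    -- The two products have no monomial in common: at `(v, 0)` they demand different counts. So the
    -- coefficient is 0 or 1.
    by_cases hA0 : ∀ x, D.circleCount S.1 Z x +
        (if D.circle S.1 x = D.circle S.1 (v, 0) then 1 else 0) = negCount (S.sgn x)
    · rw [if_pos hA0, if_neg, if_pos (hback _ (by simp) hA0), add_zero]
      intro hA2
      have h0 := hA0 (v, 0)
      have h2 := hA2 (v, 0)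
      rw [if_pos rfl] at h0
      rw [if_neg hne] at h2
      lia
    · rw [if_neg hA0, zero_add]
      refine if_congr ⟨hback _ (by simp), ?_⟩ rfl rfl
      rintro ⟨S', hi, hf'⟩
      have hS' := heq S' hi
      rw [incident_iff_of_merge hl hv (by rw [hS', hv']) (by rwa [hS']) hj (by rwa [hS']) 0] at hi
      rw [← hS', hf'] at hcount
      have hi2 := hi.2
      rw [coe_units_eq, coe_units_eq, coe_units_eq, zero_add] at hi2
      have n0 := negCount_le (S.sgn (v, 0))
      have n2 := negCount_le (S.sgn (v, 2))
      have hgen : ∀ x, D.circle S.1 x = D.circle S.1 (v, 0) ∨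
          D.circle S.1 x = D.circle S.1 (v, 2) ∨
          (D.circle S.1 x ≠ D.circle S.1 (v, 0) ∧ D.circle S.1 x ≠ D.circle S.1 (v, 2) ∧
            D.circleCount S.1 Z x = negCount (S.sgn x)) := by
        intro x
        by_cases hx : D.circle t' x = D.circle t' (v, 0)
        · rcases circle_eq_or_of_circle_eq h 0 hx with h1 | ⟨h1 | h1, -⟩
          exacts [Or.inl h1, Or.inl h1, Or.inr (Or.inl h1)]
        · refine Or.inr (Or.inr ⟨(hoff x hx).1, (hoff x hx).2, ?_⟩)
          rw [← circleCount_eq_of_ne h hj' Z hx, hi.1 x (by rwa [hS']), ← hS', hf']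
      -- The merge rule says that the counts at the two circles add up to one less than their number
      -- of negative signs. As a sign counts at most 1, the missing half-edge belongs to one of the
      -- two circles.
      by_contra hA2
      have c0 : ¬ (D.circleCount S.1 Z (v, 0) + 1 = negCount (S.sgn (v, 0)) ∧
          D.circleCount S.1 Z (v, 2) = negCount (S.sgn (v, 2))) := by
        rintro ⟨e0, e2⟩
        refine hA0 fun x => ?_
        rcases hgen x with hx | hx | ⟨hx, -, hx'⟩
        · rw [if_pos hx, circleCount_congr Z hx, S.sgn_congr hx, e0]
        · rw [if_neg (by rw [hx]; exact hne.symm), circleCount_congr Z hx, S.sgn_congr hx, e2, add_zero]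
        · rw [if_neg hx, hx', add_zero]
      have c2 : ¬ (D.circleCount S.1 Z (v, 2) + 1 = negCount (S.sgn (v, 2)) ∧
          D.circleCount S.1 Z (v, 0) = negCount (S.sgn (v, 0))) := by
        rintro ⟨e2, e0⟩
        refine hA2 fun x => ?_
        rcases hgen x with hx | hx | ⟨-, hx, hx'⟩
        · rw [if_neg (by rw [hx]; exact hne), circleCount_congr Z hx, S.sgn_congr hx, e0, add_zero]
        · rw [if_pos hx, circleCount_congr Z hx, S.sgn_congr hx, e2]
        · rw [if_neg hx, hx', add_zero]
      lia

open Classical in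
theorem EnhancedState.sum_incident_toIdeal {ev : V × Fin 4 → Bool} (hev : D.IsSourceSink ev)
    (hl : D.loops = 0) (S : D.EnhancedState) {v : V} (hv : S.1 v = 1) :
    ∑ S', (if S.Incident S' v then (1 : ℤ) else 0) • S'.toIdeal = D.edgeMap S.1 v S.toIdeal := by
  ext Z
  rw [exists_incident_fits_iff hev hl S hv, Finset.sum_apply]
  split_ifs with h
  · obtain ⟨S₀, h1, h2⟩ := h
    rw [Finset.sum_eq_single S₀]
    · simp [h1, toIdeal, h2]
    · intro S' _ hne
      by_cases hi : S.Incident S' v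
      · have : ¬ S'.Fits Z := by
          refine fun hf => hne (eq_of_fits hl (funext fun w => ?_) hf h2)
          by_cases hw : w = v
          · rw [hw, hi.2.1, h1.2.1]
          · rw [← hi.2.2.1 w hw, ← h1.2.2.1 w hw]
        simp [toIdeal, this]
      · simp [hi]
    · simp
  · refine Finset.sum_eq_zero fun S' _ => ?_
    by_cases hi : S.Incident S' v
    · have : ¬ S'.Fits Z := fun hf => h ⟨S', hi, hf⟩
      simp [toIdeal, this]
    · simp [hi]

open Classical in
-- The unsigned square commutes because both ways around it describe the same element of the ring;
-- the coefficient of `T` is then extracted.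
theorem EnhancedState.sum_incident_mul_incident {ev : V × Fin 4 → Bool}
    (hev : D.IsSourceSink ev) (hl : D.loops = 0) (S T : D.EnhancedState) {v w : V}
    (hvw : v ≠ w) (hv : S.1 v = 1) (hw : S.1 w = 1) :
    ∑ R : D.EnhancedState,
      (if S.Incident R v then (1 : ℤ) else 0) * (if R.Incident T w then 1 else 0) =
    ∑ R : D.EnhancedState,
      (if S.Incident R w then (1 : ℤ) else 0) * (if R.Incident T v then 1 else 0) := by
  have expand : ∀ v w : V, v ≠ w → S.1 v = 1 → S.1 w = 1 →
      ∑ T : D.EnhancedState, (∑ R : D.EnhancedState, (if S.Incident R v then (1 : ℤ) else 0) *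
        (if R.Incident T w then 1 else 0)) • T.toIdeal =
      D.edgeMap (Function.update S.1 v (-1)) w (D.edgeMap S.1 v S.toIdeal) := by
    intro v w hvw hv hw
    rw [← sum_incident_toIdeal hev hl S hv, map_sum]
    simp only [Finset.sum_smul, mul_smul]
    rw [Finset.sum_comm]
    refine Finset.sum_congr rfl fun R _ => ?_
    rw [map_smul, ← Finset.smul_sum]
    by_cases hi : S.Incident R v
    · rw [if_pos hi, one_smul, one_smul, sum_incident_toIdeal hev hl R (by
        rw [← hi.2.2.1 w hvw.symm, hw])]
      have : R.1 = Function.update S.1 v (-1) := by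
        funext u
        by_cases hu : u = v
        · rw [hu, hi.2.1, Function.update_self]
        · rw [← hi.2.2.1 u hu, Function.update_of_ne hu]
      rw [this]
    · rw [if_neg hi, zero_smul, zero_smul]
  have hcomm : Function.update (Function.update S.1 v (-1)) w (-1) =
      Function.update (Function.update S.1 w (-1)) v (-1) := Function.update_comm hvw _ _ _
  have main := (expand v w hvw hv hw).trans ((S.edgeMap_edgeMap hev hl
    (t₁ := Function.update S.1 v (-1)) (t₂ := Function.update S.1 w (-1))
    (t₃ := Function.update (Function.update S.1 v (-1)) w (-1))
    (fun u hu => by rw [Function.update_of_ne hu])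
    (by rw [hv, Function.update_self]; decide)
    (fun u hu => by rw [Function.update_of_ne hu])
    (by rw [hw, Function.update_self]; decide)
    (fun u hu => by rw [Function.update_of_ne hu])
    (by rw [Function.update_of_ne hvw.symm, hw, Function.update_self]; decide)
    (fun u hu => by rw [hcomm, Function.update_of_ne hu])
    (by rw [hcomm, Function.update_of_ne hvw, hv, Function.update_self]; decide)).trans
    (expand w v hvw.symm hw hv).symm)
  -- Only a `T` with both markers lowered can be reached. For such a `T` a distinguishing monomial
  -- isolates its coefficient, and for all others both sums vanish.
  by_cases hT : T.1 = Function.update (Function.update S.1 v (-1)) w (-1)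
  · obtain ⟨Z, hZ⟩ := exists_forall_fits_iff hl T
    have eval : ∀ (v w : V), Function.update (Function.update S.1 v (-1)) w (-1) = T.1 →
        (∑ T : D.EnhancedState, (∑ R : D.EnhancedState, (if S.Incident R v then (1 : ℤ) else 0) *
        (if R.Incident T w then 1 else 0)) • T.toIdeal) Z =
        ∑ R : D.EnhancedState, (if S.Incident R v then (1 : ℤ) else 0) *
        (if R.Incident T w then 1 else 0) := by
      intro v w hT
      rw [Finset.sum_apply, Finset.sum_eq_single T]
      · simp [toIdeal, (hZ T rfl).2 rfl]
      · intro T' _ hne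
        by_cases hT' : T'.1 = T.1
        · have : ¬ T'.Fits Z := fun hf => hne ((hZ T' hT').1 hf)
          simp [toIdeal, this]
        · rw [Pi.smul_apply, Finset.sum_eq_zero, zero_smul]
          intro R _
          by_cases h1 : S.Incident R v
          · by_cases h2 : R.Incident T' w
            · exfalso
              apply hT'
              rw [← hT]
              funext u
              by_cases hu : u = w
              · rw [hu, h2.2.1, Function.update_self]
              · rw [← h2.2.2.1 u hu, Function.update_of_ne hu]
                by_cases hu' : u = v
                · rw [hu', h1.2.1, Function.update_self]
                · rw [← h1.2.2.1 u hu', Function.update_of_ne hu']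
            · rw [if_neg h2, mul_zero]
          · rw [if_neg h1, zero_mul]
      · simp
    have := congrFun main Z
    rwa [eval v w hT.symm, eval w v (by rw [← hcomm, hT])] at this
  · have zero : ∀ v w : V, T.1 ≠ Function.update (Function.update S.1 v (-1)) w (-1) →
        ∑ R : D.EnhancedState, (if S.Incident R v then (1 : ℤ) else 0) *
        (if R.Incident T w then 1 else 0) = 0 := by
      intro v w hT
      refine Finset.sum_eq_zero fun R _ => ?_
      by_cases h1 : S.Incident R v
      · by_cases h2 : R.Incident T w
        · exfalso
          apply hT
          funext u
          by_cases hu : u = w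
          · rw [hu, h2.2.1, Function.update_self]
          · rw [← h2.2.2.1 u hu, Function.update_of_ne hu]
            by_cases hu' : u = v
            · rw [hu', h1.2.1, Function.update_self]
            · rw [← h1.2.2.1 u hu', Function.update_of_ne hu']
        · rw [if_neg h2, mul_zero]
      · rw [if_neg h1, zero_mul]
    rw [zero v w hT, zero w v (by rwa [← hcomm])]

end LinkDiagram

/-! ### Based complexes: exactness and torsion in extensions, matchings, transport -/

section BasedComplex

theorem Set.indicator_zsmul {α : Type*} (s : Set α) (n : ℤ) (a : α → ℤ) :
    s.indicator (n • a) = n • s.indicator a := by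
  ext x
  by_cases hx : x ∈ s <;> simp [hx]

variable {E : Type*} [Fintype E] {c : E → E → ℤ} {U U' U'' Q Q₂ P : Set E}

open Classical in
/-- The endomorphism with matrix `c`, restricted to the generators in `U`. -/
def boundary (c : E → E → ℤ) (U : Set E) : (E → ℤ) →ₗ[ℤ] (E → ℤ) where
  toFun a T := if T ∈ U then ∑ S, if S ∈ U then a S * c S T else 0 else 0
  map_add' a b := by
    ext T
    by_cases hT : T ∈ U
    · simp only [hT, if_true, Pi.add_apply, ← Finset.sum_add_distrib]
      refine Finset.sum_congr rfl fun S _ => ?_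
      split_ifs <;> ring
    · simp [hT]
  map_smul' n a := by
    ext T
    by_cases hT : T ∈ U
    · simp only [hT, if_true, Pi.smul_apply, smul_eq_mul, RingHom.id_apply, Finset.mul_sum]
      refine Finset.sum_congr rfl fun S _ => ?_
      split_ifs <;> ring
    · simp [hT]

open Classical in
theorem boundary_apply (a : E → ℤ) (T : E) :
    boundary c U a T = if T ∈ U then ∑ S, if S ∈ U then a S * c S T else 0 else 0 := rfl

theorem boundary_apply_of_notMem (a : E → ℤ) {T : E} (hT : T ∉ U) : boundary c U a T = 0 :=
  if_neg hT

theorem boundary_apply_of_support (a : E → ℤ) {T : E} (hT : T ∈ U)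
    (ha : Function.support a ⊆ U) : boundary c U a T = ∑ S, a S * c S T := by
  rw [boundary_apply, if_pos hT]
  refine Finset.sum_congr rfl fun S _ => ?_
  split_ifs with hS
  · rfl
  · rw [Function.notMem_support.1 fun h => hS (ha h), zero_mul]

open Classical in
/-- The restriction of the matrix `c` to `U` is a differential. -/
def SquareZero (c : E → E → ℤ) (U : Set E) : Prop :=
  ∀ S ∈ U, ∀ T ∈ U, ∑ R, (if R ∈ U then c S R * c R T else 0) = 0

theorem SquareZero.boundary_boundary (h : SquareZero c U) (a : E → ℤ) :
    boundary c U (boundary c U a) = 0 := by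
  classical
  ext T
  rw [boundary_apply, Pi.zero_apply]
  split_ifs with hT
  · have : ∀ R : E, (if R ∈ U then boundary c U a R * c R T else 0) =
        ∑ S, if S ∈ U then a S * (if R ∈ U then c S R * c R T else 0) else 0 := by
      intro R
      split_ifs with hR
      · rw [boundary_apply, if_pos hR, Finset.sum_mul]
        refine Finset.sum_congr rfl fun S _ => ?_
        split_ifs <;> ring
      · simp
    simp only [this]
    rw [Finset.sum_comm]
    refine Finset.sum_eq_zero fun S _ => ?_
    by_cases hS : S ∈ U
    · simp only [hS, if_true]
      rw [← Finset.mul_sum, h S hS T hT, mul_zero]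
    · simp [hS]
  · rfl

/-- The cycles in degree `P` are boundaries of chains in degree `Q`. -/
def ExactAt (c : E → E → ℤ) (U Q P : Set E) : Prop :=
  ∀ a : E → ℤ, Function.support a ⊆ U ∩ P → boundary c U a = 0 →
    ∃ b, Function.support b ⊆ U ∩ Q ∧ boundary c U b = a

/-- The homology in degree `P` has no torsion. -/
def TorsionFreeAt (c : E → E → ℤ) (U Q P : Set E) : Prop :=
  ∀ (a : E → ℤ) (n : ℤ), n ≠ 0 → Function.support a ⊆ U ∩ P →
    (∃ b, Function.support b ⊆ U ∩ Q ∧ boundary c U b = n • a) →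
    ∃ b, Function.support b ⊆ U ∩ Q ∧ boundary c U b = a

/-- The matrix `c` maps degree `Q` to degree `P`. -/
def MapsDegree (c : E → E → ℤ) (Q P : Set E) : Prop := ∀ S T, c S T ≠ 0 → S ∈ Q → T ∈ P

theorem MapsDegree.support_boundary (h : MapsDegree c Q P) {a : E → ℤ}
    (ha : Function.support a ⊆ Q) : Function.support (boundary c U a) ⊆ U ∩ P := by
  intro T hT
  rw [Function.mem_support] at hT
  have hTU : T ∈ U := by
    by_contra hc
    exact hT (boundary_apply_of_notMem a hc)
  refine ⟨hTU, ?_⟩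
  by_contra hTP
  apply hT
  rw [boundary_apply, if_pos hTU]
  refine Finset.sum_eq_zero fun S _ => ?_
  split_ifs
  · by_contra hne
    exact hTP (h S T (right_ne_zero_of_mul hne) (ha (left_ne_zero_of_mul hne)))
  · rfl

/-- If `n • a` is a boundary, then `a` is a cycle, since the chain group itself is torsion-free. -/
theorem ExactAt.torsionFreeAt (h : ExactAt c U Q P) (hU : SquareZero c U) :
    TorsionFreeAt c U Q P := by
  rintro a n hn ha ⟨b, -, hb⟩
  refine h a ha ?_
  have := hU.boundary_boundary b
  rw [hb, map_smul] at this
  exact (smul_eq_zero.1 this).resolve_left hn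

/-- The generators `U` consist of those of the subcomplex `U'` and those of the quotient `U''`. -/
structure IsExtension (c : E → E → ℤ) (U U' U'' : Set E) : Prop where
  union : U' ∪ U'' = U
  disjoint : ∀ S ∈ U', S ∉ U''
  zero : ∀ S ∈ U', ∀ T ∈ U'', c S T = 0

namespace IsExtension

variable (h : IsExtension c U U' U'')
include h

theorem mem_iff (S : E) : S ∈ U ↔ S ∈ U' ∨ S ∈ U'' := by rw [← h.union]; rfl

theorem squareZero_sub (hU : SquareZero c U) : SquareZero c U' := by
  classical
  intro S hS T hT
  refine Eq.trans ?_ (hU S ((h.mem_iff S).2 (Or.inl hS)) T ((h.mem_iff T).2 (Or.inl hT)))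
  refine Finset.sum_congr rfl fun R _ => ?_
  by_cases hR : R ∈ U'
  · rw [if_pos hR, if_pos ((h.mem_iff R).2 (Or.inl hR))]
  · rw [if_neg hR]
    split_ifs with hR'
    · rw [h.zero S hS R (((h.mem_iff R).1 hR').resolve_left hR), zero_mul]
    · rfl

theorem squareZero_quotient (hU : SquareZero c U) : SquareZero c U'' := by
  classical
  intro S hS T hT
  refine Eq.trans ?_ (hU S ((h.mem_iff S).2 (Or.inr hS)) T ((h.mem_iff T).2 (Or.inr hT)))
  refine Finset.sum_congr rfl fun R _ => ?_
  by_cases hR : R ∈ U''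
  · rw [if_pos hR, if_pos ((h.mem_iff R).2 (Or.inr hR))]
  · rw [if_neg hR]
    split_ifs with hR'
    · rw [h.zero R (((h.mem_iff R).1 hR').resolve_right hR) T hT, mul_zero]
    · rfl

theorem boundary_quotient (a : E → ℤ) : boundary c U'' (U''.indicator a) =
    U''.indicator (boundary c U a) := by
  classical
  ext T
  by_cases hT : T ∈ U''
  · rw [Set.indicator_of_mem hT, boundary_apply, boundary_apply, if_pos hT,
      if_pos ((h.mem_iff T).2 (Or.inr hT))]
    refine Finset.sum_congr rfl fun S _ => ?_
    by_cases hS : S ∈ U''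
    · rw [if_pos hS, if_pos ((h.mem_iff S).2 (Or.inr hS)), Set.indicator_of_mem hS]
    · rw [if_neg hS]
      split_ifs with hS'
      · rw [h.zero S (((h.mem_iff S).1 hS').resolve_right hS) T hT, mul_zero]
      · rfl
  · rw [Set.indicator_of_notMem hT, boundary_apply_of_notMem _ hT]

theorem boundary_sub {a : E → ℤ} (ha : Function.support a ⊆ U') :
    boundary c U' a = boundary c U a := by
  classical
  ext T
  rw [boundary_apply, boundary_apply]
  have hsum : ∀ S, (if S ∈ U' then a S * c S T else 0) =
      if S ∈ U then a S * c S T else 0 := by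
    intro S
    by_cases hS : S ∈ U'
    · rw [if_pos hS, if_pos ((h.mem_iff S).2 (Or.inl hS))]
    · rw [Function.notMem_support.1 fun h => hS (ha h)]
      simp
  simp only [← hsum]
  by_cases hT : T ∈ U'
  · rw [if_pos hT, if_pos ((h.mem_iff T).2 (Or.inl hT))]
  · rw [if_neg hT]
    split_ifs with hT'
    · symm
      refine Finset.sum_eq_zero fun S _ => ?_
      split_ifs with hS
      · rw [h.zero S hS T (((h.mem_iff T).1 hT').resolve_left hT), mul_zero]
      · rfl
    · rfl

/-- The basic move of the diagram chases: a preimage found in the quotient is lifted to the whole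
complex, and the error lies in the subcomplex. -/
theorem support_sub_boundary (hQP : MapsDegree c Q P) {x b : E → ℤ}
    (hx : Function.support x ⊆ U ∩ P) (hb : Function.support b ⊆ U'' ∩ Q)
    (hxb : boundary c U'' b = U''.indicator x) :
    Function.support (x - boundary c U b) ⊆ U' ∩ P := by
  intro T hT
  have hT0 : T ∈ U ∩ P := by
    by_contra hc
    apply hT
    have h1 : x T = 0 := Function.notMem_support.1 fun h => hc (hx h)
    have h2 : boundary c U b T = 0 := Function.notMem_support.1 fun h =>
      hc (hQP.support_boundary (fun S hS => (hb hS).2) h)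
    rw [Pi.sub_apply, h1, h2, sub_zero]
  refine ⟨((h.mem_iff T).1 hT0.1).resolve_right fun hT'' => hT ?_, hT0.2⟩
  have hbi : U''.indicator b = b := Set.indicator_eq_self.2 fun S hS => (hb hS).1
  have := h.boundary_quotient b
  rw [hbi, hxb] at this
  have := congrFun this T
  rw [Set.indicator_of_mem hT'', Set.indicator_of_mem hT''] at this
  rw [Pi.sub_apply, this, sub_self]

theorem support_indicator {x : E → ℤ} (hx : Function.support x ⊆ U ∩ P) :
    Function.support (U''.indicator x) ⊆ U'' ∩ P := by
  intro S hS
  rw [Set.support_indicator] at hS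
  exact ⟨hS.1, (hx hS.2).2⟩

/-- The middle term of a long exact sequence vanishes if its neighbours do. -/
theorem exactAt (hU : SquareZero c U) (hQP : MapsDegree c Q P) (h' : ExactAt c U' Q P)
    (h'' : ExactAt c U'' Q P) : ExactAt c U Q P := by
  intro a ha hda
  obtain ⟨b'', hb'', hdb''⟩ := h'' _ (h.support_indicator ha) (by
    rw [h.boundary_quotient, hda, Set.indicator_zero'])
  have hsupp := h.support_sub_boundary hQP ha hb'' hdb''
  obtain ⟨b', hb', hdb'⟩ := h' _ hsupp (by
    rw [h.boundary_sub fun S hS => (hsupp hS).1, map_sub, hda, hU.boundary_boundary, sub_zero])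
  rw [h.boundary_sub fun S hS => (hb' hS).1] at hdb'
  refine ⟨b' + b'', ?_, by rw [map_add, hdb', sub_add_cancel]⟩
  refine (Function.support_add _ _).trans (Set.union_subset (fun S hS => ?_) fun S hS => ?_)
  · exact ⟨(h.mem_iff S).2 (Or.inl (hb' hS).1), (hb' hS).2⟩
  · exact ⟨(h.mem_iff S).2 (Or.inr (hb'' hS).1), (hb'' hS).2⟩

/-- Here the homology of the total complex embeds into that of the quotient. -/
theorem torsionFreeAt_of_exactAt_sub (hU : SquareZero c U) (hQP : MapsDegree c Q P)
    (h' : ExactAt c U' Q P) (h'' : TorsionFreeAt c U'' Q P) : TorsionFreeAt c U Q P := by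
  rintro a n hn ha ⟨b, hb, hdb⟩
  obtain ⟨b'', hb'', hdb''⟩ := h'' _ n hn (h.support_indicator ha) ⟨U''.indicator b,
    h.support_indicator hb, by
      rw [h.boundary_quotient, hdb]
      exact Set.indicator_zsmul _ n a⟩
  have hda : boundary c U a = 0 := by
    have := hU.boundary_boundary b
    rw [hdb, map_smul] at this
    exact (smul_eq_zero.1 this).resolve_left hn
  have hsupp := h.support_sub_boundary hQP ha hb'' hdb''
  obtain ⟨b', hb', hdb'⟩ := h' _ hsupp (by
    rw [h.boundary_sub fun S hS => (hsupp hS).1, map_sub, hda, hU.boundary_boundary, sub_zero])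
  rw [h.boundary_sub fun S hS => (hb' hS).1] at hdb'
  refine ⟨b' + b'', ?_, by rw [map_add, hdb', sub_add_cancel]⟩
  refine (Function.support_add _ _).trans (Set.union_subset (fun S hS => ?_) fun S hS => ?_)
  · exact ⟨(h.mem_iff S).2 (Or.inl (hb' hS).1), (hb' hS).2⟩
  · exact ⟨(h.mem_iff S).2 (Or.inr (hb'' hS).1), (hb'' hS).2⟩

/-- Exactness of the quotient in degree `Q` kills the connecting map, so the homology in degree `P`
is an extension of a subgroup of one torsion-free group by another torsion-free group. -/
theorem torsionFreeAt (hU : SquareZero c U) (hQP : MapsDegree c Q P) (hQ₂Q : MapsDegree c Q₂ Q)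
    (h' : TorsionFreeAt c U' Q P) (h'' : TorsionFreeAt c U'' Q P) (hex : ExactAt c U'' Q₂ Q) :
    TorsionFreeAt c U Q P := by
  rintro a n hn ha ⟨b, hb, hdb⟩
  obtain ⟨z'', hz'', hdz''⟩ := h'' _ n hn (h.support_indicator ha) ⟨U''.indicator b,
    h.support_indicator hb, by
      rw [h.boundary_quotient, hdb]
      exact Set.indicator_zsmul _ n a⟩
  have hsupp := h.support_sub_boundary hQP ha hz'' hdz''
  have hz : Function.support z'' ⊆ U ∩ Q := fun S hS =>
    ⟨(h.mem_iff S).2 (Or.inr (hz'' hS).1), (hz'' hS).2⟩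
  have hw : Function.support (b - n • z'') ⊆ U ∩ Q := by
    refine (Function.support_sub _ _).trans (Set.union_subset hb fun S hS => hz ?_)
    exact right_ne_zero_of_mul hS
  have hdw : boundary c U (b - n • z'') = n • (a - boundary c U z'') := by
    rw [map_sub, map_smul, hdb, smul_sub]
  -- The difference `b - n • z''` is a cycle in the quotient. Subtracting the boundary of `u` moves
  -- it into the subcomplex without changing its own boundary.
  obtain ⟨u, hu, hdu⟩ := hex _ (h.support_indicator hw) (by
    rw [h.boundary_quotient, hdw, Set.indicator_zsmul]
    have : U''.indicator (a - boundary c U z'') = 0 := by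
      rw [Set.indicator_eq_zero']
      rw [Set.disjoint_left]
      exact fun S hS => h.disjoint S (hsupp hS).1
    rw [this, smul_zero])
  have hsupp₂ := h.support_sub_boundary hQ₂Q hw hu hdu
  obtain ⟨b', hb', hdb'⟩ := h' _ n hn hsupp ⟨_, hsupp₂, by
    rw [h.boundary_sub fun S hS => (hsupp₂ hS).1, map_sub, hU.boundary_boundary, sub_zero, hdw]⟩
  rw [h.boundary_sub fun S hS => (hb' hS).1] at hdb'
  refine ⟨b' + z'', ?_, by rw [map_add, hdb', sub_add_cancel]⟩
  refine (Function.support_add _ _).trans (Set.union_subset (fun S hS => ?_) hz)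
  exact ⟨(h.mem_iff S).2 (Or.inl (hb' hS).1), (hb' hS).2⟩

/-- A complex is acyclic if the component of the differential from the quotient to the subcomplex
matches the generators bijectively. -/
theorem exactAt_of_matching (hU : SquareZero c U) (χ ψ : E → E)
    (hχ : ∀ T ∈ U', χ T ∈ U'' ∧ ψ (χ T) = T) (hψ : ∀ S ∈ U'', ψ S ∈ U' ∧ χ (ψ S) = S)
    (hP : ∀ S ∈ U'', ψ S ∈ P → S ∈ Q)
    (hc : ∀ S ∈ U'', ∀ T ∈ U', c S T ≠ 0 → T = ψ S)
    (hc' : ∀ S ∈ U'', c S (ψ S) * c S (ψ S) = 1) : ExactAt c U Q P := by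
  classical
  intro a ha hda
  -- The matched coefficients are units equal to their inverses, so this `b` has a boundary that
  -- agrees with `a` on the subcomplex.
  let b : E → ℤ := fun S => if S ∈ U'' then c S (ψ S) * a (ψ S) else 0
  have hb'' : Function.support b ⊆ U'' := fun S hS => by
    by_contra hc
    exact hS (if_neg hc)
  have hb : Function.support b ⊆ U ∩ Q := by
    intro S hS
    have hSU := hb'' hS
    have hbS : b S = c S (ψ S) * a (ψ S) := if_pos hSU
    rw [Function.mem_support, hbS] at hS
    exact ⟨(h.mem_iff S).2 (Or.inr hSU), hP S hSU (ha (right_ne_zero_of_mul hS)).2⟩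
  refine ⟨b, hb, ?_⟩
  have hdb : ∀ T ∈ U', boundary c U b T = a T := by
    intro T hT
    obtain ⟨hχT, hψT⟩ := hχ T hT
    rw [boundary_apply_of_support b ((h.mem_iff T).2 (Or.inl hT)) fun S hS => (hb hS).1,
      Finset.sum_eq_single (χ T)]
    · have : b (χ T) = c (χ T) (ψ (χ T)) * a (ψ (χ T)) := if_pos hχT
      have h1 := hc' (χ T) hχT
      rw [this]
      rw [hψT] at h1 ⊢
      linear_combination a T * h1
    · intro S _ hS
      by_contra hne
      have hSU := hb'' (left_ne_zero_of_mul hne)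
      apply hS
      rw [hc S hSU T hT (right_ne_zero_of_mul hne), (hψ S hSU).2]
    · simp
  have ha₁ : Function.support (a - boundary c U b) ⊆ U := by
    intro T hT
    by_contra hc
    apply hT
    rw [Pi.sub_apply, boundary_apply_of_notMem _ hc,
      Function.notMem_support.1 fun h' => hc (ha h').1, sub_zero]
  -- The remainder is a cycle supported on the quotient generators, on which the matched component
  -- of the differential is injective. So it vanishes.
  have hd₁ : boundary c U (a - boundary c U b) = 0 := by
    rw [map_sub, hda, hU.boundary_boundary, sub_zero]
  symm
  rw [← sub_eq_zero]
  ext S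
  by_contra hne
  have hSU' : S ∉ U' := fun hS => hne (by rw [Pi.sub_apply, hdb S hS, sub_self]; rfl)
  have hSU : S ∈ U'' := ((h.mem_iff S).1 (ha₁ hne)).resolve_left hSU'
  have h0 := congrFun hd₁ (ψ S)
  rw [boundary_apply_of_support _ ((h.mem_iff _).2 (Or.inl (hψ S hSU).1)) ha₁,
    Finset.sum_eq_single S] at h0
  · exact hne (((mul_eq_zero.1 h0).resolve_right fun hz => by
      have := hc' S hSU
      rw [hz] at this
      simp at this))
  · intro R _ hR
    by_contra hne'
    have hR1 := left_ne_zero_of_mul hne'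
    have hRU' : R ∉ U' := fun hS => hR1 (by rw [Pi.sub_apply, hdb R hS, sub_self])
    have hRU : R ∈ U'' := ((h.mem_iff R).1 (ha₁ hR1)).resolve_left hRU'
    apply hR
    rw [← (hψ R hRU).2, ← hc R hRU _ (hψ S hSU).1 (right_ne_zero_of_mul hne'), (hψ S hSU).2]
  · simp

end IsExtension

section Transport

variable {c' : E → E → ℤ} {U₁ Q₁ P₁ : Set E} {χ ψ : E → E}
  (hχ : ∀ S ∈ U₁, χ S ∈ U ∧ ψ (χ S) = S) (hψ : ∀ S ∈ U, ψ S ∈ U₁ ∧ χ (ψ S) = S)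
  (hc : ∀ S ∈ U₁, ∀ T ∈ U₁, c (χ S) (χ T) = c' S T)

include hχ hψ hc in
-- The maps `χ` and `ψ` need to be mutually inverse only between `U₁` and `U`; the indicators
-- discard their values elsewhere.
theorem boundary_pullback (a : E → ℤ) :
    boundary c' U₁ (U₁.indicator (a ∘ χ)) = U₁.indicator (boundary c U a ∘ χ) := by
  classical
  ext T
  by_cases hT : T ∈ U₁
  · rw [Set.indicator_of_mem hT, Function.comp_apply, boundary_apply, boundary_apply, if_pos hT,
      if_pos (hχ T hT).1, ← Finset.sum_filter, ← Finset.sum_filter]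
    refine Finset.sum_bij' (fun S _ => χ S) (fun S _ => ψ S) ?_ ?_ ?_ ?_ ?_
    · intro S hS
      simp only [Finset.mem_filter, Finset.mem_univ, true_and] at hS ⊢
      exact (hχ S hS).1
    · intro S hS
      simp only [Finset.mem_filter, Finset.mem_univ, true_and] at hS ⊢
      exact (hψ S hS).1
    · intro S hS
      simp only [Finset.mem_filter, Finset.mem_univ, true_and] at hS
      exact (hχ S hS).2
    · intro S hS
      simp only [Finset.mem_filter, Finset.mem_univ, true_and] at hS
      exact (hψ S hS).2
    · intro S hS
      simp only [Finset.mem_filter, Finset.mem_univ, true_and] at hS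
      rw [Set.indicator_of_mem hS, hc S hS T hT, Function.comp_apply]
  · rw [Set.indicator_of_notMem hT, boundary_apply_of_notMem _ hT]

include hψ in
omit [Fintype E] in
theorem eq_of_indicator_comp_eq {a b : E → ℤ} (ha : Function.support a ⊆ U)
    (hb : Function.support b ⊆ U) (h : U₁.indicator (a ∘ χ) = U₁.indicator (b ∘ χ)) : a = b := by
  ext S
  by_cases hS : S ∈ U
  · obtain ⟨h1, h2⟩ := hψ S hS
    have := congrFun h (ψ S)
    rwa [Set.indicator_of_mem h1, Set.indicator_of_mem h1, Function.comp_apply,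
      Function.comp_apply, h2] at this
  · rw [Function.notMem_support.1 fun h => hS (ha h), Function.notMem_support.1 fun h => hS (hb h)]

omit [Fintype E] in
theorem support_indicator_comp (hP : ∀ S ∈ U₁, χ S ∈ P → S ∈ P₁) {a : E → ℤ}
    (ha : Function.support a ⊆ U ∩ P) : Function.support (U₁.indicator (a ∘ χ)) ⊆ U₁ ∩ P₁ := by
  intro S hS
  rw [Set.support_indicator] at hS
  exact ⟨hS.1, hP S hS.1 (ha hS.2).2⟩

include hχ hψ hc in
theorem exists_boundary_eq_of_pullback (hQ : ∀ S ∈ U₁, S ∈ Q₁ → χ S ∈ Q) {a b' : E → ℤ}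
    (ha : Function.support a ⊆ U) (hb' : Function.support b' ⊆ U₁ ∩ Q₁)
    (h : boundary c' U₁ b' = U₁.indicator (a ∘ χ)) :
    ∃ b, Function.support b ⊆ U ∩ Q ∧ boundary c U b = a := by
  have hpull : U₁.indicator (U.indicator (b' ∘ ψ) ∘ χ) = b' := by
    ext S
    by_cases hS : S ∈ U₁
    · rw [Set.indicator_of_mem hS, Function.comp_apply, Set.indicator_of_mem (hχ S hS).1,
        Function.comp_apply, (hχ S hS).2]
    · rw [Set.indicator_of_notMem hS, Function.notMem_support.1 fun h => hS (hb' h).1]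
  refine ⟨U.indicator (b' ∘ ψ), fun S hS => ?_, ?_⟩
  · rw [Set.support_indicator] at hS
    obtain ⟨h1, h2⟩ := hψ S hS.1
    have := hQ _ h1 (hb' hS.2).2
    rw [h2] at this
    exact ⟨hS.1, this⟩
  · refine eq_of_indicator_comp_eq hψ (fun S hS => ?_) ha ?_
    · by_contra hc
      exact hS (boundary_apply_of_notMem _ hc)
    · rw [← boundary_pullback hχ hψ hc, hpull, h]

include hχ hψ hc in
theorem ExactAt.transport (hQ : ∀ S ∈ U₁, S ∈ Q₁ → χ S ∈ Q) (hP : ∀ S ∈ U₁, χ S ∈ P → S ∈ P₁)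
    (h : ExactAt c' U₁ Q₁ P₁) : ExactAt c U Q P := by
  intro a ha hda
  obtain ⟨b', hb', hdb'⟩ := h _ (support_indicator_comp hP ha) (by
    rw [boundary_pullback hχ hψ hc, hda]
    exact Set.indicator_zero' _)
  exact exists_boundary_eq_of_pullback hχ hψ hc hQ (fun S hS => (ha hS).1) hb' hdb'

include hχ hψ hc in
theorem TorsionFreeAt.transport (hQ : ∀ S ∈ U₁, S ∈ Q₁ ↔ χ S ∈ Q)
    (hP : ∀ S ∈ U₁, χ S ∈ P → S ∈ P₁)
    (h : TorsionFreeAt c' U₁ Q₁ P₁) : TorsionFreeAt c U Q P := by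
  rintro a n hn ha ⟨b, hb, hdb⟩
  obtain ⟨b', hb', hdb'⟩ := h _ n hn (support_indicator_comp hP ha) ⟨_,
    support_indicator_comp (fun S hS => (hQ S hS).2) hb, by
      rw [boundary_pullback hχ hψ hc, hdb]
      exact Set.indicator_zsmul _ n _⟩
  exact exists_boundary_eq_of_pullback hχ hψ hc (fun S hS => (hQ S hS).1) (fun S hS => (ha hS).1)
    hb' hdb'

end Transport

end BasedComplex

/-! ### Partially smoothed diagrams as subcubes with signs -/

namespace LinkDiagram

variable {V : Type*} [Fintype V] {D : LinkDiagram V}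

open Classical in
/-- The matrix of the differential, with an arbitrary assignment `κ` of signs to the edges of the
cube of Kauffman states. -/
def incidenceMatrix (D : LinkDiagram V) (κ : (V → ℤˣ) → V → ℤˣ) (S T : D.EnhancedState) : ℤ :=
  ∑ v, if S.Incident T v then (κ S.1 v : ℤ) else 0

/-- The enhanced states whose markers outside of `W` are those of `s`: the generators for the
diagram in which the crossings outside of `W` are smoothed according to `s`. -/
def cube (D : LinkDiagram V) (W : Finset V) (s : V → ℤˣ) : Set D.EnhancedState :=
  {S | ∀ w, w ∉ W → S.1 w = s w}

/-- The enhanced states of bidegree `(i, j)`. -/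
def bidegree (D : LinkDiagram V) (i j : ℤ) : Set D.EnhancedState :=
  {S | S.sigma = i ∧ S.sigma + 2 * S.tau = j}

/-- The signs `κ` make the faces of the cube with directions in `W` anticommute. -/
def Anticommutes [DecidableEq V] (W : Finset V) (κ : (V → ℤˣ) → V → ℤˣ) : Prop :=
  ∀ t v w, v ∈ W → w ∈ W → v ≠ w → t v = 1 → t w = 1 →
    κ t v * κ (Function.update t v (-1)) w = -(κ t w * κ (Function.update t w (-1)) v)

namespace EnhancedState

theorem Incident.fst_eq [DecidableEq V] {S T : D.EnhancedState} {v : V} (h : S.Incident T v) :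
    T.1 = Function.update S.1 v (-1) := by
  funext u
  by_cases hu : u = v
  · rw [hu, h.2.1, Function.update_self]
  · rw [← h.2.2.1 u hu, Function.update_of_ne hu]

theorem Incident.unique {S T : D.EnhancedState} {v w : V} (h : S.Incident T v)
    (h' : S.Incident T w) : v = w := by
  by_contra hne
  have := h.2.2.1 w (Ne.symm hne)
  rw [h'.1, h'.2.1] at this
  exact absurd this (by decide)

theorem sigma_eq_of_eq {S T : D.EnhancedState} {v : V} (h : ∀ w, w ≠ v → S.1 w = T.1 w) :
    S.sigma = T.sigma + S.1 v - T.1 v := by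
  classical
  unfold sigma
  have hS := Finset.add_sum_erase Finset.univ (fun w => (S.1 w : ℤ)) (Finset.mem_univ v)
  have hT := Finset.add_sum_erase Finset.univ (fun w => (T.1 w : ℤ)) (Finset.mem_univ v)
  have : ∑ w ∈ Finset.univ.erase v, (S.1 w : ℤ) = ∑ w ∈ Finset.univ.erase v, (T.1 w : ℤ) :=
    Finset.sum_congr rfl fun w hw => by rw [h w (Finset.ne_of_mem_erase hw)]
  linarith

theorem Incident.sigma_eq {S T : D.EnhancedState} {v : V} (h : S.Incident T v) :
    S.sigma = T.sigma + 2 := by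
  rw [sigma_eq_of_eq h.2.2.1, h.1, h.2.1]
  push_cast
  ring

end EnhancedState

theorem incidenceMatrix_of_incident (κ : (V → ℤˣ) → V → ℤˣ) {S T : D.EnhancedState} {v : V}
    (h : S.Incident T v) : D.incidenceMatrix κ S T = κ S.1 v := by
  classical
  unfold incidenceMatrix
  rw [Finset.sum_eq_single v]
  · rw [if_pos h]
  · intro w _ hw
    exact if_neg fun h' => hw (h'.unique h)
  · simp

theorem exists_incident_of_ne_zero {κ : (V → ℤˣ) → V → ℤˣ} {S T : D.EnhancedState}
    (h : D.incidenceMatrix κ S T ≠ 0) : ∃ v, S.Incident T v := by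
  classical
  obtain ⟨v, -, hv⟩ := Finset.exists_ne_zero_of_sum_ne_zero h
  exact ⟨v, by by_contra hc; exact hv (if_neg hc)⟩

theorem incidenceMatrix_mapsDegree (κ : (V → ℤˣ) → V → ℤˣ) (i j : ℤ) :
    MapsDegree (D.incidenceMatrix κ) (D.bidegree (i + 2) j) (D.bidegree i j) := by
  rintro S T h ⟨h1, h2⟩
  obtain ⟨v, hv⟩ := exists_incident_of_ne_zero h
  have h3 := hv.sigma_eq
  have h4 := hv.2.2.2.2.2
  constructor <;> lia

theorem incidenceMatrix_mem_iff {κ : (V → ℤˣ) → V → ℤˣ} {S T : D.EnhancedState}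
    (h : D.incidenceMatrix κ S T ≠ 0) (i j : ℤ) :
    S ∈ D.bidegree (i + 2) j ↔ T ∈ D.bidegree i j := by
  refine ⟨incidenceMatrix_mapsDegree κ i j S T h, ?_⟩
  rintro ⟨h1, h2⟩
  obtain ⟨v, hv⟩ := exists_incident_of_ne_zero h
  have h3 := hv.sigma_eq
  have h4 := hv.2.2.2.2.2
  constructor <;> lia

theorem EnhancedState.Incident.mem {W : Finset V} {s : V → ℤˣ} {S T : D.EnhancedState} {v : V}
    (h : S.Incident T v) (hS : S ∈ D.cube W s) (hT : T ∈ D.cube W s) : v ∈ W := by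
  by_contra hv
  have := (hS v hv).trans (hT v hv).symm
  rw [h.1, h.2.1] at this
  exact absurd this (by decide)

variable [DecidableEq V]

/-- Unsigned squares commute and the signs anticommute, so the two paths around each square cancel.
-/
theorem squareZero_cube {ev : V × Fin 4 → Bool} (hev : D.IsSourceSink ev) (hl : D.loops = 0)
    {W : Finset V} {κ : (V → ℤˣ) → V → ℤˣ} (hκ : Anticommutes W κ) (s : V → ℤˣ) :
    SquareZero (D.incidenceMatrix κ) (D.cube W s) := by
  classical
  intro S hS T hT
  -- The sign of a two-step path, extended by zero. Cutting off at `W` makes it antisymmetric and at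
  -- the same time drops the paths through states outside the cube.
  let g : V → V → ℤ := fun v w => if v ∈ W ∧ w ∈ W ∧ v ≠ w ∧ S.1 v = 1 ∧ S.1 w = 1 then
    κ S.1 v * κ (Function.update S.1 v (-1)) w else 0
  have hg : ∀ v w, g v w = - g w v := by
    intro v w
    simp only [g]
    by_cases h : v ∈ W ∧ w ∈ W ∧ v ≠ w ∧ S.1 v = 1 ∧ S.1 w = 1
    · obtain ⟨h1, h2, h3, h4, h5⟩ := h
      rw [if_pos ⟨h1, h2, h3, h4, h5⟩, if_pos ⟨h2, h1, h3.symm, h5, h4⟩]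
      have := congrArg (fun u : ℤˣ => (u : ℤ)) (hκ S.1 v w h1 h2 h3 h4 h5)
      push_cast at this
      exact this
    · rw [if_neg h, if_neg fun h' => h ⟨h'.2.1, h'.1, h'.2.2.1.symm, h'.2.2.2.2, h'.2.2.2.1⟩,
        neg_zero]
  have hterm : ∀ R : D.EnhancedState,
      (if R ∈ D.cube W s then D.incidenceMatrix κ S R * D.incidenceMatrix κ R T else 0) =
      ∑ v, ∑ w, g v w *
        ((if S.Incident R v then (1 : ℤ) else 0) * (if R.Incident T w then 1 else 0)) := by
    intro R
    split_ifs with hR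
    · unfold incidenceMatrix
      rw [Finset.sum_mul_sum]
      refine Finset.sum_congr rfl fun v _ => Finset.sum_congr rfl fun w _ => ?_
      by_cases h1 : S.Incident R v
      · by_cases h2 : R.Incident T w
        · have hvw : v ≠ w := by
            rintro rfl
            exact absurd (h1.2.1.symm.trans h2.1) (by decide)
          have hgv : g v w = κ S.1 v * κ R.1 w := by
            simp only [g]
            rw [if_pos ⟨h1.mem hS hR, h2.mem hR hT, hvw, h1.1,
              (h1.2.2.1 w hvw.symm).trans h2.1⟩, h1.fst_eq]
          rw [if_pos h1, if_pos h2, if_pos h1, if_pos h2, hgv]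
          ring
        · rw [if_neg h2, if_neg h2, mul_zero, mul_zero, mul_zero]
      · rw [if_neg h1, if_neg h1, zero_mul, zero_mul, mul_zero]
    · symm
      refine Finset.sum_eq_zero fun v _ => Finset.sum_eq_zero fun w _ => ?_
      by_cases h1 : S.Incident R v
      · have hv : v ∉ W := by
          intro hv
          apply hR
          intro u hu
          rw [← h1.2.2.1 u fun h => hu (h ▸ hv), hS u hu]
        simp only [g]
        rw [if_neg fun h => hv h.1, zero_mul]
      · rw [if_neg h1, zero_mul, mul_zero]
  simp only [hterm]
  rw [Finset.sum_comm]
  simp only [Finset.sum_comm (s := (Finset.univ : Finset D.EnhancedState)), ← Finset.mul_sum]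
  have hanti : ∀ v w, g v w * ∑ R : D.EnhancedState, (if S.Incident R v then (1 : ℤ) else 0) *
      (if R.Incident T w then 1 else 0) = - (g w v * ∑ R : D.EnhancedState,
      (if S.Incident R w then (1 : ℤ) else 0) * (if R.Incident T v then 1 else 0)) := by
    intro v w
    by_cases h : v ∈ W ∧ w ∈ W ∧ v ≠ w ∧ S.1 v = 1 ∧ S.1 w = 1
    · rw [hg v w, S.sum_incident_mul_incident hev hl T h.2.2.1 h.2.2.2.1 h.2.2.2.2, neg_mul]
    · have h0 : g v w = 0 := if_neg h
      have h0' : g w v = 0 := by rw [hg, h0, neg_zero]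
      rw [h0, h0', zero_mul, zero_mul, neg_zero]
  have hsum : ∀ F : V → V → ℤ, (∀ v w, F v w = - F w v) → ∑ v, ∑ w, F v w = 0 := by
    intro F hF
    have h1 : ∑ v, ∑ w, F v w = - ∑ v, ∑ w, F v w := by
      conv_lhs => rw [Finset.sum_comm]
      rw [← Finset.sum_neg_distrib]
      refine Finset.sum_congr rfl fun v _ => ?_
      rw [← Finset.sum_neg_distrib]
      exact Finset.sum_congr rfl fun w _ => hF w v
    lia
  exact hsum _ hanti

theorem mem_cube_erase {W : Finset V} {s : V → ℤˣ} {v : V} (hv : v ∈ W) (m : ℤˣ)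
    (S : D.EnhancedState) :
    S ∈ D.cube (W.erase v) (Function.update s v m) ↔ S ∈ D.cube W s ∧ S.1 v = m := by
  constructor
  · intro h
    refine ⟨fun w hw => ?_, ?_⟩
    · have hwv : w ≠ v := fun e => hw (e ▸ hv)
      rw [h w (by simp [hw]), Function.update_of_ne hwv]
    · rw [h v (by simp), Function.update_self]
  · rintro ⟨h, hm⟩ w hw
    by_cases hwv : w = v
    · rw [hwv, hm, Function.update_self]
    · rw [Function.update_of_ne hwv, h w (by simpa [hwv] using hw)]

/-- The differential only turns positive markers into negative ones, so the negative smoothing is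
the subcomplex. -/
theorem isExtension_cube (κ : (V → ℤˣ) → V → ℤˣ) {W : Finset V} (s : V → ℤˣ) {v : V}
    (hv : v ∈ W) : IsExtension (D.incidenceMatrix κ) (D.cube W s)
      (D.cube (W.erase v) (Function.update s v (-1)))
      (D.cube (W.erase v) (Function.update s v 1)) where
  union := by
    ext S
    rw [Set.mem_union, mem_cube_erase hv, mem_cube_erase hv, ← and_or_left]
    exact and_iff_left (Int.units_eq_one_or _).symm
  disjoint S h h' := by
    rw [mem_cube_erase hv] at h h'
    exact absurd (h.2.symm.trans h'.2) (by decide)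
  zero S hS T hT := by
    rw [mem_cube_erase hv] at hS hT
    by_contra hne
    obtain ⟨w, hw⟩ := exists_incident_of_ne_zero hne
    by_cases hwv : w = v
    · subst hwv
      exact absurd (hw.2.1.symm.trans hT.2) (by decide)
    · exact absurd (hS.2.symm.trans ((hw.2.2.1 v (Ne.symm hwv)).trans hT.2)) (by decide)

omit [Fintype V] in
theorem Anticommutes.mono {W W' : Finset V} {κ : (V → ℤˣ) → V → ℤˣ} (h : Anticommutes W κ)
    (hW : W' ⊆ W) : Anticommutes W' κ :=
  fun t v w hv hw => h t v w (hW hv) (hW hw)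

omit [Fintype V] in
-- A kink is removed by passing to the states with marker `-m` at `v`, but the signs to be used
-- there are those of the states with marker `m`. This is why the induction allows arbitrary
-- anticommuting signs.
theorem Anticommutes.update {W : Finset V} {κ : (V → ℤˣ) → V → ℤˣ} (h : Anticommutes W κ)
    (v : V) (m : ℤˣ) :
    Anticommutes (W.erase v) fun t => κ (Function.update t v m) := by
  intro t u w hu hw huw htu htw
  rw [Finset.mem_erase] at hu hw
  have := h (Function.update t v m) u w hu.2 hw.2 huw (by rwa [Function.update_of_ne hu.1])
    (by rwa [Function.update_of_ne hw.1])
  rwa [Function.update_comm hu.1.symm, Function.update_comm hw.1.symm] at this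

end LinkDiagram

/-! ### Kinks: splitting off a circle and absorbing it -/

namespace LinkDiagram

variable {V : Type*} [Fintype V] {D : LinkDiagram V} [DecidableEq V]

/-- If the crossing `v` is smoothed according to `m`, then `A` is a circle that splits off, touches
no other crossing of `W` and passes through the half-edge `(v, p)`. -/
structure IsKink (D : LinkDiagram V) (W : Finset V) (s : V → ℤˣ) (v : V) (m : ℤˣ) (p : Fin 4)
    (A : Set (V × Fin 4)) : Prop where
  mem : v ∈ W
  mem_iff : ∀ t : V → ℤˣ, (∀ w, w ∉ W → t w = s w) → t v = m →
    ∀ x, x ∈ A ↔ D.circle t x = D.circle t (v, p)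
  opposite : (v, p + 2) ∉ A
  notMem : ∀ w ∈ W, w ≠ v → ∀ q, (w, q) ∉ A

namespace IsKink

variable {W : Finset V} {s : V → ℤˣ} {v : V} {m : ℤˣ} {p : Fin 4} {A : Set (V × Fin 4)}
  {ev : V × Fin 4 → Bool}

omit [DecidableEq V] in
theorem not_joined (h : D.IsKink W s v m p A) {t : V → ℤˣ} (ht : ∀ w, w ∉ W → t w = s w)
    (hv : t v = m) : ¬ D.Joined t v := fun hj =>
  h.opposite ((h.mem_iff t ht hv _).2 (hj.circle_eq _ _))

omit [DecidableEq V] in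
theorem joined (h : D.IsKink W s v m p A) (hev : D.IsSourceSink ev) {t t' : V → ℤˣ}
    (ht : ∀ w, w ∉ W → t w = s w) (hv : t v = m) (htt' : ∀ w, w ≠ v → t w = t' w)
    (hv' : t' v = -m) : D.Joined t' v := by
  by_contra hj
  refine h.not_joined ht hv ((joined_iff_not_joined hev htt' ?_).2 hj)
  rw [hv, hv']
  rcases Int.units_eq_one_or m with rfl | rfl <;> decide

omit [DecidableEq V] in
theorem self_mem (h : D.IsKink W s v m p A) {t : V → ℤˣ} (ht : ∀ w, w ∉ W → t w = s w)
    (hv : t v = m) : (v, p) ∈ A := (h.mem_iff t ht hv _).2 rfl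

omit [DecidableEq V] in
theorem circle_eq_iff (h : D.IsKink W s v m p A) (hev : D.IsSourceSink ev) {t t' : V → ℤˣ}
    (ht : ∀ w, w ∉ W → t w = s w) (hv : t v = m) (htt' : ∀ w, w ≠ v → t w = t' w)
    (hv' : t' v = -m) {x y : V × Fin 4} (hx : x ∉ A) (hy : y ∉ A) :
    D.circle t x = D.circle t y ↔ D.circle t' x = D.circle t' y := by
  refine ⟨circle_eq_of_joined htt' (h.joined hev ht hv htt' hv'), fun hxy => ?_⟩
  rw [h.mem_iff t ht hv] at hx hy
  rcases circle_eq_or_of_circle_eq htt' p hxy with h1 | ⟨h1, h2⟩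
  · exact h1
  · exact (h1.resolve_left hx).trans (h2.resolve_left hy).symm

omit [DecidableEq V] in
theorem circle_eq_of_mem (h : D.IsKink W s v m p A) (hev : D.IsSourceSink ev) {t t' : V → ℤˣ}
    (ht : ∀ w, w ∉ W → t w = s w) (hv : t v = m) (htt' : ∀ w, w ≠ v → t w = t' w)
    (hv' : t' v = -m) {x : V × Fin 4} (hx : x ∈ A) (q : Fin 4) :
    D.circle t' x = D.circle t' (v, q) := by
  have hj := h.joined hev ht hv htt' hv'
  exact (circle_eq_of_joined htt' hj ((h.mem_iff t ht hv x).1 hx)).trans (hj.circle_eq _ _)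

end IsKink

namespace EnhancedState

variable {W : Finset V} {s : V → ℤˣ} {v : V} {m : ℤˣ} {p : Fin 4} {A : Set (V × Fin 4)}
  {ev : V × Fin 4 → Bool}

open Classical in
/-- Split off the circle `A` with the sign `ε` by giving the crossing `v` the marker `m`. -/
def splitOff (hl : D.loops = 0) (v : V) (m : ℤˣ) (A : Set (V × Fin 4)) (ε : ℤˣ)
    (S : D.EnhancedState) : D.EnhancedState :=
  ofSgn hl (Function.update S.1 v m) fun x => if x ∈ A then ε else S.sgn x

open Classical in
/-- Absorb the circle `A` into the other circle at `v` by changing the marker of `v` into `-m`. -/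
def absorb (hl : D.loops = 0) (v : V) (m : ℤˣ) (p : Fin 4) (A : Set (V × Fin 4))
    (S : D.EnhancedState) : D.EnhancedState :=
  ofSgn hl (Function.update S.1 v (-m)) fun x => if x ∈ A then S.sgn (v, p + 2) else S.sgn x

theorem splitOff_fst (hl : D.loops = 0) (ε : ℤˣ) (S : D.EnhancedState) :
    (splitOff hl v m A ε S).1 = Function.update S.1 v m := rfl

theorem absorb_fst (hl : D.loops = 0) (S : D.EnhancedState) :
    (absorb hl v m p A S).1 = Function.update S.1 v (-m) := rfl

theorem update_mem (hv : v ∈ W) {S : D.EnhancedState} (hS : S ∈ D.cube W s) (m : ℤˣ) :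
    ∀ w, w ∉ W → Function.update S.1 v m w = s w := fun w hw => by
  have hwv : w ≠ v := fun e => hw (e ▸ hv)
  rw [Function.update_of_ne hwv, hS w hw]

theorem splitOff_mem (h : D.IsKink W s v m p A) (hl : D.loops = 0) (ε : ℤˣ)
    {S : D.EnhancedState} (hS : S ∈ D.cube W s) : splitOff hl v m A ε S ∈ D.cube W s :=
  update_mem h.mem hS m

theorem absorb_mem (h : D.IsKink W s v m p A) (hl : D.loops = 0)
    {S : D.EnhancedState} (hS : S ∈ D.cube W s) : absorb hl v m p A S ∈ D.cube W s :=
  update_mem h.mem hS (-m)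

open Classical in
theorem sgn_splitOff (h : D.IsKink W s v m p A) (hev : D.IsSourceSink ev) (hl : D.loops = 0)
    (ε : ℤˣ) {S : D.EnhancedState} (hS : S ∈ D.cube W s) (hSv : S.1 v = -m) (x : V × Fin 4) :
    (splitOff hl v m A ε S).sgn x = if x ∈ A then ε else S.sgn x := by
  have ht := update_mem h.mem hS m
  have hv : Function.update S.1 v m v = m := Function.update_self ..
  have htt' : ∀ w, w ≠ v → Function.update S.1 v m w = S.1 w := fun w hw =>
    Function.update_of_ne hw ..
  refine sgn_ofSgn hl _ _ (fun x y hxy => ?_) x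
  have hA : x ∈ A ↔ y ∈ A := by
    rw [h.mem_iff _ ht hv, h.mem_iff _ ht hv, hxy]
  by_cases hx : x ∈ A
  · rw [if_pos hx, if_pos (hA.1 hx)]
  · have hy := fun hy => hx (hA.2 hy)
    rw [if_neg hx, if_neg hy]
    exact S.sgn_congr ((h.circle_eq_iff hev ht hv htt' hSv hx hy).1 hxy)

open Classical in
theorem sgn_absorb (h : D.IsKink W s v m p A) (hl : D.loops = 0)
    {S : D.EnhancedState} (hS : S ∈ D.cube W s) (hSv : S.1 v = m) (x : V × Fin 4) :
    (absorb hl v m p A S).sgn x = if x ∈ A then S.sgn (v, p + 2) else S.sgn x := by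
  have htt' : ∀ w, w ≠ v → S.1 w = Function.update S.1 v (-m) w := fun w hw =>
    (Function.update_of_ne hw ..).symm
  refine sgn_ofSgn hl _ _ (fun x y hxy => ?_) x
  rcases circle_eq_or_of_circle_eq htt' p hxy with h1 | ⟨h1, h2⟩
  · have hA : x ∈ A ↔ y ∈ A := by
      rw [h.mem_iff _ hS hSv, h.mem_iff _ hS hSv, h1]
    rw [S.sgn_congr h1]
    simp only [hA]
  · have : ∀ x, D.circle S.1 x = D.circle S.1 (v, p) ∨ D.circle S.1 x = D.circle S.1 (v, p + 2) →
        (if x ∈ A then S.sgn (v, p + 2) else S.sgn x) = S.sgn (v, p + 2) := by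
      intro x hx
      split_ifs with hA
      · rfl
      · rw [h.mem_iff _ hS hSv] at hA
        exact S.sgn_congr (hx.resolve_left hA)
    rw [this x h1, this y h2]

theorem absorb_splitOff (h : D.IsKink W s v m p A) (hev : D.IsSourceSink ev) (hl : D.loops = 0)
    (ε : ℤˣ) {S : D.EnhancedState} (hS : S ∈ D.cube W s) (hSv : S.1 v = -m) :
    absorb hl v m p A (splitOff hl v m A ε S) = S := by
  have hv : (splitOff hl v m A ε S).1 v = m := Function.update_self ..
  refine ext_sgn hl ?_ fun x => ?_
  · rw [absorb_fst, splitOff_fst, Function.update_idem, ← hSv, Function.update_eq_self]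
  · rw [sgn_absorb h hl (splitOff_mem h hl ε hS) hv, sgn_splitOff h hev hl ε hS hSv,
      sgn_splitOff h hev hl ε hS hSv, if_neg h.opposite]
    split_ifs with hx
    · exact (S.sgn_congr (h.circle_eq_of_mem hev (splitOff_mem h hl ε hS) hv
        (fun w hw => Function.update_of_ne hw ..) hSv hx _)).symm
    · rfl

theorem splitOff_absorb (h : D.IsKink W s v m p A) (hev : D.IsSourceSink ev) (hl : D.loops = 0)
    (ε : ℤˣ) {S : D.EnhancedState} (hS : S ∈ D.cube W s) (hSv : S.1 v = m)
    (hε : S.sgn (v, p) = ε) : splitOff hl v m A ε (absorb hl v m p A S) = S := by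
  have hv : (absorb hl v m p A S).1 v = -m := Function.update_self ..
  refine ext_sgn hl ?_ fun x => ?_
  · rw [splitOff_fst, absorb_fst, Function.update_idem, ← hSv, Function.update_eq_self]
  · rw [sgn_splitOff h hev hl ε (absorb_mem h hl hS) hv, sgn_absorb h hl hS hSv]
    split_ifs with hx
    · rw [← hε]
      exact (S.sgn_congr ((h.mem_iff _ hS hSv x).1 hx)).symm
    · rfl

theorem tau_splitOff (h : D.IsKink W s v m p A) (hev : D.IsSourceSink ev) (hl : D.loops = 0)
    (ε : ℤˣ) {S : D.EnhancedState} (hS : S ∈ D.cube W s) (hSv : S.1 v = -m) :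
    (splitOff hl v m A ε S).tau = S.tau + ε := by
  have ht := splitOff_mem h hl ε hS
  have hv : (splitOff hl v m A ε S).1 v = m := Function.update_self ..
  have htt' : ∀ w, w ≠ v → (splitOff hl v m A ε S).1 w = S.1 w := fun w hw =>
    Function.update_of_ne hw ..
  have hj := h.joined hev ht hv htt' hSv
  have := tau_of_joined hl htt' (h.not_joined ht hv) hj p fun x hx => by
    rw [sgn_splitOff h hev hl ε hS hSv, if_neg]
    exact fun hA => hx (h.circle_eq_of_mem hev ht hv htt' hSv hA 0)
  rw [sgn_splitOff h hev hl ε hS hSv, sgn_splitOff h hev hl ε hS hSv, if_pos (h.self_mem ht hv),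
    if_neg h.opposite, S.sgn_congr (hj.circle_eq (p + 2) 0)] at this
  linarith

theorem sigma_splitOff (hl : D.loops = 0) (ε : ℤˣ) {S : D.EnhancedState} (hSv : S.1 v = -m) :
    (splitOff hl v m A ε S).sigma = S.sigma + 2 * m := by
  rw [sigma_eq_of_eq (T := S) (v := v) fun w hw => Function.update_of_ne hw .., splitOff_fst,
    Function.update_self, hSv]
  push_cast
  ring

/-- The circle `A` touches no other crossing of `W`, so it is a spectator: it has the same sign in
both states and shifts both values of `τ` by `ε`. -/
theorem incident_splitOff_iff (h : D.IsKink W s v m p A) (hev : D.IsSourceSink ev)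
    (hl : D.loops = 0) (ε : ℤˣ) {S T : D.EnhancedState} (hS : S ∈ D.cube W s) (hSv : S.1 v = -m)
    (hT : T ∈ D.cube W s) (hTv : T.1 v = -m) (w : V) :
    (splitOff hl v m A ε S).Incident (splitOff hl v m A ε T) w ↔ S.Incident T w := by
  have hS' := splitOff_mem h hl ε hS
  have hT' := splitOff_mem h hl ε hT
  have hv : ∀ S : D.EnhancedState, (splitOff hl v m A ε S).1 v = m := fun S =>
    Function.update_self ..
  have hne : ∀ S : D.EnhancedState, ∀ w, w ≠ v → (splitOff hl v m A ε S).1 w = S.1 w :=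
    fun S w hw => Function.update_of_ne hw ..
  by_cases hwv : w = v
  · subst hwv
    refine iff_of_false (fun hi => ?_) fun hi => ?_
    · exact absurd (hi.1.symm.trans ((hv S).trans ((hv T).symm.trans hi.2.1))) (by decide)
    · exact absurd (hi.1.symm.trans (hSv.trans (hTv.symm.trans hi.2.1))) (by decide)
  by_cases hw : w ∈ W
  swap
  · exact iff_of_false (fun hi => hw (hi.mem hS' hT')) fun hi => hw (hi.mem hS hT)
  rw [incident_iff hl, incident_iff hl, hne S w hwv, hne T w hwv, tau_splitOff h hev hl ε hS hSv,
    tau_splitOff h hev hl ε hT hTv]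
  have e3 : (∀ u, u ≠ w → (splitOff hl v m A ε S).1 u = (splitOff hl v m A ε T).1 u) ↔
      ∀ u, u ≠ w → S.1 u = T.1 u := by
    refine forall_congr' fun u => imp_congr_right fun _ => ?_
    by_cases hu : u = v
    · rw [hu, hv, hv, hSv, hTv]; simp
    · rw [hne S u hu, hne T u hu]
  have e4 : (∀ x, (∀ q, D.circle (splitOff hl v m A ε S).1 x ≠
        D.circle (splitOff hl v m A ε S).1 (w, q)) →
        (splitOff hl v m A ε S).sgn x = (splitOff hl v m A ε T).sgn x) ↔
      ∀ x, (∀ q, D.circle S.1 x ≠ D.circle S.1 (w, q)) → S.sgn x = T.sgn x := by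
    have hout : ∀ x, x ∉ A → ((∀ q, D.circle (splitOff hl v m A ε S).1 x ≠
        D.circle (splitOff hl v m A ε S).1 (w, q)) ↔
        ∀ q, D.circle S.1 x ≠ D.circle S.1 (w, q)) := fun x hx =>
      forall_congr' fun q => not_congr
        (h.circle_eq_iff hev hS' (hv S) (hne S) hSv hx (h.notMem w hw hwv q))
    constructor
    · have key : ∀ x, x ∉ A → (∀ x, (∀ q, D.circle (splitOff hl v m A ε S).1 x ≠
          D.circle (splitOff hl v m A ε S).1 (w, q)) →
          (splitOff hl v m A ε S).sgn x = (splitOff hl v m A ε T).sgn x) →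
          (∀ q, D.circle S.1 x ≠ D.circle S.1 (w, q)) → S.sgn x = T.sgn x := by
        intro x hx hyp hq
        have := hyp x ((hout x hx).2 hq)
        rwa [sgn_splitOff h hev hl ε hS hSv, sgn_splitOff h hev hl ε hT hTv, if_neg hx,
          if_neg hx] at this
      intro hyp x hq
      -- Before splitting, `A` is part of the circle through `(v, p + 2)`. Hence `x` may be replaced
      -- by this half-edge, which lies outside `A`.
      by_cases hx : x ∈ A
      · have c1 := h.circle_eq_of_mem hev hS' (hv S) (hne S) hSv hx (p + 2)
        have c2 := h.circle_eq_of_mem hev hT' (hv T) (hne T) hTv hx (p + 2)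
        rw [S.sgn_congr c1, T.sgn_congr c2]
        exact key _ h.opposite hyp fun q hc => hq q (c1.trans hc)
      · exact key x hx hyp hq
    · intro hyp x hq
      rw [sgn_splitOff h hev hl ε hS hSv, sgn_splitOff h hev hl ε hT hTv]
      split_ifs with hx
      · rfl
      · exact hyp x ((hout x hx).1 hq)
  rw [e3, e4]
  refine and_congr_right fun _ => and_congr_right fun _ => and_congr_right fun _ =>
    and_congr_right fun _ => ?_
  constructor <;> intro <;> linarith

theorem incidenceMatrix_splitOff (h : D.IsKink W s v m p A) (hev : D.IsSourceSink ev)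
    (hl : D.loops = 0) (κ : (V → ℤˣ) → V → ℤˣ) (ε : ℤˣ) {S T : D.EnhancedState}
    (hS : S ∈ D.cube W s) (hSv : S.1 v = -m) (hT : T ∈ D.cube W s) (hTv : T.1 v = -m) :
    D.incidenceMatrix κ (splitOff hl v m A ε S) (splitOff hl v m A ε T) =
      D.incidenceMatrix (fun t => κ (Function.update t v m)) S T := by
  unfold incidenceMatrix
  refine Finset.sum_congr rfl fun w _ => ?_
  classical
  exact if_congr (incident_splitOff_iff h hev hl ε hS hSv hT hTv w) rfl rfl

theorem eq_absorb_iff (h : D.IsKink W s v m p A) (hev : D.IsSourceSink ev) (hl : D.loops = 0)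
    {S T : D.EnhancedState} (hS : S ∈ D.cube W s) (hSv : S.1 v = m)
    (hST : ∀ w, w ≠ v → S.1 w = T.1 w) (hTv : T.1 v = -m) :
    T = absorb hl v m p A S ↔
      (∀ x, D.circle T.1 x ≠ D.circle T.1 (v, 0) → S.sgn x = T.sgn x) ∧
        T.sgn (v, 0) = S.sgn (v, p + 2) := by
  have hj := h.joined hev hS hSv hST hTv
  constructor
  · intro he
    have hsgn : ∀ x, T.sgn x = (absorb hl v m p A S).sgn x := fun x => by rw [he]
    constructor
    · intro x hx
      rw [hsgn, sgn_absorb h hl hS hSv, if_neg]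
      exact fun hA => hx (h.circle_eq_of_mem hev hS hSv hST hTv hA 0)
    · rw [T.sgn_congr (hj.circle_eq 0 (p + 2)), hsgn, sgn_absorb h hl hS hSv, if_neg h.opposite]
  · rintro ⟨h1, h2⟩
    refine ext_sgn hl ?_ fun x => ?_
    · funext w
      rw [absorb_fst]
      by_cases hw : w = v
      · rw [hw, hTv, Function.update_self]
      · rw [Function.update_of_ne hw, hST w hw]
    · rw [sgn_absorb h hl hS hSv]
      split_ifs with hx
      · rw [T.sgn_congr (h.circle_eq_of_mem hev hS hSv hST hTv hx 0), h2]
      · by_cases hc : D.circle T.1 x = D.circle T.1 (v, 0)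
        · rw [T.sgn_congr hc, h2]
          rw [← hj.circle_eq (p + 2) 0] at hc
          exact (S.sgn_congr ((h.circle_eq_iff hev hS hSv hST hTv hx h.opposite).2 hc)).symm
        · exact (h1 x hc).symm

omit [DecidableEq V] in
-- A marker change at another crossing of the cube does not touch `A`. So the sign of `A` decomposes
-- the part with marker `m` into subcomplexes.
theorem sgn_eq_of_incident (h : D.IsKink W s v m p A) (hl : D.loops = 0) {S T : D.EnhancedState}
    (hS : S ∈ D.cube W s) (hSv : S.1 v = m) (hT : T ∈ D.cube W s) (hTv : T.1 v = m) {w : V}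
    (hi : S.Incident T w) : S.sgn (v, p) = T.sgn (v, p) := by
  have hwv : w ≠ v := by
    rintro rfl
    exact absurd (hi.1.symm.trans (hSv.trans (hTv.symm.trans hi.2.1))) (by decide)
  refine ((incident_iff hl).1 hi).2.2.2.1 _ fun q hq => h.notMem w (hi.mem hS hT) hwv q ?_
  rw [h.mem_iff _ hS hSv, hq]

end EnhancedState

end LinkDiagram

/-! ### Invariance of the homology under removal of a kink -/

namespace LinkDiagram

variable {V : Type*} [Fintype V] {D : LinkDiagram V} [DecidableEq V]

namespace IsKink

variable {W : Finset V} {s : V → ℤˣ} {v : V} {m : ℤˣ} {p : Fin 4} {A : Set (V × Fin 4)}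
  {ev : V × Fin 4 → Bool}

open EnhancedState

/-- The enhanced states in which the kink is split off with the sign `ε`. -/
def splitSet (D : LinkDiagram V) (W : Finset V) (s : V → ℤˣ) (v : V) (m : ℤˣ) (p : Fin 4)
    (ε : ℤˣ) : Set D.EnhancedState := {S | S ∈ D.cube W s ∧ S.1 v = m ∧ S.sgn (v, p) = ε}

theorem splitOff_mem_splitSet (h : D.IsKink W s v m p A) (hev : D.IsSourceSink ev)
    (hl : D.loops = 0) (ε : ℤˣ) {S : D.EnhancedState} (hS : S ∈ D.cube W s) (hSv : S.1 v = -m) :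
    splitOff hl v m A ε S ∈ splitSet D W s v m p ε := by
  have hv : (splitOff hl v m A ε S).1 v = m := Function.update_self ..
  refine ⟨splitOff_mem h hl ε hS, hv, ?_⟩
  rw [sgn_splitOff h hev hl ε hS hSv, if_pos (h.self_mem (splitOff_mem h hl ε hS) hv)]

/-- Splitting off with sign `m` adds `2m` to `σ` and `m` to `τ`. The diagonal `j - 2i` is therefore
unchanged. -/
theorem splitOff_bidegree_iff (h : D.IsKink W s v m p A) (hev : D.IsSourceSink ev)
    (hl : D.loops = 0) {S : D.EnhancedState} (hS : S ∈ D.cube W s) (hSv : S.1 v = -m)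
    (i j : ℤ) : S ∈ D.bidegree (i - 2 * m) (j - 4 * m) ↔ splitOff hl v m A m S ∈ D.bidegree i j := by
  unfold bidegree
  rw [Set.mem_ofPred_eq, Set.mem_ofPred_eq, sigma_splitOff hl m hSv, tau_splitOff h hev hl m hS hSv]
  constructor <;> rintro ⟨h1, h2⟩ <;> constructor <;> linarith

section

variable (h : D.IsKink W s v m p A) (hev : D.IsSourceSink ev) (hl : D.loops = 0)
  (κ : (V → ℤˣ) → V → ℤˣ) (i j : ℤ)

include h hev hl

theorem exactAt_splitSet
    (hq : ExactAt (D.incidenceMatrix fun t => κ (Function.update t v m))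
      (D.cube (W.erase v) (Function.update s v (-m))) (D.bidegree (i + 2 - 2 * m) (j - 4 * m))
      (D.bidegree (i - 2 * m) (j - 4 * m))) :
    ExactAt (D.incidenceMatrix κ) (splitSet D W s v m p m) (D.bidegree (i + 2) j)
      (D.bidegree i j) := by
  refine ExactAt.transport (χ := splitOff hl v m A m) (ψ := absorb hl v m p A)
    ?_ ?_ ?_ ?_ ?_ hq
  · intro S hS
    rw [mem_cube_erase h.mem] at hS
    exact ⟨h.splitOff_mem_splitSet hev hl m hS.1 hS.2, absorb_splitOff h hev hl m hS.1 hS.2⟩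
  · rintro S ⟨h1, h2, h3⟩
    rw [mem_cube_erase h.mem]
    exact ⟨⟨absorb_mem h hl h1, Function.update_self ..⟩, splitOff_absorb h hev hl m h1 h2 h3⟩
  · intro S hS T hT
    rw [mem_cube_erase h.mem] at hS hT
    exact incidenceMatrix_splitOff h hev hl κ m hS.1 hS.2 hT.1 hT.2
  · intro S hS
    rw [mem_cube_erase h.mem] at hS
    exact (h.splitOff_bidegree_iff hev hl hS.1 hS.2 (i + 2) j).1
  · intro S hS
    rw [mem_cube_erase h.mem] at hS
    exact (h.splitOff_bidegree_iff hev hl hS.1 hS.2 i j).2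

theorem torsionFreeAt_splitSet
    (hq : TorsionFreeAt (D.incidenceMatrix fun t => κ (Function.update t v m))
      (D.cube (W.erase v) (Function.update s v (-m))) (D.bidegree (i + 2 - 2 * m) (j - 4 * m))
      (D.bidegree (i - 2 * m) (j - 4 * m))) :
    TorsionFreeAt (D.incidenceMatrix κ) (splitSet D W s v m p m) (D.bidegree (i + 2) j)
      (D.bidegree i j) := by
  refine TorsionFreeAt.transport (χ := splitOff hl v m A m) (ψ := absorb hl v m p A)
    ?_ ?_ ?_ ?_ ?_ hq
  · intro S hS
    rw [mem_cube_erase h.mem] at hS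
    exact ⟨h.splitOff_mem_splitSet hev hl m hS.1 hS.2, absorb_splitOff h hev hl m hS.1 hS.2⟩
  · rintro S ⟨h1, h2, h3⟩
    rw [mem_cube_erase h.mem]
    exact ⟨⟨absorb_mem h hl h1, Function.update_self ..⟩, splitOff_absorb h hev hl m h1 h2 h3⟩
  · intro S hS T hT
    rw [mem_cube_erase h.mem] at hS hT
    exact incidenceMatrix_splitOff h hev hl κ m hS.1 hS.2 hT.1 hT.2
  · intro S hS
    rw [mem_cube_erase h.mem] at hS
    exact h.splitOff_bidegree_iff hev hl hS.1 hS.2 (i + 2) j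
  · intro S hS
    rw [mem_cube_erase h.mem] at hS
    exact (h.splitOff_bidegree_iff hev hl hS.1 hS.2 i j).2

end

theorem coe_mul_self (u : ℤˣ) : (u : ℤ) * u = 1 := by
  rw [← Units.val_mul, Int.units_mul_self, Units.val_one]

/-- In a merge a negative circle acts as a unit: the other circle keeps its sign. -/
theorem incident_iff_eq_absorb_pos (h : D.IsKink W s v 1 p A) (hev : D.IsSourceSink ev)
    (hl : D.loops = 0) {S T : D.EnhancedState} (hS : S ∈ splitSet D W s v 1 p (-1))
    (hST : ∀ w, w ≠ v → S.1 w = T.1 w) (hTv : T.1 v = -1) :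
    S.Incident T v ↔ T = absorb hl v 1 p A S := by
  obtain ⟨h1, h2, h3⟩ := hS
  rw [eq_absorb_iff h hev hl h1 h2 hST hTv, incident_iff_of_merge hl h2 hTv hST
    (h.not_joined h1 h2) (h.joined hev h1 h2 hST hTv) p, h3]
  refine and_congr_right fun _ => ?_
  rw [← Units.val_inj]
  push_cast
  constructor <;> intro <;> linarith

/-- Dually, among the results of a split there is exactly one in which `A` is positive, and in it
the other circle keeps the old sign. -/
theorem incident_iff_eq_absorb_neg (h : D.IsKink W s v (-1) p A) (hev : D.IsSourceSink ev)
    (hl : D.loops = 0) {S T : D.EnhancedState} (hT : T ∈ splitSet D W s v (-1) p 1)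
    (hST : ∀ w, w ≠ v → S.1 w = T.1 w) (hSv : S.1 v = 1) :
    S.Incident T v ↔ S = absorb hl v (-1) p A T := by
  obtain ⟨h1, h2, h3⟩ := hT
  have hTS : ∀ w, w ≠ v → T.1 w = S.1 w := fun w hw => (hST w hw).symm
  have hSv' : S.1 v = - -1 := by rw [hSv, neg_neg]
  rw [eq_absorb_iff h hev hl h1 h2 hTS hSv', incident_iff_of_split hl hSv h2 hST
    (h.joined hev h1 h2 hTS hSv') (h.not_joined h1 h2) p, h3]
  refine and_congr (forall_congr' fun x => imp_congr_right fun _ => eq_comm) ?_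
  rw [← Units.val_inj]
  push_cast
  constructor <;> intro <;> linarith

section

variable {κ : (V → ℤˣ) → V → ℤˣ} (i j : ℤ)

/-- For a positive kink the states with `A` negative cancel against those with marker `-1` at `v`;
together they form an acyclic subcomplex, and the states with `A` positive remain as the quotient.
-/
theorem isExtension_pos (h : D.IsKink W s v 1 p A) (hl : D.loops = 0) :
    IsExtension (D.incidenceMatrix κ) (D.cube W s)
      (D.cube (W.erase v) (Function.update s v (-1)) ∪ splitSet D W s v 1 p (-1))
      (splitSet D W s v 1 p 1) where
  union := by
    ext S
    simp only [Set.mem_union, mem_cube_erase h.mem, splitSet, Set.mem_ofPred_eq]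
    have h1 := Int.units_eq_one_or (S.1 v)
    have h2 := Int.units_eq_one_or (S.sgn (v, p))
    tauto
  disjoint := by
    rintro S (hS | ⟨-, -, hS⟩) ⟨-, h1, h2⟩
    · rw [mem_cube_erase h.mem] at hS
      exact absurd (hS.2.symm.trans h1) (by decide)
    · exact absurd (hS.symm.trans h2) (by decide)
  zero := by
    rintro S hS T ⟨hT, hTv, hTs⟩
    by_contra hne
    obtain ⟨w, hw⟩ := exists_incident_of_ne_zero hne
    rcases hS with hS | ⟨hS, hSv, hSs⟩
    · rw [mem_cube_erase h.mem] at hS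
      by_cases hwv : v = w
      · subst hwv
        exact absurd (hw.2.1.symm.trans hTv) (by decide)
      · exact absurd (hS.2.symm.trans ((hw.2.2.1 v hwv).trans hTv)) (by decide)
    · have := sgn_eq_of_incident h hl hS hSv hT hTv hw
      exact absurd (hSs.symm.trans (this.trans hTs)) (by decide)

theorem isExtension_pos_acyclic (h : D.IsKink W s v 1 p A) :
    IsExtension (D.incidenceMatrix κ)
      (D.cube (W.erase v) (Function.update s v (-1)) ∪ splitSet D W s v 1 p (-1))
      (D.cube (W.erase v) (Function.update s v (-1))) (splitSet D W s v 1 p (-1)) where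
  union := rfl
  disjoint := by
    rintro S hS ⟨-, h1, -⟩
    rw [mem_cube_erase h.mem] at hS
    exact absurd (hS.2.symm.trans h1) (by decide)
  zero := by
    rintro S hS T ⟨hT, hTv, hTs⟩
    refine (isExtension_cube κ s h.mem).zero S hS T ?_
    rw [mem_cube_erase h.mem]
    exact ⟨hT, hTv⟩

/-- For a negative kink the roles are reversed: the acyclic part is the quotient, and the states
with `A` negative remain as a subcomplex. -/
theorem isExtension_neg (h : D.IsKink W s v (-1) p A) (hl : D.loops = 0) :
    IsExtension (D.incidenceMatrix κ) (D.cube W s) (splitSet D W s v (-1) p (-1))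
      (splitSet D W s v (-1) p 1 ∪ D.cube (W.erase v) (Function.update s v 1)) where
  union := by
    ext S
    simp only [Set.mem_union, mem_cube_erase h.mem, splitSet, Set.mem_ofPred_eq]
    have h1 := Int.units_eq_one_or (S.1 v)
    have h2 := Int.units_eq_one_or (S.sgn (v, p))
    tauto
  disjoint := by
    rintro S ⟨-, h1, h2⟩ (⟨-, -, hS⟩ | hS)
    · exact absurd (hS.symm.trans h2) (by decide)
    · rw [mem_cube_erase h.mem] at hS
      exact absurd (hS.2.symm.trans h1) (by decide)
  zero := by
    rintro S ⟨hS, hSv, hSs⟩ T hT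
    by_contra hne
    obtain ⟨w, hw⟩ := exists_incident_of_ne_zero hne
    rcases hT with ⟨hT, hTv, hTs⟩ | hT
    · have := sgn_eq_of_incident h hl hS hSv hT hTv hw
      exact absurd (hSs.symm.trans (this.trans hTs)) (by decide)
    · rw [mem_cube_erase h.mem] at hT
      by_cases hwv : v = w
      · subst hwv
        exact absurd (hw.2.1.symm.trans hT.2) (by decide)
      · exact absurd (hSv.symm.trans ((hw.2.2.1 v hwv).trans hT.2)) (by decide)

theorem isExtension_neg_acyclic (h : D.IsKink W s v (-1) p A) :
    IsExtension (D.incidenceMatrix κ)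
      (splitSet D W s v (-1) p 1 ∪ D.cube (W.erase v) (Function.update s v 1))
      (splitSet D W s v (-1) p 1) (D.cube (W.erase v) (Function.update s v 1)) where
  union := rfl
  disjoint := by
    rintro S ⟨-, h1, -⟩ hS
    rw [mem_cube_erase h.mem] at hS
    exact absurd (hS.2.symm.trans h1) (by decide)
  zero := by
    rintro S ⟨hS, hSv, hSs⟩ T hT
    refine (isExtension_cube κ s h.mem).zero S ?_ T hT
    rw [mem_cube_erase h.mem]
    exact ⟨hS, hSv⟩

theorem eq_of_incident {S T : D.EnhancedState} {w : V} (h : S.Incident T w) (hSv : S.1 v = 1)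
    (hTv : T.1 v = -1) : w = v := by
  by_contra hne
  exact absurd (hSv.symm.trans ((h.2.2.1 v (Ne.symm hne)).trans hTv)) (by decide)

theorem acyclic_pos (h : D.IsKink W s v 1 p A) (hev : D.IsSourceSink ev) (hl : D.loops = 0)
    (hκ : Anticommutes W κ) : ExactAt (D.incidenceMatrix κ)
      (D.cube (W.erase v) (Function.update s v (-1)) ∪ splitSet D W s v 1 p (-1))
      (D.bidegree (i + 2) j) (D.bidegree i j) := by
  have hinc : ∀ S ∈ splitSet D W s v 1 p (-1), S.Incident (absorb hl v 1 p A S) v :=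
    fun S hS => (h.incident_iff_eq_absorb_pos hev hl hS
      (fun w hw => (Function.update_of_ne hw ..).symm) (Function.update_self ..)).2 rfl
  have hmat : ∀ S ∈ splitSet D W s v 1 p (-1), D.incidenceMatrix κ S (absorb hl v 1 p A S) *
      D.incidenceMatrix κ S (absorb hl v 1 p A S) = 1 := fun S hS => by
    rw [incidenceMatrix_of_incident κ (hinc S hS), coe_mul_self]
  refine h.isExtension_pos_acyclic.exactAt_of_matching
    ((h.isExtension_pos hl).squareZero_sub (squareZero_cube hev hl hκ s))
    (splitOff hl v 1 A (-1)) (absorb hl v 1 p A) ?_ ?_ ?_ ?_ hmat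
  · intro T hT
    rw [mem_cube_erase h.mem] at hT
    exact ⟨h.splitOff_mem_splitSet hev hl _ hT.1 hT.2, absorb_splitOff h hev hl _ hT.1 hT.2⟩
  · rintro S ⟨h1, h2, h3⟩
    rw [mem_cube_erase h.mem]
    exact ⟨⟨absorb_mem h hl h1, Function.update_self ..⟩, splitOff_absorb h hev hl _ h1 h2 h3⟩
  · intro S hS hP
    exact (incidenceMatrix_mem_iff (κ := κ) (left_ne_zero_of_mul (ne_of_eq_of_ne (hmat S hS)
      one_ne_zero)) i j).2 hP
  · intro S hS T hT hne
    rw [mem_cube_erase h.mem] at hT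
    obtain ⟨w, hw⟩ := exists_incident_of_ne_zero hne
    obtain rfl := eq_of_incident hw hS.2.1 hT.2
    exact (h.incident_iff_eq_absorb_pos hev hl hS hw.2.2.1 hT.2).1 hw

theorem acyclic_neg (h : D.IsKink W s v (-1) p A) (hev : D.IsSourceSink ev) (hl : D.loops = 0)
    (hκ : Anticommutes W κ) : ExactAt (D.incidenceMatrix κ)
      (splitSet D W s v (-1) p 1 ∪ D.cube (W.erase v) (Function.update s v 1))
      (D.bidegree (i + 2) j) (D.bidegree i j) := by
  have hback : ∀ S ∈ D.cube (W.erase v) (Function.update s v 1),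
      S ∈ D.cube W s ∧ S.1 v = - -1 := by
    intro S hS
    rwa [mem_cube_erase h.mem, ← neg_neg (1 : ℤˣ)] at hS
  have hinc : ∀ S ∈ D.cube (W.erase v) (Function.update s v 1),
      S.Incident (splitOff hl v (-1) A 1 S) v := by
    intro S hS
    obtain ⟨h1, h2⟩ := hback S hS
    rw [h.incident_iff_eq_absorb_neg hev hl (h.splitOff_mem_splitSet hev hl _ h1 h2)
      (fun w hw => (Function.update_of_ne hw ..).symm) (by rw [h2, neg_neg])]
    exact (absorb_splitOff h hev hl _ h1 h2).symm
  have hmat : ∀ S ∈ D.cube (W.erase v) (Function.update s v 1),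
      D.incidenceMatrix κ S (splitOff hl v (-1) A 1 S) *
        D.incidenceMatrix κ S (splitOff hl v (-1) A 1 S) = 1 := fun S hS => by
    rw [incidenceMatrix_of_incident κ (hinc S hS), coe_mul_self]
  refine h.isExtension_neg_acyclic.exactAt_of_matching
    ((h.isExtension_neg hl).squareZero_quotient (squareZero_cube hev hl hκ s))
    (absorb hl v (-1) p A) (splitOff hl v (-1) A 1) ?_ ?_ ?_ ?_ hmat
  · rintro S ⟨h1, h2, h3⟩
    rw [mem_cube_erase h.mem]
    exact ⟨⟨absorb_mem h hl h1, (Function.update_self ..).trans (neg_neg _)⟩,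
      splitOff_absorb h hev hl _ h1 h2 h3⟩
  · intro S hS
    obtain ⟨h1, h2⟩ := hback S hS
    exact ⟨h.splitOff_mem_splitSet hev hl _ h1 h2, absorb_splitOff h hev hl _ h1 h2⟩
  · intro S hS hP
    exact (incidenceMatrix_mem_iff (κ := κ) (left_ne_zero_of_mul (ne_of_eq_of_ne (hmat S hS)
      one_ne_zero)) i j).2 hP
  · intro S hS T hT hne
    obtain ⟨h1, h2⟩ := hback S hS
    obtain ⟨w, hw⟩ := exists_incident_of_ne_zero hne
    obtain rfl := eq_of_incident hw (h2.trans (neg_neg _)) hT.2.1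
    rw [(h.incident_iff_eq_absorb_neg hev hl hT hw.2.2.1 (h2.trans (neg_neg _))).1 hw,
      splitOff_absorb h hev hl _ hT.1 hT.2.1 hT.2.2]

end

/-- A kink can be removed without changing the homology. -/
theorem exactAt (h : D.IsKink W s v m p A) (hev : D.IsSourceSink ev) (hl : D.loops = 0)
    {κ : (V → ℤˣ) → V → ℤˣ} (hκ : Anticommutes W κ) (i j : ℤ)
    (hq : ExactAt (D.incidenceMatrix fun t => κ (Function.update t v m))
      (D.cube (W.erase v) (Function.update s v (-m))) (D.bidegree (i + 2 - 2 * m) (j - 4 * m))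
      (D.bidegree (i - 2 * m) (j - 4 * m))) :
    ExactAt (D.incidenceMatrix κ) (D.cube W s) (D.bidegree (i + 2) j) (D.bidegree i j) := by
  have hsplit := h.exactAt_splitSet hev hl κ i j hq
  have hsq := squareZero_cube hev hl hκ s
  have hdeg := incidenceMatrix_mapsDegree (D := D) κ i j
  rcases Int.units_eq_one_or m with rfl | rfl
  · exact (h.isExtension_pos hl).exactAt hsq hdeg (h.acyclic_pos i j hev hl hκ) hsplit
  · exact (h.isExtension_neg hl).exactAt hsq hdeg hsplit (h.acyclic_neg i j hev hl hκ)

theorem torsionFreeAt (h : D.IsKink W s v m p A) (hev : D.IsSourceSink ev) (hl : D.loops = 0)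
    {κ : (V → ℤˣ) → V → ℤˣ} (hκ : Anticommutes W κ) (i j : ℤ)
    (hq : TorsionFreeAt (D.incidenceMatrix fun t => κ (Function.update t v m))
      (D.cube (W.erase v) (Function.update s v (-m))) (D.bidegree (i + 2 - 2 * m) (j - 4 * m))
      (D.bidegree (i - 2 * m) (j - 4 * m))) :
    TorsionFreeAt (D.incidenceMatrix κ) (D.cube W s) (D.bidegree (i + 2) j) (D.bidegree i j) := by
  have hsplit := h.torsionFreeAt_splitSet hev hl κ i j hq
  have hsq := squareZero_cube hev hl hκ s
  have hdeg := incidenceMatrix_mapsDegree (D := D) κ i j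
  rcases Int.units_eq_one_or m with rfl | rfl
  · exact (h.isExtension_pos hl).torsionFreeAt_of_exactAt_sub hsq hdeg
      (h.acyclic_pos i j hev hl hκ) hsplit
  -- With an acyclic quotient, its exactness is needed in the two consecutive degrees `i` and `i +
  -- 2`.
  · have hE := h.isExtension_neg (κ := κ) hl
    exact hE.torsionFreeAt hsq hdeg (incidenceMatrix_mapsDegree κ (i + 2) j) hsplit
      ((h.acyclic_neg i j hev hl hκ).torsionFreeAt (hE.squareZero_quotient hsq))
      (h.acyclic_neg (i + 2) j hev hl hκ)

end IsKink

end LinkDiagram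

/-! ### Connectivity of partial smoothings and the existence of kinks -/

namespace LinkDiagram

variable {V : Type*} [Fintype V] {D : LinkDiagram V}

/-- The connected components (without the crossingless ones) of the diagram in which the crossings
outside of `W` are smoothed according to `s`. -/
def Region (D : LinkDiagram V) (W : Finset V) (s : V → ℤˣ) : Type _ :=
  Quot fun x y : V × Fin 4 => y = D.edge x ∨ y = smoothing (s x.1) x ∨ (x.1 ∈ W ∧ y.1 = x.1)

/-- The connected component of the half-edge `x` after smoothing the crossings outside of `W`. -/
def region (D : LinkDiagram V) (W : Finset V) (s : V → ℤˣ) (x : V × Fin 4) : D.Region W s :=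
  Quot.mk _ x

/-- The diagram in which the crossings outside of `W` are smoothed according to `s` is connected. -/
def IsConnected (D : LinkDiagram V) (W : Finset V) (s : V → ℤˣ) : Prop :=
  ∀ x y, D.region W s x = D.region W s y

section

variable {W : Finset V} {s : V → ℤˣ}

theorem region_edge (x : V × Fin 4) : D.region W s (D.edge x) = D.region W s x :=
  (Quot.sound (r := fun x y => y = D.edge x ∨ y = smoothing (s x.1) x ∨ (x.1 ∈ W ∧ y.1 = x.1))
    (Or.inl rfl)).symm

theorem region_smoothing (x : V × Fin 4) :
    D.region W s (smoothing (s x.1) x) = D.region W s x :=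
  (Quot.sound (r := fun x y => y = D.edge x ∨ y = smoothing (s x.1) x ∨ (x.1 ∈ W ∧ y.1 = x.1))
    (Or.inr (Or.inl rfl))).symm

theorem region_eq_of_mem {x y : V × Fin 4} (hx : x.1 ∈ W) (h : y.1 = x.1) :
    D.region W s y = D.region W s x :=
  (Quot.sound (r := fun x y => y = D.edge x ∨ y = smoothing (s x.1) x ∨ (x.1 ∈ W ∧ y.1 = x.1))
    (Or.inr (Or.inr ⟨hx, h⟩))).symm

theorem region_factor {α : Type*} (g : V × Fin 4 → α)
    (he : ∀ x, g (D.edge x) = g x) (hs : ∀ x, g (smoothing (s x.1) x) = g x)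
    (hW : ∀ x y : V × Fin 4, x.1 ∈ W → y.1 = x.1 → g y = g x)
    {x y : V × Fin 4} (h : D.region W s x = D.region W s y) : g x = g y := by
  refine congrArg (Quot.lift g ?_) h
  rintro a b (rfl | rfl | ⟨h1, h2⟩)
  · exact (he a).symm
  · exact (hs a).symm
  · exact (hW a b h1 h2).symm

theorem region_eq_of_circle_eq {t : V → ℤˣ} (ht : ∀ w, w ∉ W → t w = s w) {x y : V × Fin 4}
    (h : D.circle t x = D.circle t y) : D.region W s x = D.region W s y := by
  refine circle_factor (D.region W s) region_edge (fun x => ?_) h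
  by_cases hx : x.1 ∈ W
  · exact region_eq_of_mem hx rfl
  · rw [ht _ hx, region_smoothing]

theorem region_eq_or_opposite (v : V) (p q : Fin 4) :
    D.region W s (v, q) = D.region W s (v, p) ∨
      D.region W s (v, q) = D.region W s (v, p + 2) :=
  (circle_eq_or_opposite s v p q).imp (region_eq_of_circle_eq fun _ _ => rfl)
    (region_eq_of_circle_eq fun _ _ => rfl)

theorem region_eq_of_joined {v : V} (h : D.region W s (v, 0) = D.region W s (v, 2))
    (p q : Fin 4) : D.region W s (v, p) = D.region W s (v, q) := by
  have key : ∀ p, D.region W s (v, p) = D.region W s (v, 0) := fun p => by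
    rcases region_eq_or_opposite (D := D) (W := W) (s := s) v 0 p with h' | h'
    · exact h'
    · exact h'.trans h.symm
  rw [key p, key q]

variable [DecidableEq V]

/-- Smoothing `v` only gives up the identification of its half-edges with each other, so
connectedness can be lost only there. -/
theorem IsConnected.erase (h : D.IsConnected W s) {v : V} {m : ℤˣ}
    (hv : D.region (W.erase v) (Function.update s v m) (v, 0) =
      D.region (W.erase v) (Function.update s v m) (v, 2)) :
    D.IsConnected (W.erase v) (Function.update s v m) := by
  have hall := region_eq_of_joined hv
  intro x y
  refine region_factor (D.region (W.erase v) (Function.update s v m)) region_edge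
    (fun x => ?_) (fun x y hx hxy => ?_) (h x y)
  · obtain ⟨w, p⟩ := x
    by_cases hw : w = v
    · subst hw; exact hall _ _
    · have := region_smoothing (D := D) (W := W.erase v) (s := Function.update s v m) (w, p)
      rwa [Function.update_of_ne hw] at this
  · obtain ⟨w, p⟩ := x
    obtain ⟨w', q⟩ := y
    obtain rfl : w' = w := hxy
    by_cases hw : w' = v
    · subst hw; exact hall _ _
    · exact region_eq_of_mem (by simpa [hw] using hx) rfl

/-- If every crossing of a connected diagram is disconnected by one of its smoothings, then there
is a kink. -/
theorem exists_isKink (hW : W.Nonempty)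
    (h : ∀ v ∈ W, ∃ m, D.region (W.erase v) (Function.update s v m) (v, 0) ≠
      D.region (W.erase v) (Function.update s v m) (v, 2)) :
    ∃ v m p A, D.IsKink W s v m p A := by
  classical
  choose! m hm using h
  set R := fun v => D.region (W.erase v) (Function.update s v (m v)) with hR
  -- An innermost choice: among all pieces cut off by a disconnecting smoothing, one with the fewest
  -- half-edges.
  obtain ⟨⟨v, p⟩, hvp, hmin⟩ := Finset.exists_min_image (W ×ˢ (Finset.univ : Finset (Fin 4)))
    (fun x => (Finset.univ.filter fun y => R x.1 y = R x.1 x).card)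
    (hW.product Finset.univ_nonempty)
  have hv : v ∈ W := (Finset.mem_product.1 hvp).1
  have hempty : ∀ w ∈ W, w ≠ v → ∀ q, R v (w, q) ≠ R v (v, p) := by
    intro w hw hwv q hq
    have hvw : ∀ q, R w (v, q) = R w (v, p) := fun q =>
      region_eq_of_mem (Finset.mem_erase.2 ⟨hwv.symm, hv⟩) rfl
    have hwq : ∀ q q', R v (w, q) = R v (w, q') := fun q q' =>
      region_eq_of_mem (Finset.mem_erase.2 ⟨hwv, hw⟩) rfl
    -- The disconnecting smoothing of `w` has a side away from `v`. That side is untouched by the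
    -- smoothing of `v`, so it lies inside the piece at `v`, and it misses `(v, p)`; this
    -- contradicts minimality.
    obtain ⟨p', hp'⟩ : ∃ p', R w (w, p') ≠ R w (v, p) := by
      by_contra! hc
      exact hm w hw ((hc 0).trans (hc 2).symm)
    refine absurd (hmin (w, p') (Finset.mem_product.2 ⟨hw, Finset.mem_univ _⟩)) (not_le.2 ?_)
    refine Finset.card_lt_card (Finset.ssubset_iff_of_subset ?_ |>.2 ⟨(v, p), ?_, ?_⟩)
    · intro y hy
      simp only [Finset.mem_filter, Finset.mem_univ, true_and] at hy ⊢
      have hgen : ∀ x y : V × Fin 4, R w x = R w y → (R w y = R w (w, p') → R v x = R v y) →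
          (R w x = R w (w, p') ∧ R v x = R v (v, p)) =
            (R w y = R w (w, p') ∧ R v y = R v (v, p)) := by
        intro x y h1 h2
        rw [h1]
        exact propext (and_congr_right fun h3 => by rw [h2 h3])
      have := region_factor (D := D) (W := W.erase w) (s := Function.update s w (m w))
        (fun x => R w x = R w (w, p') ∧ R v x = R v (v, p))
        (fun x => hgen _ _ (region_edge x) fun _ => region_edge x)
        (fun x => hgen _ _ (region_smoothing x) fun hx => ?_)
        (fun x y hx hxy => hgen _ _ (region_eq_of_mem hx hxy) fun h => ?_) hy
      · exact (this.symm ▸ ⟨rfl, (hwq _ _).trans hq⟩ :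
          R w y = R w (w, p') ∧ R v y = R v (v, p)).2
      · obtain ⟨u, r⟩ := x
        by_cases huw : u = w
        · subst huw; exact hwq _ _
        · have huv : u ≠ v := by
            rintro rfl
            exact hp' (hx.symm.trans (hvw r))
          have := region_smoothing (D := D) (W := W.erase v) (s := Function.update s v (m v)) (u, r)
          rw [Function.update_of_ne huv] at this
          simp only [Function.update_of_ne huw]
          exact this
      · obtain ⟨u, r⟩ := x
        have huv : u ≠ v := by
          rintro rfl
          exact hp' (h.symm.trans (hvw r))
        exact region_eq_of_mem (Finset.mem_erase.2 ⟨huv, Finset.mem_of_mem_erase hx⟩) hxy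
    · simp
    · simpa using hp'.symm
  -- The minimal piece contains no other crossing of `W`, so it is a single circle, whatever the
  -- markers at the other crossings of `W` are.
  refine ⟨v, m v, p, {x | R v x = R v (v, p)}, hv, ?_, ?_, hempty⟩
  · intro t ht htv x
    constructor
    · intro hx
      have hgen : ∀ x y : V × Fin 4, R v x = R v y →
          (R v y = R v (v, p) → D.circle t x = D.circle t y) →
          (R v x = R v (v, p) ∧ D.circle t x = D.circle t (v, p)) =
            (R v y = R v (v, p) ∧ D.circle t y = D.circle t (v, p)) := by
        intro x y h1 h2
        rw [h1]
        exact propext (and_congr_right fun h3 => by rw [h2 h3])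
      have := region_factor (D := D) (W := W.erase v) (s := Function.update s v (m v))
        (fun x => R v x = R v (v, p) ∧ D.circle t x = D.circle t (v, p))
        (fun x => hgen _ _ (region_edge x) fun _ => D.circle_edge t x)
        (fun x => hgen _ _ (region_smoothing x) fun hx => ?_)
        (fun x y hx hxy => hgen _ _ (region_eq_of_mem hx hxy) fun h => ?_) hx
      · exact (this.symm ▸ ⟨rfl, rfl⟩ :
          R v x = R v (v, p) ∧ D.circle t x = D.circle t (v, p)).2
      · obtain ⟨u, r⟩ := x
        have htu : t u = Function.update s v (m v) u := by
          by_cases huv : u = v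
          · rw [huv, htv, Function.update_self]
          · rw [Function.update_of_ne huv]
            exact ht u fun hu => hempty u hu huv r hx
        have := D.circle_smoothing t (u, r)
        simp only [htu] at this
        exact this
      · obtain ⟨u, r⟩ := x
        rw [Finset.mem_erase] at hx
        exact absurd h (hempty u hx.2 hx.1 r)
    · refine region_eq_of_circle_eq fun w hw => ?_
      by_cases hwv : w = v
      · rw [hwv, htv, Function.update_self]
      · rw [Function.update_of_ne hwv]
        exact ht w fun h => hw (Finset.mem_erase.2 ⟨hwv, h⟩)
  · intro hc
    have hc' : R v (v, p + 2) = R v (v, p) := hc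
    apply hm v hv
    have key : ∀ q, R v (v, q) = R v (v, p) := fun q => by
      rcases region_eq_or_opposite (D := D) (W := W.erase v) (s := Function.update s v (m v)) v p q
        with h | h
      · exact h
      · exact h.trans hc'
    exact (key 0).trans (key 2).symm

end

/-! ### Bounds for the homology of partially smoothed diagrams -/

variable [DecidableEq V]

/-- The state with marker `m` at the crossings of `W` and those of `s` elsewhere. -/
def constOn (W : Finset V) (s : V → ℤˣ) (m : ℤˣ) (w : V) : ℤˣ := if w ∈ W then m else s w

omit [Fintype V] in
theorem constOn_of_notMem {W : Finset V} {s : V → ℤˣ} {m : ℤˣ} (w : V) (hw : w ∉ W) :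
    constOn W s m w = s w := if_neg hw

omit [Fintype V] in
theorem constOn_erase {W : Finset V} (s : V → ℤˣ) {v : V} (hv : v ∈ W) (m m' : ℤˣ) :
    constOn (W.erase v) (Function.update s v m') m = Function.update (constOn W s m) v m' := by
  funext w
  by_cases hw : w = v
  · subst hw
    simp [constOn]
  · simp [constOn, hw]

omit [Fintype V] in
theorem constOn_erase_self {W : Finset V} (s : V → ℤˣ) {v : V} (hv : v ∈ W) (m : ℤˣ) :
    constOn (W.erase v) (Function.update s v m) m = constOn W s m := by
  rw [constOn_erase s hv]
  exact Function.update_eq_self_iff.2 (if_pos hv).symm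

/-- The difference of the numbers of positive and of negative markers. -/
def markerSum (t : V → ℤˣ) : ℤ := ∑ w, (t w : ℤ)

theorem markerSum_update (t : V → ℤˣ) (v : V) (m : ℤˣ) :
    markerSum (Function.update t v m) = markerSum t - t v + m := by
  unfold markerSum
  rw [← Finset.add_sum_erase _ _ (Finset.mem_univ v),
    ← Finset.add_sum_erase _ (fun w => (t w : ℤ)) (Finset.mem_univ v), Function.update_self,
    Finset.sum_congr rfl fun w hw => by rw [Function.update_of_ne (Finset.ne_of_mem_erase hw)]]
  ring

/-- The maximal value of `2τ - σ` on the state with positive markers on `W`. -/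
def maxDiagonal (D : LinkDiagram V) (W : Finset V) (s : V → ℤˣ) : ℤ :=
  2 * D.numCircles (constOn W s 1) - markerSum (constOn W s 1)

/-- The minimal value of `2τ - σ` on the state with negative markers on `W`. -/
def minDiagonal (D : LinkDiagram V) (W : Finset V) (s : V → ℤˣ) : ℤ :=
  -2 * D.numCircles (constOn W s (-1)) - markerSum (constOn W s (-1))

section

variable {W : Finset V} (s : V → ℤˣ) {v : V} (hv : v ∈ W)
include hv

theorem maxDiagonal_erase_pos :
    D.maxDiagonal (W.erase v) (Function.update s v 1) = D.maxDiagonal W s := by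
  unfold maxDiagonal
  rw [constOn_erase_self s hv]

theorem minDiagonal_erase_neg :
    D.minDiagonal (W.erase v) (Function.update s v (-1)) = D.minDiagonal W s := by
  unfold minDiagonal
  rw [constOn_erase_self s hv]

theorem maxDiagonal_erase_neg : D.maxDiagonal (W.erase v) (Function.update s v (-1)) =
    2 * D.numCircles (Function.update (constOn W s 1) v (-1)) - markerSum (constOn W s 1) + 2 := by
  unfold maxDiagonal
  rw [constOn_erase s hv, markerSum_update, show constOn W s 1 v = 1 from if_pos hv]
  push_cast
  ring

theorem minDiagonal_erase_pos : D.minDiagonal (W.erase v) (Function.update s v 1) =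
    -2 * D.numCircles (Function.update (constOn W s (-1)) v 1)
      - markerSum (constOn W s (-1)) - 2 := by
  unfold minDiagonal
  rw [constOn_erase s hv, markerSum_update, show constOn W s (-1) v = -1 from if_pos hv]
  push_cast
  ring

/-- Lowering one marker raises `-σ` by 2, while losing a circle costs at most 2. -/
theorem maxDiagonal_le {ev : V × Fin 4 → Bool} (hev : D.IsSourceSink ev) (hl : D.loops = 0) :
    D.maxDiagonal W s ≤ D.maxDiagonal (W.erase v) (Function.update s v (-1)) := by
  rw [maxDiagonal_erase_neg s hv]
  have := numCircles_le_succ hev hl (t := constOn W s 1)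
    (t' := Function.update (constOn W s 1) v (-1)) (v := v)
    fun w hw => (Function.update_of_ne hw ..).symm
  unfold maxDiagonal
  lia

theorem minDiagonal_le {ev : V × Fin 4 → Bool} (hev : D.IsSourceSink ev) (hl : D.loops = 0) :
    D.minDiagonal (W.erase v) (Function.update s v 1) ≤ D.minDiagonal W s := by
  rw [minDiagonal_erase_pos s hv]
  have := numCircles_le_succ hev hl (t := constOn W s (-1))
    (t' := Function.update (constOn W s (-1)) v 1) (v := v)
    fun w hw => (Function.update_of_ne hw ..).symm
  unfold minDiagonal
  lia

end

/-- Removing the kink loses exactly one circle in the extreme state with marker `m`, which balances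
the change of `σ`. The other extreme state already has marker `-m` at `v`. -/
theorem IsKink.diagonal_eq {W : Finset V} {s : V → ℤˣ} {v : V} {m : ℤˣ} {p : Fin 4}
    {A : Set (V × Fin 4)} {ev : V × Fin 4 → Bool} (h : D.IsKink W s v m p A)
    (hev : D.IsSourceSink ev) (hl : D.loops = 0) :
    D.maxDiagonal (W.erase v) (Function.update s v (-m)) = D.maxDiagonal W s ∧
      D.minDiagonal (W.erase v) (Function.update s v (-m)) = D.minDiagonal W s := by
  have key : ∀ t : V → ℤˣ, (∀ w, w ∉ W → t w = s w) → t v = m →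
      D.numCircles t = D.numCircles (Function.update t v (-m)) + 1 := by
    intro t ht htv
    have hne : ∀ w, w ≠ v → t w = Function.update t v (-m) w := fun w hw =>
      (Function.update_of_ne hw ..).symm
    exact numCircles_of_joined hl hne (h.not_joined ht htv)
      (h.joined hev ht htv hne (Function.update_self ..))
  have hk := key (constOn W s m) constOn_of_notMem (if_pos h.mem)
  rcases Int.units_eq_one_or m with rfl | rfl
  · refine ⟨?_, minDiagonal_erase_neg s h.mem⟩
    rw [maxDiagonal_erase_neg s h.mem]
    unfold maxDiagonal
    lia
  · rw [neg_neg] at hk ⊢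
    refine ⟨maxDiagonal_erase_pos s h.mem, ?_⟩
    rw [minDiagonal_erase_pos s h.mem]
    unfold minDiagonal
    lia

/-- The homology of a connected, partially smoothed diagram is concentrated on the diagonals
between `maxDiagonal - 4` and `minDiagonal + 4`, and there is no torsion below `maxDiagonal`. -/
theorem exactAt_and_torsionFreeAt {ev : V × Fin 4 → Bool} (hev : D.IsSourceSink ev)
    (hl : D.loops = 0) (n : ℕ) : ∀ (W : Finset V) (s : V → ℤˣ) (κ : (V → ℤˣ) → V → ℤˣ),
    W.card = n → Anticommutes W κ → D.IsConnected W s → ∀ i j : ℤ,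
    ((j - 2 * i < D.maxDiagonal W s - 4 ∨ D.minDiagonal W s + 4 < j - 2 * i) →
      ExactAt (D.incidenceMatrix κ) (D.cube W s) (D.bidegree (i + 2) j) (D.bidegree i j)) ∧
    (j - 2 * i < D.maxDiagonal W s →
      TorsionFreeAt (D.incidenceMatrix κ) (D.cube W s) (D.bidegree (i + 2) j)
        (D.bidegree i j)) := by
  induction n with
  | zero =>
    intro W s κ hW hκ hconn i j
    obtain rfl := Finset.card_eq_zero.1 hW
    have hcube : ∀ S ∈ D.cube ∅ s, S.1 = s := fun S hS => funext fun w => hS w (by simp)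
    have hconst : ∀ m, constOn ∅ s m = s := fun m => funext fun w => constOn_of_notMem w (by simp)
    -- Connectedness enters here: with at most one circle, the diagonals `2τ - σ` fill no more than
    -- the allowed window.
    have hcard : D.numCircles s ≤ 1 := by
      refine Fintype.card_le_one_iff.2 fun c c' => ?_
      obtain ⟨x, rfl⟩ := exists_circle_eq hl c
      obtain ⟨y, rfl⟩ := exists_circle_eq hl c'
      exact region_factor (D.circle s) (D.circle_edge s) (D.circle_smoothing s)
        (fun x y hx => absurd hx (by simp)) (hconn x y)
    constructor
    · intro hij a ha _
      refine ⟨0, by simp, ?_⟩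
      rw [map_zero]
      symm
      rw [← Function.support_eq_empty_iff, Set.eq_empty_iff_forall_notMem]
      intro S hS
      obtain ⟨h1, h2, h3⟩ := ha hS
      have h4 := S.abs_tau_le
      rw [hcube S h1, abs_le] at h4
      have h5 : S.sigma = markerSum s := by
        unfold EnhancedState.sigma markerSum
        rw [hcube S h1]
      unfold maxDiagonal minDiagonal at hij
      rw [hconst, hconst] at hij
      lia
    · rintro - a k hk ha ⟨b, hb, hdb⟩
      have hzero : boundary (D.incidenceMatrix κ) (D.cube ∅ s) b = 0 := by
        ext T
        by_cases hT : T ∈ D.cube ∅ s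
        · rw [boundary_apply_of_support b hT fun S hS => (hb hS).1]
          refine Finset.sum_eq_zero fun S _ => ?_
          by_contra hne
          obtain ⟨w, hw⟩ := exists_incident_of_ne_zero (right_ne_zero_of_mul hne)
          exact absurd (hw.mem (hb (left_ne_zero_of_mul hne)).1 hT) (by simp)
        · exact boundary_apply_of_notMem b hT
      rw [hzero] at hdb
      refine ⟨0, by simp, ?_⟩
      rw [map_zero]
      exact ((smul_eq_zero.1 hdb.symm).resolve_left hk).symm
  | succ n ih =>
    intro W s κ hW hκ hconn i j
    have hne : W.Nonempty := Finset.card_pos.1 (by lia)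
    have hcard : ∀ v ∈ W, (W.erase v).card = n := fun v hv => by
      rw [Finset.card_erase_of_mem hv, hW]; rfl
    by_cases hex : ∃ v ∈ W, ∀ m, D.region (W.erase v) (Function.update s v m) (v, 0) =
        D.region (W.erase v) (Function.update s v m) (v, 2)
    · obtain ⟨v, hv, hm⟩ := hex
      have hneg := ih _ (Function.update s v (-1)) κ (hcard v hv)
        (hκ.mono (Finset.erase_subset _ _)) (hconn.erase (hm _))
      have hpos := ih _ (Function.update s v 1) κ (hcard v hv)
        (hκ.mono (Finset.erase_subset _ _)) (hconn.erase (hm _))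
      have h1 := D.maxDiagonal_erase_pos s hv
      have h2 := D.minDiagonal_erase_neg s hv
      have h3 := maxDiagonal_le s hv hev hl
      have h4 := minDiagonal_le s hv hev hl
      have hE := isExtension_cube (D := D) κ s hv
      have hsq := squareZero_cube hev hl hκ s
      constructor
      · intro hij
        refine hE.exactAt hsq (incidenceMatrix_mapsDegree κ i j) ((hneg i j).1 ?_)
          ((hpos i j).1 ?_)
        · lia
        · lia
      -- Raising `i` by 2 lowers the diagonal by 4. So "below `maxDiagonal`" in degree `i` is
      -- exactly "below `maxDiagonal - 4`" in degree `i + 2`, where the quotient is exact.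
      · intro hij
        refine hE.torsionFreeAt hsq (incidenceMatrix_mapsDegree κ i j)
          (incidenceMatrix_mapsDegree κ (i + 2) j) ((hneg i j).2 (by lia)) ((hpos i j).2 (by lia))
          ((hpos (i + 2) j).1 (by lia))
    · push Not at hex
      obtain ⟨v, m, p, A, hk⟩ := exists_isKink hne hex
      -- The other smoothing of the kink joins both sides, so the diagram stays connected and the
      -- induction hypothesis applies.
      have hjoin : D.Joined (Function.update s v (-m)) v :=
        hk.joined hev (t := Function.update s v m)
          (fun w hw => Function.update_of_ne (fun e => hw (by rw [e]; exact hk.mem)) ..)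
          (Function.update_self ..)
          (fun w hw => by rw [Function.update_of_ne hw, Function.update_of_ne hw])
          (Function.update_self ..)
      have hq := ih _ (Function.update s v (-m)) _ (hcard v hk.mem) (hκ.update v m)
        (hconn.erase (region_eq_of_circle_eq (fun _ _ => rfl) hjoin))
        (i - 2 * m) (j - 4 * m)
      rw [(hk.diagonal_eq hev hl).1, (hk.diagonal_eq hev hl).2,
        show i - 2 * m + 2 = i + 2 - 2 * (m : ℤ) by ring] at hq
      exact ⟨fun hij => hk.exactAt hev hl hκ i j (hq.1 (by lia)),
        fun hij => hk.torsionFreeAt hev hl hκ i j (hq.2 (by lia))⟩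

end LinkDiagram

namespace LinkDiagram

variable {V : Type*} [Fintype V] {D : LinkDiagram V}

/-! ### Almost alternating diagrams -/

theorem isOver_add_one {V : Type*} (v : V) (p : Fin 4) : IsOver (v, p + 1) ↔ ¬ IsOver (v, p) := by
  unfold IsOver
  fin_cases p <;> simp

open Classical in
/-- The half-edges that belong to the upper strands after the crossings in `F` are changed. -/
def overColouring {V : Type*} (F : Finset V) (x : V × Fin 4) : Bool :=
  decide (IsOver ((relabel F).symm x))

theorem overColouring_iff {V : Type*} {F : Finset V} (x : V × Fin 4) :
    overColouring F x = true ↔ IsOver ((relabel F).symm x) := by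
  classical
  exact decide_eq_true_iff

theorem overColouring_of_mem {V : Type*} {F : Finset V} {v : V} (hv : v ∈ F) (p : Fin 4) :
    overColouring F (v, p) = true ↔ IsOver (v, p - 1) := by
  rw [overColouring_iff]
  simp only [relabel, Equiv.coe_fn_symm_mk, hv, if_true]

theorem overColouring_of_notMem {V : Type*} {F : Finset V} {v : V} (hv : v ∉ F) (p : Fin 4) :
    overColouring F (v, p) = true ↔ IsOver (v, p) := by
  rw [overColouring_iff]
  simp only [relabel, Equiv.coe_fn_symm_mk, hv, if_false]

/-- Upper and lower half-edges alternate around every crossing, and along the edges by the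
alternation of the changed diagram. -/
theorem isSourceSink_overColouring {F : Finset V} (h : (D.changeCrossings F).IsAlternating) :
    D.IsSourceSink (overColouring F) where
  edge x := by
    have h1 : IsOver ((relabel F).symm (D.edge (relabel F ((relabel F).symm x)))) ↔
      ¬ IsOver ((relabel F).symm x) := h ((relabel F).symm x)
    rw [Equiv.apply_symm_apply] at h1
    rw [Bool.eq_iff_iff, Bool.not_eq_true', ← Bool.not_eq_true, overColouring_iff,
      overColouring_iff, h1]
  rot v p := by
    rw [Bool.eq_iff_iff, Bool.not_eq_true', ← Bool.not_eq_true]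
    by_cases hv : v ∈ F
    · rw [overColouring_of_mem hv, overColouring_of_mem hv, ← isOver_add_one,
        add_sub_cancel_right, sub_add_cancel]
    · rw [overColouring_of_notMem hv, overColouring_of_notMem hv, isOver_add_one]

/-- If the circles of `D_t` run along the faces at the half-edges of colour `b`, then half-edges
of this colour on the same circle belong to the same face. -/
theorem face_eq_of_circle_eq {ev : V × Fin 4 → Bool} (hev : D.IsSourceSink ev) {t : V → ℤˣ}
    {b : Bool} (ht : ∀ v p, ev (v, p) = b → (smoothing (t v) (v, p)).2 + 1 = p)
    {x y : V × Fin 4} (hx : ev x = b) (hy : ev y = b) (h : D.circle t x = D.circle t y) :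
    D.face x.1 x.2 = D.face y.1 y.2 := by
  have hstep : ∀ x : V × Fin 4, D.face (D.edge x).1 (D.edge x).2 = D.face x.1 (x.2 + 1) := by
    intro x
    have := Quot.sound (r := fun x y : V × Fin 4 => y = ((D.edge x).1, (D.edge x).2 + 1))
      (a := D.edge x) rfl
    rw [D.edge_edge] at this
    exact this
  -- A half-edge of the other colour is assigned the face of the other end of its edge; this makes
  -- the assignment constant along edges and arcs.
  have key := circle_factor (D := D) (s := t)
    (fun x => if ev x = b then D.face x.1 x.2 else D.face (D.edge x).1 (D.edge x).2)
    (fun x => ?_) (fun x => ?_) h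
  · simpa only [hx, hy, if_true] using key
  · simp only [hev.edge, D.edge_edge]
    by_cases hx : ev x = b
    · rw [if_neg (by rw [hx]; simp), if_pos hx]
    · rw [if_pos (by rw [Bool.not_eq]; exact hx), if_neg hx]
  · simp only [hev.smoothing]
    by_cases hx : ev x = b
    · rw [if_neg (by rw [hx]; simp), if_pos hx, hstep, ht x.1 x.2 hx, smoothing_fst]
    · have hz : ev (smoothing (t x.1) x) = b := by
        rw [hev.smoothing, Bool.not_eq]; exact hx
      rw [if_pos (by rw [Bool.not_eq]; exact hx), if_neg hx, hstep]
      have : (smoothing (t x.1) (smoothing (t x.1) x)).2 + 1 = (smoothing (t x.1) x).2 :=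
        ht _ _ hz
      rw [smoothing_smoothing] at this
      rw [smoothing_fst, this]

theorem card_face_le {F : Finset V} (h : (D.changeCrossings F).IsAlternating) :
    ∃ t : V → ℤˣ, (∀ v, v ∉ F → t v = -1) ∧
      Nat.card D.Face ≤ D.numCircles t + D.numCircles (-t) := by
  classical
  have hev := isSourceSink_overColouring h
  -- A crossing change interchanges the two smoothings, so this is the all-negative state of the
  -- alternating diagram. Its circles follow the faces at one colour, those of `-t` the faces at the
  -- other.
  let t : V → ℤˣ := fun v => if v ∈ F then 1 else -1
  refine ⟨t, fun v hv => if_neg hv, ?_⟩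
  have ht : ∀ v p, overColouring F (v, p) = false → (smoothing (t v) (v, p)).2 + 1 = p := by
    intro v p hp
    rw [← Bool.not_eq_true] at hp
    by_cases hv : v ∈ F
    · rw [overColouring_of_mem hv] at hp
      simp only [t, hv, if_true, smoothing]
      fin_cases p <;> simp [IsOver] at hp ⊢
      exact absurd hp (by decide)
    · rw [overColouring_of_notMem hv] at hp
      simp only [t, hv, if_false, smoothing]
      fin_cases p <;> simp [IsOver] at hp ⊢
  have ht' : ∀ v p, overColouring F (v, p) = true → (smoothing ((-t) v) (v, p)).2 + 1 = p := by
    intro v p hp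
    by_cases hv : v ∈ F
    · rw [overColouring_of_mem hv] at hp
      simp only [Pi.neg_apply, t, hv, if_true, smoothing]
      fin_cases p <;> simp [IsOver] at hp ⊢
    · rw [overColouring_of_notMem hv] at hp
      simp only [Pi.neg_apply, t, hv, if_false, smoothing]
      fin_cases p <;> simp [IsOver] at hp ⊢
  choose r hr using fun f : D.Face => Quot.exists_rep f
  -- The colour of a representative decides which state's circle to take. Only injectivity matters,
  -- so the choice of the representative is harmless.
  let Φ : D.Face → D.Circle t ⊕ D.Circle (-t) := fun f =>
    if overColouring F (r f) = false then Sum.inl (D.circle t (r f))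
    else Sum.inr (D.circle (-t) (r f))
  have hΦ : Function.Injective Φ := by
    intro f f' hff'
    rw [← hr f, ← hr f']
    simp only [Φ] at hff'
    split_ifs at hff' with h1 h2 h2
    · exact face_eq_of_circle_eq hev ht h1 h2 (Sum.inl_injective hff')
    · exact face_eq_of_circle_eq hev ht' (by simpa using h1) (by simpa using h2)
        (Sum.inr_injective hff')
  have := Nat.card_le_card_of_injective Φ hΦ
  rwa [Nat.card_sum, Nat.card_eq_fintype_card (α := D.Circle t),
    Nat.card_eq_fintype_card (α := D.Circle (-t))] at this

theorem two_mul_card_le_card_edges :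
    2 * Fintype.card V ≤ Nat.card (Quot fun x y : V × Fin 4 => y = D.edge x) := by
  classical
  let Q := Quot fun x y : V × Fin 4 => y = D.edge x
  have : Fintype Q := Fintype.ofFinite _
  have hfib : ∀ x y : V × Fin 4, (Quot.mk _ y : Q) = Quot.mk _ x → y = x ∨ y = D.edge x := by
    intro x y hxy
    have h1 := congrArg (Quot.lift (fun x => ({x, D.edge x} : Finset (V × Fin 4))) (by
      rintro a _ rfl
      rw [D.edge_edge, Finset.pair_comm])) hxy
    have h2 : y ∈ ({x, D.edge x} : Finset (V × Fin 4)) := by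
      change ({y, D.edge y} : Finset (V × Fin 4)) = {x, D.edge x} at h1
      rw [← h1]; simp
    simpa using h2
  have hcard := Finset.card_le_mul_card_image (f := fun x => (Quot.mk _ x : Q))
    (Finset.univ : Finset (V × Fin 4)) 2 (by
      intro q hq
      obtain ⟨x, -, rfl⟩ := Finset.mem_image.1 hq
      refine (Finset.card_le_card (t := {x, D.edge x}) fun y hy => ?_).trans Finset.card_le_two
      simpa using hfib x y (Finset.mem_filter.1 hy).2)
  have h2 := Finset.card_le_univ (Finset.univ.image fun x => (Quot.mk _ x : Q))
  rw [Finset.card_univ, Fintype.card_prod, Fintype.card_fin] at hcard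
  rw [Nat.card_eq_fintype_card]
  change _ ≤ Fintype.card Q
  lia

theorem numCircles_le_add_card {ev : V × Fin 4 → Bool} (hev : D.IsSourceSink ev)
    (hl : D.loops = 0) (F : Finset V) (t t' : V → ℤˣ) (h : ∀ v, v ∉ F → t v = t' v) :
    D.numCircles t ≤ D.numCircles t' + F.card := by
  classical
  induction F using Finset.induction_on generalizing t with
  | empty => rw [show t = t' from funext fun v => h v (by simp)]; simp
  | insert v F hv ih =>
    have h1 := numCircles_le_succ hev hl (t := t) (t' := Function.update t v (t' v)) (v := v)
      fun w hw => (Function.update_of_ne hw ..).symm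
    have h2 := ih (Function.update t v (t' v)) fun w hw => by
      by_cases hwv : w = v
      · rw [hwv, Function.update_self]
      · rw [Function.update_of_ne hwv]
        exact h w (by simp [hwv, hw])
    rw [Finset.card_insert_of_notMem hv]
    lia

theorem card_component_and_loops [Nonempty V] (h : D.IsNonSplit) :
    Nat.card D.Component = 1 ∧ D.loops = 0 := by
  have : Finite D.Component := inferInstanceAs (Finite (Quot _))
  have : Nonempty D.Component := ⟨Quot.mk _ (Classical.arbitrary V, 0)⟩
  have h1 : 0 < Nat.card D.Component := Nat.card_pos
  unfold IsNonSplit at h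
  lia

/-- The genus of a `k`-almost alternating diagram is at most `k`. -/
theorem numCrossings_add_two_le [Nonempty V] {k : ℕ} (hsplit : D.IsNonSplit)
    (halt : D.IsAlmostAlternating k) : D.numCrossings + 2 ≤ D.numPos + D.numNeg + 2 * k := by
  obtain ⟨F, rfl, hF⟩ := halt
  obtain ⟨hcomp, hl⟩ := card_component_and_loops hsplit
  have hev := isSourceSink_overColouring hF
  obtain ⟨t, ht, hface⟩ := card_face_le hF
  have h1 := numCircles_le_add_card hev hl F t (fun _ => -1) ht
  have h2 := numCircles_le_add_card hev hl F (-t) (fun _ => 1) fun v hv => by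
    rw [Pi.neg_apply, ht v hv, neg_neg]
  -- With at least `2N` edges and one component, Euler's formula gives at least `N + 2` faces. The
  -- passage to the constant states costs at most one circle per changed crossing in each state,
  -- hence `2k`.
  have hedge := D.two_mul_card_le_card_edges
  have hplanar := D.planar
  change _ + Nat.card D.Face = _ + 2 * Nat.card D.Component at hplanar
  rw [hcomp] at hplanar
  unfold numPos numNeg numCrossings
  lia

theorem isConnected_univ [Nonempty V] (hsplit : D.IsNonSplit) (s : V → ℤˣ) :
    D.IsConnected Finset.univ s := by
  intro x y
  have : Finite D.Component := inferInstanceAs (Finite (Quot _))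
  have : Subsingleton D.Component :=
    (Nat.card_eq_one_iff_unique.1 (card_component_and_loops hsplit).1).1
  have hxy : (Quot.mk _ x : D.Component) = Quot.mk _ y := this.elim _ _
  have hstep : ∀ a b : V × Fin 4, (b = D.edge a ∨ a.1 = b.1) →
      D.region Finset.univ s a = D.region Finset.univ s b := ?_
  · exact congrArg (Quot.lift (D.region Finset.univ s) hstep) hxy
  rintro a b (rfl | hab)
  · exact (region_edge a).symm
  · exact (region_eq_of_mem (Finset.mem_univ _) hab.symm).symm

/-! ### The signs of the differential and the homology groups -/

section

variable [LinearOrder V]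

/-- The sign `(-1)^t`, where `t` is the number of negative markers at crossings bigger than `v`. -/
def khovanovSign (t : V → ℤˣ) (v : V) : ℤˣ :=
  (-1) ^ (Finset.univ.filter fun w => v < w ∧ t w = -1).card

theorem anticommutes_khovanovSign (W : Finset V) : Anticommutes W (khovanovSign (V := V)) := by
  have key : ∀ (t : V → ℤˣ) (v w : V), v < w → t w = 1 →
      khovanovSign t v * khovanovSign (Function.update t v (-1)) w =
        -(khovanovSign t w * khovanovSign (Function.update t w (-1)) v) := by
    intro t v w hvw hw
    have h1 : khovanovSign (Function.update t v (-1)) w = khovanovSign t w := by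
      unfold khovanovSign
      congr 2
      ext u
      simp only [Finset.mem_filter, Finset.mem_univ, true_and, and_congr_right_iff]
      intro hu
      rw [Function.update_of_ne (hvw.trans hu).ne']
    -- For `v < w`, lowering `w` adds one negative marker above `v`, while lowering `v` adds none
    -- above `w`. This single sign makes the square anticommute.
    have h2 : khovanovSign (Function.update t w (-1)) v = - khovanovSign t v := by
      have : (Finset.univ.filter fun u => v < u ∧ Function.update t w (-1) u = -1) =
          insert w (Finset.univ.filter fun u => v < u ∧ t u = -1) := by
        ext u
        simp only [Finset.mem_filter, Finset.mem_univ, true_and, Finset.mem_insert]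
        by_cases hu : u = w
        · subst hu; simp [hvw]
        · simp [hu]
      unfold khovanovSign
      rw [this, Finset.card_insert_of_notMem (by simp [hw]), pow_succ, mul_neg_one]
    rw [h1, h2, mul_neg, neg_neg, mul_comm]
  intro t v w _ _ hvw hv hw
  rcases lt_or_gt_of_ne hvw with h | h
  · exact key t v w h hw
  · rw [key t w v h hv, neg_neg]

theorem coeff_eq_incidenceMatrix (S T : D.EnhancedState) :
    S.coeff T = D.incidenceMatrix khovanovSign S T := by
  classical
  unfold EnhancedState.coeff incidenceMatrix
  refine Finset.sum_congr rfl fun v _ => if_congr Iff.rfl ?_ rfl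
  unfold khovanovSign EnhancedState.numNegAbove
  push_cast
  rfl

theorem coe_differential (x : D.Chain) :
    ⇑(D.differential x) = boundary (D.incidenceMatrix khovanovSign) Set.univ x := by
  ext T
  rw [boundary_apply_of_support _ (Set.mem_univ _) (Set.subset_univ _), differential,
    Finsupp.linearCombination_apply, Finsupp.sum_fintype _ _ (by simp), Finsupp.finsetSum_apply]
  refine Finset.sum_congr rfl fun S _ => ?_
  rw [Finsupp.smul_apply, Finsupp.finsetSum_apply, smul_eq_mul, Finset.sum_eq_single T]
  · rw [Finsupp.single_eq_same, coeff_eq_incidenceMatrix]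
  · intro T' _ hT'
    exact Finsupp.single_eq_of_ne hT'.symm
  · simp

omit [LinearOrder V] in
theorem mem_chainGrade_iff (x : D.Chain) (i j : ℤ) :
    x ∈ D.chainGrade i j ↔ Function.support x ⊆ Set.univ ∩ D.bidegree i j := by
  rw [Set.univ_inter, chainGrade, Finsupp.mem_supported, Finsupp.fun_support_eq]
  rfl

theorem exists_chain_of_boundary {i j : ℤ} {x : D.Chain}
    (h : ∃ b, Function.support b ⊆ Set.univ ∩ D.bidegree (i + 2) j ∧
      boundary (D.incidenceMatrix khovanovSign) Set.univ b = x) : x ∈ D.boundaries i j := by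
  obtain ⟨b, hb, hdb⟩ := h
  refine ⟨Finsupp.equivFunOnFinite.symm b, (mem_chainGrade_iff _ _ _).2 hb, ?_⟩
  exact DFunLike.coe_injective ((coe_differential _).trans hdb)

theorem subsingleton_homology {i j : ℤ}
    (h : ExactAt (D.incidenceMatrix khovanovSign) Set.univ (D.bidegree (i + 2) j)
      (D.bidegree i j)) : Subsingleton (D.Homology i j) := by
  rw [Submodule.Quotient.subsingleton_iff, Submodule.submoduleOf,
    Submodule.comap_subtype_eq_top]
  rintro x ⟨hx, hx'⟩
  refine exists_chain_of_boundary (h x ((mem_chainGrade_iff _ _ _).1 hx') ?_)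
  rw [← coe_differential, LinearMap.mem_ker.1 hx]
  rfl

theorem torsionPart_eq_bot {i j : ℤ}
    (h : TorsionFreeAt (D.incidenceMatrix khovanovSign) Set.univ (D.bidegree (i + 2) j)
      (D.bidegree i j)) : D.torsionPart i j = ⊥ := by
  rw [eq_bot_iff]
  intro x hx
  obtain ⟨⟨n, hn⟩, hnx⟩ := (Submodule.mem_torsion_iff x).1 hx
  obtain ⟨⟨z, hz⟩, rfl⟩ := Submodule.Quotient.mk_surjective _ x
  have hnz : n • z ∈ D.boundaries i j :=
    (Submodule.Quotient.mk_eq_zero (p := (D.boundaries i j).submoduleOf (D.cycles i j))).1 hnx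
  obtain ⟨y, hy, hyz⟩ := hnz
  rw [Submodule.mem_bot, Submodule.Quotient.mk_eq_zero]
  refine exists_chain_of_boundary (h z n (nonZeroDivisors.ne_zero hn)
    ((mem_chainGrade_iff _ _ _).1 hz.2) ⟨y, (mem_chainGrade_iff _ _ _).1 hy, ?_⟩)
  rw [← coe_differential, hyz]
  rfl

omit [LinearOrder V] in
theorem cube_univ (s : V → ℤˣ) : D.cube Finset.univ s = Set.univ :=
  Set.eq_univ_of_forall fun _ w hw => absurd (Finset.mem_univ w) hw

/-- Without crossings the differential is zero and the chains are free; the bound `|τ| ≤ |s|` alone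
places them in the strip. -/
theorem thick_of_isEmpty [IsEmpty V] (k : ℕ) (k₂ : ℤ) : D.IsHThick k k ∧ D.IsTHThick k k₂ := by
  constructor
  · intro i j hij
    refine subsingleton_homology fun a ha _ => ⟨0, by simp, ?_⟩
    rw [map_zero]
    symm
    rw [← Function.support_eq_empty_iff, Set.eq_empty_iff_forall_notMem]
    intro S hS
    obtain ⟨-, h1, h2⟩ := ha hS
    have h3 : S.sigma = 0 := by simp [EnhancedState.sigma]
    have h4 := S.abs_tau_le
    have h5 : D.numCircles S.1 = D.numPos := congrArg D.numCircles (Subsingleton.elim _ _)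
    have h6 : D.numCircles S.1 = D.numNeg := congrArg D.numCircles (Subsingleton.elim _ _)
    have h7 : D.numCrossings = 0 := Fintype.card_eq_zero
    rw [abs_le] at h4
    apply hij
    constructor <;> lia
  · intro i j _
    refine torsionPart_eq_bot ?_
    rintro a n hn - ⟨b, -, hb⟩
    have hzero : boundary (D.incidenceMatrix khovanovSign) Set.univ b = 0 := by
      ext T
      rw [boundary_apply_of_support _ (Set.mem_univ _) (Set.subset_univ _)]
      simp [incidenceMatrix]
    rw [hzero] at hb
    refine ⟨0, by simp, ?_⟩
    rw [map_zero]
    exact ((smul_eq_zero.1 hb.symm).resolve_left hn).symm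

theorem thick_of_isAlmostAlternating [Nonempty V] {k : ℕ} (hsplit : D.IsNonSplit)
    (halt : D.IsAlmostAlternating k) : D.IsHThick k k ∧ D.IsTHThick k ((k : ℤ) - 1) := by
  have hgenus := numCrossings_add_two_le hsplit halt
  obtain ⟨F, -, hF⟩ := halt
  have hev := isSourceSink_overColouring hF
  have hl := (card_component_and_loops hsplit).2
  have hanti := anticommutes_khovanovSign (V := V) Finset.univ
  have main := exactAt_and_torsionFreeAt hev hl _ Finset.univ (fun _ => 1) _ rfl
    hanti (isConnected_univ hsplit _)
  have hconst : ∀ m, constOn Finset.univ (fun _ : V => (1 : ℤˣ)) m = fun _ => m := fun m =>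
    funext fun w => if_pos (Finset.mem_univ w)
  have hmax : D.maxDiagonal Finset.univ (fun _ => 1) = 2 * D.numPos - D.numCrossings := by
    unfold maxDiagonal markerSum numPos numCrossings
    rw [hconst]
    simp
  have hmin : D.minDiagonal Finset.univ (fun _ => 1) = D.numCrossings - 2 * D.numNeg := by
    unfold minDiagonal markerSum numNeg numCrossings
    rw [hconst]
    simp
    ring
  rw [cube_univ, hmax, hmin] at main
  constructor
  · intro i j hij
    refine subsingleton_homology ((main i j).1 ?_)
    -- The genus bound puts the window from `maxDiagonal - 4` to `minDiagonal + 4` inside the strip.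
    by_contra hc
    apply hij
    constructor <;> lia
  · intro i j hij
    refine torsionPart_eq_bot ?_
    -- From `maxDiagonal` upwards the lower bound of the strip for `k - 1` holds by the genus bound.
    -- So the upper one fails, and there the homology vanishes altogether.
    by_cases hlow : j - 2 * i < 2 * D.numPos - D.numCrossings
    · exact (main i j).2 hlow
    · refine ((main i j).1 ?_).torsionFreeAt ?_
      · by_contra hc
        apply hij
        constructor <;> lia
      · rw [← cube_univ (fun _ => 1)]
        exact squareZero_cube hev hl hanti _

end

end LinkDiagram

end

theorem corollaryX5p8 {V : Type*} [Fintype V] [LinearOrder V] (D : LinkDiagram V) (k : ℕ)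
    (hsplit : D.IsNonSplit) (halt : D.IsAlmostAlternating k) (hnug : ∀ v, ¬ D.IsNugatory v) :
    D.IsHThick k k ∧ D.IsTHThick k ((k : ℤ) - 1) := by
  rcases isEmpty_or_nonempty V with h | h
  · exact LinkDiagram.thick_of_isEmpty k _
  · exact LinkDiagram.thick_of_isAlmostAlternating hsplit halt
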